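/- **Setting.** Let $Z_i=(X_i,Y_i)$, $i\ge 1$, be i.i.d. with values in $\mathcal X\times\mathcal Y$ (law of $X$: $P_X$; conditional law of $Y$ given $X$: a Markov kernel). Let $H$ be a real normed space (not necessarily complete), $\Theta\subset\mathbb R^{d_\theta}$ compact, $\mathcal A=\Theta\times H$, $\|(\theta,h)\|_s=\|\theta\|+\|h\|$, and let $\rho(Z,\alpha)\in\mathbb R^{d_\rho}$ be a residual function, measurable and integrable in $Z$ for every $\alpha\in\mathcal A$, with $\rho(Z,\alpha_0)$ square integrable. Put $m(x,\alpha)=E[\rho(Z,\alpha)\mid X=x]$, let $\Sigma(x)$ be a weighting matrix, $\Sigma_0(x)=\mathrm{Var}(\rho(Z,\alpha_0)\mid X=x)$, and $Q(\alpha)=E[m(X,\alpha)'\Sigma(X)^{-1}m(X,\alpha)]<\infty$ on $\mathcal A$. Let $\phi:\mathbb R^{d_\theta}\times H\to\mathbb R$ be continuous with pathwise derivative at $\alpha_0$ equal to the $\|\cdot\|_s$-bounded linear functional $\phi'[\cdot]$. $\mathcal H_1\subseteq\mathcal H_2\subseteq\dots$ are finite-dimensional subspaces with dense union, $k(n)\to\infty$,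 $\mathcal A_{k(n)}=\Theta\times\mathcal H_{k(n)}$, $\Pi_n\alpha_0=(\theta_0,\Pi_nh_0)$ with $\Pi_nh_0\in\mathcal H_{k(n)}$, $\lambda_n>0$, $\mathrm{Pen}:H\to[0,\infty)$, and $\eta_n>0$ is a fixed sequence with $n\eta_n\to0$. *Criteria.* For weights $b=(b_1,\dots,b_n)$ let $\hat m^b(x,\alpha)=\sum_i A_n(X_i,x)\,b_i\rho(Z_i,\alpha)$, where $A_n(\cdot,\cdot)$ depends on $X_1,\dots,X_n$, and $\hat Q^b_n(\alpha)=n^{-1}\sum_i\hat m^b(X_i,\alpha)'\hat\Sigma(X_i)^{-1}\hat m^b(X_i,\alpha)$, where all $\hat\Sigma(X_i)$ are positive definite with probability approaching one (wpa1). $\hat Q_n$ is the case $b\equiv1$. $\hat Q^B_n$ is the case $b=\omega=(\omega_{1,n},\dots,\omega_{n,n})$, bootstrap weights independent of the data with $\omega_{i,n}\ge0$, $E\omega_{i,n}=1$, $\lim_n\mathrm{Var}(\omega_{i,n})=\sigma_\omega^2\in(0,\infty)$ for every $i$. *Stochastic orders.* $\Delta_n=o_{P^*}(1)$ means $P(P(|\Delta_n|>\epsilon\mid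 Z^n)>\epsilon)\to0$ for all $\epsilon>0$; $\Delta_n=O_{P^*}(1)$ means that for every $\epsilon>0$ there is $M<\infty$ with $P(P(|\Delta_n|>M\mid Z^n)>\epsilon)\to0$; events hold wpa1$^*$ if $P(P(\text{not }E_n\mid Z^n)>\epsilon)\to0$ for all $\epsilon>0$. Outer probabilities are used for non-measurable events. *Estimators.* $\hat\alpha_n$ (a function of the data) minimizes $\hat Q_n+\lambda_n\mathrm{Pen}$ over $\mathcal A_{k(n)}$ up to $\eta_n$, wpa1; $\hat\alpha^B_n$ and $\hat\alpha^{R,B}_n$ (functions of data and weights) minimize $\hat Q_n^B+\lambda_n\mathrm{Pen}$ up to $\eta_n$, wpa1$^*$, over $\mathcal A_{k(n)}$ and over $\{\alpha\in\mathcal A_{k(n)}:\phi(\alpha)=\hat\phi_n\}$ respectively, where $\hat\phi_n=\phi(\hat\alpha_n)$. **Global conditions.** (a) $\theta_0\in\mathrm{int}\,\Theta$; for $\alpha\in\mathcal A$, $m(X,\alpha)=0$ a.s. iff $\|\alpha-\alpha_0\|_s=0$; $\|\Pi_nh_0-h_0\|\to0$; $Q$ is lower semicontinuous on $\mathcal A$;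 the eigenvalues of the symmetric matrices $\Sigma(X),\Sigma_0(X)$ lie a.s. in some $[c,C]\subset(0,\infty)$. (b) $Q(\Pi_n\alpha_0)+\eta_n=O(\lambda_n)$, $\lambda_n\to0$, $|\mathrm{Pen}(\Pi_nh_0)-\mathrm{Pen}(h_0)|=O(1)$, and all $\{\mathrm{Pen}\le M\}$ are compact. (c) For some constants $c_0,c_0^*>0$: $\hat Q_n(\Pi_n\alpha_0)\le c_0Q(\Pi_n\alpha_0)+\eta_n$ wpa1, and $\hat Q_n^B(\hat\alpha_n)\le c_0^*\hat Q_n(\hat\alpha_n)+\eta_n$ wpa1$^*$. **Local objects.** Fix $M_0$ and sequences $\delta_n>0$, $\bar\delta_n$, $\bar\delta^*_n$ tending to $0$ with $\delta_n\le\bar\delta_n$, $\delta_n\le\bar\delta_n^*$ and $\max\{Q(\Pi_n\alpha_0),\lambda_n,\eta_n\}\le\delta_n^2$ eventually. $\mathcal A_{os}$ is a convex set with $\mathcal A_{os}\subseteq\{\alpha\in\mathcal A:\|\alpha-\alpha_0\|_s<M_0,\mathrm{Pen}(h)\le M_0\}$ containing $\{\alpha\in\mathcal A:\|\alpha-\alpha_0\|_s<r,\mathrm{Pen}(h)\le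 M_0\}$ for some $r>0$; $\mathcal A_{osn}=\mathcal A_{os}\cap\mathcal A_{k(n)}$. For $\alpha\in\mathcal A_{os}$, $\tau\mapsto m(X,\alpha_0+\tau(\alpha-\alpha_0))$, $\tau\in[0,1]$, has at $\tau=0$ a.s. the derivative $m'[\alpha-\alpha_0](X)$, where $m'$ is linear on $\mathbb R^{d_\theta}\times H$ with square integrable values. Put $\langle v,w\rangle=E[m'[v](X)'\Sigma(X)^{-1}m'[w](X)]$, $\|v\|^2=\langle v,v\rangle$. Let $\tau_n=\sup\{\|\alpha-\Pi_n\alpha_0\|_s/\|\alpha-\Pi_n\alpha_0\|:\alpha\in\mathcal A_{osn},\|\alpha-\Pi_n\alpha_0\|\ne0\}$, $\delta_{s,n}=\|h_0-\Pi_nh_0\|+\tau_n\delta_n$ (positive eventually, tending to $0$), $M_n=\min\{\log\log(n+1),\log(\delta_{s,n}^{-1}+1)\}$, $$\mathcal N_{osn}=\{\alpha\in\mathcal A_{k(n)}:\|\alpha-\alpha_0\|\le M_n\delta_n,\ \|\alpha-\alpha_0\|_s\le M_n\delta_{s,n},\ \mathrm{Pen}(h)\le M_0\},\qquad \mathcal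 T_n=\{t\in\mathbb R:|t|\le4M_n^2\delta_n\}.$$ $\alpha_{0,n}$ minimizes $\|\alpha-\alpha_0\|$ over $\mathbb R^{d_\theta}\times\mathcal H_{k(n)}$; $\overline V_n$ is the span of $\mathcal A_{osn}-\alpha_{0,n}$, on which $\|\cdot\|$ is a norm for large $n$; $v_n^*\in\overline V_n$ satisfies $\phi'[w]=\langle v_n^*,w\rangle$ for $w\in\overline V_n$; $S_n(Z)=m'[v_n^*](X)'\Sigma(X)^{-1}\rho(Z,\alpha_0)$, $\|v_n^*\|_{sd}^2=\mathrm{Var}(S_n(Z))$, $u_n^*=v_n^*/\|v_n^*\|_{sd}$, and $\mathbb Z_n^b=n^{-1}\sum_ib_iS_n(Z_i)/\|v_n^*\|_{sd}$, $\mathbb Z_n=\mathbb Z_n^1$. **Local conditions.** (d) For some $c,c^*>0$: $\hat Q_n\ge cQ-O_P(\bar\delta_n^2)$ and $\hat Q_n^B\ge c^*\hat Q_n-O_{P^*}(\bar\delta_n^{*2})$ uniformly over $\{\alpha\in\mathcal A_{k(n)}:\mathrm{Pen}(h)\le M_0\}$; the same with the rates $\delta_n^2$ uniformly over $\mathcal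 A_{osn}$. (e) $\|\alpha-\alpha_0\|\le C\|\alpha-\alpha_0\|_s$ and $Q(\alpha)\asymp\|\alpha-\alpha_0\|^2$ on $\mathcal A_{os}$. (f) With $\alpha(t)=\alpha+tu_n^*$ and $h(t)$ its $H$-component, $\lambda_n\sup_{\alpha,\alpha'\in\mathcal N_{osn};\,t,t'\in\mathcal T_n}|\mathrm{Pen}(h(t))-\mathrm{Pen}(h'(t'))|=o(1/n)$. (g) $\phi'[\alpha-\alpha_0]\neq0$ for some $\alpha\in\mathcal A_{os}$; $\|v_n^*\|/\sqrt n\to0$ ($\|v_n^*\|\to\infty$ is allowed: irregular $\phi$); $\sqrt n\,|\phi(\alpha(t))-\phi(\alpha_0)-\phi'[\alpha(t)-\alpha_0]|/\|v_n^*\|\to0$ uniformly over $\mathcal N_{osn}\times\mathcal T_n$; $\sqrt n\,|\phi'[\alpha_{0,n}-\alpha_0]|/\|v_n^*\|\to0$. (h) *LQA*: for large $n$, $\alpha(t)\in\mathcal A_{k(n)}$ on $\mathcal N_{osn}\times\mathcal T_n$, and there are positive, data-measurable $B_n=O_P(1)$ such that, with $r_n(t)=\max\{t^2,|t|n^{-1/2},\eta_n\}^{-1}$,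 $$\sup_{\mathcal N_{osn}\times\mathcal T_n}r_n(t)\Big|\tfrac12\{\hat Q_n(\alpha(t))-\hat Q_n(\alpha)\}-t\{\mathbb Z_n+\langle u_n^*,\alpha-\alpha_0\rangle\}-\tfrac{B_n}2t^2\Big|=o_P(1),$$ and $\sqrt n\mathbb Z_n\Rightarrow N(0,1)$. (i) *Bootstrap LQA*: the same expansion with $\hat Q_n^B$, $\mathbb Z_n^\omega$, a positive measurable function $B_n^\omega=O_{P^*}(1)$ of data and weights, and $o_{P^*}(1)$; moreover $\sup_{f\in BL_1}|E[f(\sqrt n\mathbb Z_n^{\omega-1}/\sigma_\omega)\mid Z^n]-E f(N(0,1))|=o_P(1)$, with $BL_1=\{f:|f|\le1,\ f\text{ 1-Lipschitz}\}$; and $|B_n^\omega-\|u_n^*\|^2|=o_{P^*}(1)$. **Theorem.** Under the global conditions there is a finite $\underline M$ such that, whenever $M_0\ge\underline M$ and the local conditions hold, the following is true for every bootstrap SQLR statistic $\widehat{QLR}{}^B_n(\hat\phi_n)=n\big(\hat Q_n^B(\hat\alpha_n^{R,B})-\hat Q_n^B(\hat\alpha_n^B)\big)+o_{P^*}(1)$.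 (1) $\displaystyle \frac{\widehat{QLR}{}^B_n(\hat\phi_n)}{\sigma_\omega^2}=\Big(\sqrt n\,\frac{\mathbb Z_n^{\omega-1}}{\sigma_\omega\|u_n^*\|}\Big)^2+o_{P^*}(1)=O_{P^*}(1).$ Assume moreover that $\phi(\alpha_0)=\phi_0$, that $|B_n-\|u_n^*\|^2|=o_P(1)$, that $\hat\alpha_n^R$ minimizes $\hat Q_n+\lambda_n\mathrm{Pen}$ over $\{\alpha\in\mathcal A_{k(n)}:\phi(\alpha)=\phi_0\}$ up to $\eta_n$ wpa1, that $\hat\alpha_n^R\in\mathcal N_{osn}$ wpa1, and let $\widehat{QLR}_n(\phi_0)=n\big(\hat Q_n(\hat\alpha_n^R)-\hat Q_n(\hat\alpha_n)\big)+o_P(1)$. Then (2) $\displaystyle \sup_{t\in\mathbb R}\Big|P\Big(\frac{\widehat{QLR}{}^B_n(\hat\phi_n)}{\sigma_\omega^2}\le t\,\Big|\,Z^n\Big)-P\big(\widehat{QLR}_n(\phi_0)\le t\big)\Big|=o_{P^*}(1)$; (3) for every $a\in(0,1)$, $\lim_nP\big(\widehat{QLR}_n(\phi_0)\ge\hat c_n(1-a)\big)=a$,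 where $\hat c_n(s)=\inf\{t: P(\widehat{QLR}{}^B_n(\hat\phi_n)/\sigma_\omega^2\le t\mid Z^n)\ge s\}$. Neither $\Sigma=\Sigma_0$ (optimal weighting) nor regularity of $\phi$ is assumed. -/

import Mathlib

open MeasureTheory ProbabilityTheory Filter Topology Set
open scoped ENNReal NNReal Matrix

noncomputable section

namespace PSMD

/-! ### Stochastic orders

All probabilities of possibly non-measurable events are outer probabilities. `P` is the law of the
data and `R` the law of the bootstrap weights; the enlarged space is the product of the two spaces,
so that the conditional probability given the data of an event is the `R`-probability of its
section. -/

section Orders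

variable {S W : Type*} [MeasurableSpace S] [MeasurableSpace W]

/-- The events `Ev n` hold with probability approaching one. -/
def Wpa1 (P : Measure S) (Ev : ℕ → S → Prop) : Prop :=
  Tendsto (fun n => P {z | ¬ Ev n z}) atTop (𝓝 0)

/-- `X n = o_P(1)`. -/
def LittleOP (P : Measure S) (X : ℕ → S → ℝ) : Prop :=
  ∀ ε > 0, Tendsto (fun n => P {z | ε < |X n z|}) atTop (𝓝 0)

/-- `X n = O_P(1)`. -/
def BigOP (P : Measure S) (X : ℕ → S → ℝ) : Prop :=
  ∀ ε > 0, ∃ K > 0, ∀ᶠ n in atTop, P {z | K < |X n z|} ≤ ENNReal.ofReal ε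

/-- Conditionally on the data, the events `Ev n` hold with probability approaching one,
in probability. -/
def CondWpa1 (P : Measure S) (R : Measure W) (Ev : ℕ → S → W → Prop) : Prop :=
  ∀ ε > 0, Tendsto (fun n => P {z | ENNReal.ofReal ε < R {w | ¬ Ev n z w}}) atTop (𝓝 0)

/-- `X n` is `o(1)` in conditional probability given the data, with probability approaching one:
for every `ε > 0`, `P (R (|X n| > ε | data) > ε) → 0`. -/
def CondLittleOP (P : Measure S) (R : Measure W) (X : ℕ → S → W → ℝ) : Prop :=
  ∀ ε > 0, Tendsto (fun n => P {z | ENNReal.ofReal ε < R {w | ε < |X n z w|}}) atTop (𝓝 0)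

/-- `X n` is `O(1)` in conditional probability given the data, with probability approaching one:
for every `ε > 0` there is `K` with `P (R (|X n| > K | data) > ε) → 0`. -/
def CondBigOP (P : Measure S) (R : Measure W) (X : ℕ → S → W → ℝ) : Prop :=
  ∀ ε > 0, ∃ K > 0,
    Tendsto (fun n => P {z | ENNReal.ofReal ε < R {w | K < |X n z w|}}) atTop (𝓝 0)

end Orders

/-- The linear parameter space `ℝ^dθ × H` of pairs `(θ, h)`. -/
abbrev Par (dθ : ℕ) (H : Type*) : Type _ := EuclideanSpace ℝ (Fin dθ) × H

/-- The strong norm `‖θ‖ + ‖h‖`. -/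
def snorm {dθ : ℕ} {H : Type*} [NormedAddCommGroup H] (α : Par dθ H) : ℝ := ‖α.1‖ + ‖α.2‖

/-- A semi/nonparametric conditional moment model, with all the ingredients of penalized sieve
minimum distance (PSMD) estimation and of its generalized residual bootstrap.
Functions of the sample of size `n` take a vector `zs : Fin n → 𝒳 × 𝒴` of observations
`z = (x, y)`; functions of the bootstrap sample also take a vector of weights `ws : Fin n → ℝ`. -/
structure Model (dθ dρ : ℕ) (H 𝒳 𝒴 W : Type*) [NormedAddCommGroup H] [NormedSpace ℝ H]
    [MeasurableSpace 𝒳] [MeasurableSpace 𝒴] [MeasurableSpace W] where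
  /-- law of `X` -/
  PX : Measure 𝒳
  isProb_PX : IsProbabilityMeasure PX
  /-- conditional law of `Y` given `X` -/
  κ : Kernel 𝒳 𝒴
  isMarkov_κ : IsMarkovKernel κ
  /-- residual function -/
  ρ : 𝒳 × 𝒴 → Par dθ H → Fin dρ → ℝ
  /-- weighting matrix -/
  Sig : 𝒳 → Matrix (Fin dρ) (Fin dρ) ℝ
  /-- parameter set of the Euclidean part -/
  Θ : Set (EuclideanSpace ℝ (Fin dθ))
  /-- true parameter -/
  α₀ : Par dθ H
  /-- functional of interest -/
  φ : Par dθ H → ℝ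
  /-- pathwise derivative of the functional at the true parameter -/
  dφ : Par dθ H →L[ℝ] ℝ
  /-- penalty function -/
  Pen : H → ℝ
  /-- linear sieves -/
  sieve : ℕ → Submodule ℝ H
  /-- sieve index -/
  k : ℕ → ℕ
  /-- sieve approximations of `h₀` -/
  projH : ℕ → H
  /-- penalization parameter -/
  lam : ℕ → ℝ
  /-- the `o(1/n)` sequence which is common to all `o(1/n)` remainders -/
  η : ℕ → ℝ
  /-- coefficients of the linear nonparametric estimator of the conditional mean -/
  A : (n : ℕ) → (Fin n → 𝒳) → 𝒳 → 𝒳 → ℝ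
  /-- estimator of the weighting matrix -/
  SigHat : (n : ℕ) → (Fin n → 𝒳 × 𝒴) → 𝒳 → Matrix (Fin dρ) (Fin dρ) ℝ
  /-- law on the space which carries the bootstrap weights -/
  R : Measure W
  isProb_R : IsProbabilityMeasure R
  /-- `ω n i`, for `i < n`, is the `i`-th bootstrap weight at sample size `n` -/
  ω : ℕ → ℕ → W → ℝ
  /-- limit of the standard deviations of the weights -/
  σ : ℝ
  /-- the PSMD estimator -/
  αhat : (n : ℕ) → (Fin n → 𝒳 × 𝒴) → Par dθ H
  /-- the bootstrap PSMD estimator -/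
  αhatB : (n : ℕ) → (Fin n → 𝒳 × 𝒴) → (Fin n → ℝ) → Par dθ H
  /-- the restricted bootstrap PSMD estimator -/
  αhatRB : (n : ℕ) → (Fin n → 𝒳 × 𝒴) → (Fin n → ℝ) → Par dθ H

attribute [instance] Model.isProb_PX Model.isMarkov_κ Model.isProb_R

namespace Model

variable {dθ dρ : ℕ} {H 𝒳 𝒴 W : Type*} [NormedAddCommGroup H] [NormedSpace ℝ H]
  [MeasurableSpace 𝒳] [MeasurableSpace 𝒴] [MeasurableSpace W]
  (D : Model dθ dρ H 𝒳 𝒴 W)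

/-! ### Population objects -/

/-- Law of one observation `Z = (X, Y)`. -/
def P1 : Measure (𝒳 × 𝒴) := D.PX ⊗ₘ D.κ

instance : IsProbabilityMeasure D.P1 := by unfold P1; infer_instance

/-- Law of the i.i.d. data sequence. -/
def P : Measure (ℕ → 𝒳 × 𝒴) := Measure.infinitePi fun _ => D.P1

instance : IsProbabilityMeasure D.P := by unfold P; infer_instance

/-- The parameter space `Θ × H`. -/
def space : Set (Par dθ H) := {α | α.1 ∈ D.Θ}

/-- The sieve space `Θ × H_{k(n)}`. -/
def sieveSpace (n : ℕ) : Set (Par dθ H) := {α | α.1 ∈ D.Θ ∧ α.2 ∈ D.sieve (D.k n)}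

/-- The approximation `(θ₀, projH n)` of the true parameter. -/
def projA (n : ℕ) : Par dθ H := (D.α₀.1, D.projH n)

/-- `m(x, α) = E[ρ(Z, α) | X = x]`. -/
def m (x : 𝒳) (α : Par dθ H) : Fin dρ → ℝ := fun j => ∫ y, D.ρ (x, y) α j ∂(D.κ x)

/-- `Σ₀(x) = Var(ρ(Z, α₀) | X = x)`. -/
def Sig₀ (x : 𝒳) : Matrix (Fin dρ) (Fin dρ) ℝ := fun i j =>
  ∫ y, (D.ρ (x, y) D.α₀ i - D.m x D.α₀ i) * (D.ρ (x, y) D.α₀ j - D.m x D.α₀ j) ∂(D.κ x)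

/-- Population criterion `Q(α) = E[m(X, α)' Σ(X)⁻¹ m(X, α)]`. -/
def Q (α : Par dθ H) : ℝ := ∫ x, D.m x α ⬝ᵥ ((D.Sig x)⁻¹ *ᵥ D.m x α) ∂D.PX

/-! ### Sample objects -/

/-- The first `n` observations. -/
def obs (n : ℕ) (z : ℕ → 𝒳 × 𝒴) : Fin n → 𝒳 × 𝒴 := fun i => z i

/-- The vector of the bootstrap weights at sample size `n`. -/
def wts (n : ℕ) (w : W) : Fin n → ℝ := fun i => D.ω n i w

/-- Linear nonparametric estimator of `m(x, α)` computed from the weighted residuals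
`b i • ρ(Z_i, α)`. -/
def mhat (n : ℕ) (zs : Fin n → 𝒳 × 𝒴) (b : Fin n → ℝ) (x : 𝒳) (α : Par dθ H) : Fin dρ → ℝ :=
  ∑ i, D.A n (fun j => (zs j).1) (zs i).1 x • (b i • D.ρ (zs i) α)

/-- Sample criterion computed from the weighted residuals `b i • ρ(Z_i, α)`. -/
def crit (n : ℕ) (zs : Fin n → 𝒳 × 𝒴) (b : Fin n → ℝ) (α : Par dθ H) : ℝ :=
  (n : ℝ)⁻¹ * ∑ i, D.mhat n zs b (zs i).1 α ⬝ᵥ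
    ((D.SigHat n zs (zs i).1)⁻¹ *ᵥ D.mhat n zs b (zs i).1 α)

/-- The original-sample criterion. -/
def Qhat (n : ℕ) (zs : Fin n → 𝒳 × 𝒴) (α : Par dθ H) : ℝ := D.crit n zs (fun _ => 1) α

/-- The bootstrap criterion. -/
def QB (n : ℕ) (zs : Fin n → 𝒳 × 𝒴) (ws : Fin n → ℝ) (α : Par dθ H) : ℝ := D.crit n zs ws α

/-- `a` minimizes `crit + λ_n Pen` over `C`, up to `η_n`. -/
def ApproxMin (n : ℕ) (zs : Fin n → 𝒳 × 𝒴) (b : Fin n → ℝ) (C : Set (Par dθ H))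
    (a : Par dθ H) : Prop :=
  a ∈ C ∧ ∀ α ∈ C, D.crit n zs b a + D.lam n * D.Pen a.2
    ≤ D.crit n zs b α + D.lam n * D.Pen α.2 + D.η n

/-- Symmetric matrices with eigenvalues in `[c, C]`. -/
def EigenvaluesIn (c C : ℝ) (V : Matrix (Fin dρ) (Fin dρ) ℝ) : Prop :=
  V.IsSymm ∧ ∀ a : Fin dρ → ℝ, c * (a ⬝ᵥ a) ≤ a ⬝ᵥ (V *ᵥ a) ∧ a ⬝ᵥ (V *ᵥ a) ≤ C * (a ⬝ᵥ a)

/-- Conditions on the model, the sieves, the criterion, the penalty, the weights and the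
estimators that do not involve a neighbourhood of the true parameter. -/
structure Basic : Prop where
  -- residual function, weighting matrix and functional
  meas_ρ : ∀ α ∈ D.space, Measurable fun z => D.ρ z α
  int_ρ : ∀ α ∈ D.space, Integrable (fun z => D.ρ z α) D.P1
  sq_int_ρ : MemLp (fun z => D.ρ z D.α₀) 2 D.P1
  meas_Sig : ∀ i j, Measurable fun x => D.Sig x i j
  int_Q : ∀ α ∈ D.space, Integrable (fun x => D.m x α ⬝ᵥ ((D.Sig x)⁻¹ *ᵥ D.m x α)) D.PX
  cont_φ : Continuous D.φ
  deriv_φ : ∀ v, HasDerivAt (fun s : ℝ => D.φ (D.α₀ + s • v)) (D.dφ v) 0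
  -- the remainder sequence
  η_pos : ∀ n, 0 < D.η n
  η_small : Tendsto (fun n : ℕ => n * D.η n) atTop (𝓝 0)
  -- identification, sieves and criterion
  α₀_mem : D.α₀.1 ∈ interior D.Θ
  ident : ∀ α ∈ D.space, (∀ᵐ x ∂D.PX, D.m x α = 0) ↔ snorm (α - D.α₀) = 0
  compact_Θ : IsCompact D.Θ
  mono_sieve : Monotone D.sieve
  finDim_sieve : ∀ j, FiniteDimensional ℝ (D.sieve j)
  dense_sieve : Dense (⋃ j, (D.sieve j : Set H))
  k_tendsto : Tendsto D.k atTop atTop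
  projH_mem : ∀ n, D.projH n ∈ D.sieve (D.k n)
  projH_tendsto : Tendsto (fun n => ‖D.projH n - D.α₀.2‖) atTop (𝓝 0)
  lsc_Q : LowerSemicontinuousOn D.Q D.space
  eigen : ∃ c > 0, ∃ C, ∀ᵐ x ∂D.PX, EigenvaluesIn c C (D.Sig x) ∧ EigenvaluesIn c C (D.Sig₀ x)
  -- penalty
  lam_pos : ∀ n, 0 < D.lam n
  lam_tendsto : Tendsto D.lam atTop (𝓝 0)
  lam_big : ∃ C, ∀ᶠ n in atTop, D.Q (D.projA n) + D.η n ≤ C * D.lam n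
  pen_bdd : ∃ C, ∀ᶠ n in atTop, |D.Pen (D.projH n) - D.Pen D.α₀.2| ≤ C
  pen_nonneg : ∀ h, 0 ≤ D.Pen h
  pen_compact : ∀ C, IsCompact {h | D.Pen h ≤ C}
  -- bootstrap weights
  meas_ω : ∀ n i, Measurable (D.ω n i)
  ω_nonneg : ∀ n, ∀ i < n, ∀ w, 0 ≤ D.ω n i w
  ω_mean : ∀ n, ∀ i < n, ∫ w, D.ω n i w ∂D.R = 1
  σ_pos : 0 < D.σ
  ω_var : ∀ i, Tendsto (fun n => variance (D.ω n i) D.R) atTop (𝓝 (D.σ ^ 2))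
  -- estimators
  posDef_SigHat : Wpa1 D.P fun n z => ∀ i, (D.SigHat n (obs n z) (obs n z i).1).PosDef
  est : Wpa1 D.P fun n z =>
    D.ApproxMin n (obs n z) (fun _ => 1) (D.sieveSpace n) (D.αhat n (obs n z))
  estB : CondWpa1 D.P D.R fun n z w =>
    D.ApproxMin n (obs n z) (D.wts n w) (D.sieveSpace n) (D.αhatB n (obs n z) (D.wts n w))
  estRB : CondWpa1 D.P D.R fun n z w =>
    D.ApproxMin n (obs n z) (D.wts n w)
      {α ∈ D.sieveSpace n | D.φ α = D.φ (D.αhat n (obs n z))} (D.αhatRB n (obs n z) (D.wts n w))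
  -- upper bounds on the sample criteria
  upper : ∃ c > 0, Wpa1 D.P fun n z =>
    D.Qhat n (obs n z) (D.projA n) ≤ c * D.Q (D.projA n) + D.η n
  upperB : ∃ c > 0, CondWpa1 D.P D.R fun n z w =>
    D.QB n (obs n z) (D.wts n w) (D.αhat n (obs n z))
      ≤ c * D.Qhat n (obs n z) (D.αhat n (obs n z)) + D.η n

/-! ### Local objects -/

/-- Objects attached to a neighbourhood of the true parameter. -/
structure Loc (D : Model dθ dρ H 𝒳 𝒴 W) where
  /-- the bound `M₀` on penalties and strong norms -/
  M₀ : ℝ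
  /-- rate of the sample criterion over `{Pen ≤ M₀}` -/
  δbar : ℕ → ℝ
  /-- local rate of the sample criterion -/
  δ : ℕ → ℝ
  /-- rate of the bootstrap criterion over `{Pen ≤ M₀}` -/
  δbarB : ℕ → ℝ
  /-- the neighbourhood of the true parameter -/
  Aos : Set (Par dθ H)
  /-- pathwise derivative `dm(x, α₀)/dα [v]` -/
  dm : Par dθ H →ₗ[ℝ] (𝒳 → Fin dρ → ℝ)
  /-- best sieve approximation of the true parameter in the weak norm -/
  α₀n : ℕ → Par dθ H
  /-- sieve Riesz representer -/
  v : ℕ → Par dθ H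
  /-- curvature of the sample criterion -/
  B : (n : ℕ) → (Fin n → 𝒳 × 𝒴) → ℝ
  /-- curvature of the bootstrap criterion -/
  Bω : (n : ℕ) → (Fin n → 𝒳 × 𝒴) → (Fin n → ℝ) → ℝ

namespace Loc

variable {D} (L : Loc D)

/-- The weak inner product `⟨v₁, v₂⟩ = E[(dm[v₁])' Σ⁻¹ dm[v₂]]`. -/
def winner (v₁ v₂ : Par dθ H) : ℝ := ∫ x, L.dm v₁ x ⬝ᵥ ((D.Sig x)⁻¹ *ᵥ L.dm v₂ x) ∂D.PX

/-- The weak norm. -/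
def wnorm (v : Par dθ H) : ℝ := √(L.winner v v)

/-- `{α in the sieve space : Pen ≤ M₀}`. -/
def penSieve (n : ℕ) : Set (Par dθ H) := {α ∈ D.sieveSpace n | D.Pen α.2 ≤ L.M₀}

/-- Intersection of the neighbourhood with the sieve space. -/
def Aosn (n : ℕ) : Set (Par dθ H) := L.Aos ∩ D.sieveSpace n

/-- Sieve measure of local ill-posedness. -/
def τ (n : ℕ) : ℝ :=
  sSup {r | ∃ α ∈ L.Aosn n, L.wnorm (α - D.projA n) ≠ 0 ∧
    r = snorm (α - D.projA n) / L.wnorm (α - D.projA n)}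

/-- Rate in the strong norm. -/
def δs (n : ℕ) : ℝ := ‖D.α₀.2 - D.projH n‖ + L.τ n * L.δ n

/-- The slowly diverging sequence `M_n`. -/
def Mseq (n : ℕ) : ℝ :=
  min (Real.log (Real.log ((n : ℝ) + 1))) (Real.log ((L.δs n)⁻¹ + 1))

/-- The shrinking sieve neighbourhood `N_osn`. -/
def Nosn (n : ℕ) : Set (Par dθ H) :=
  {α ∈ D.sieveSpace n | L.wnorm (α - D.α₀) ≤ L.Mseq n * L.δ n ∧
    snorm (α - D.α₀) ≤ L.Mseq n * L.δs n ∧ D.Pen α.2 ≤ L.M₀}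

/-- The range of perturbations. -/
def T (n : ℕ) : Set ℝ := {t | |t| ≤ 4 * L.Mseq n ^ 2 * L.δ n}

/-- The linear span of `A_osn - α₀n`. -/
def Vbar (n : ℕ) : Submodule ℝ (Par dθ H) :=
  Submodule.span ℝ ((fun α => α - L.α₀n n) '' L.Aosn n)

/-- Score in the direction `v`. -/
def score (v : Par dθ H) (z : 𝒳 × 𝒴) : ℝ :=
  L.dm v z.1 ⬝ᵥ ((D.Sig z.1)⁻¹ *ᵥ D.ρ z D.α₀)

/-- Square root of the sieve variance, i.e. of the variance of the sieve score. -/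
def sd (n : ℕ) : ℝ := √(variance (L.score (L.v n)) D.P1)

/-- Scaled sieve Riesz representer `u_n = v_n / ‖v_n‖_sd`. -/
def u (n : ℕ) : Par dθ H := (L.sd n)⁻¹ • L.v n

/-- `n⁻¹ ∑ b_i (dm(X_i)[u_n])' Σ(X_i)⁻¹ ρ(Z_i, α₀)`. -/
def Z (n : ℕ) (zs : Fin n → 𝒳 × 𝒴) (b : Fin n → ℝ) : ℝ :=
  (n : ℝ)⁻¹ * ∑ i, b i * L.score (L.u n) (zs i)

/-- Remainder of the local quadratic approximation along `u_n` of the criterion with weights `b`. -/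
def remainder (n : ℕ) (zs : Fin n → 𝒳 × 𝒴) (b : Fin n → ℝ) (curv : ℝ) (α : Par dθ H)
    (t : ℝ) : ℝ :=
  (1 / 2) * (D.crit n zs b (α + t • L.u n) - D.crit n zs b α)
    - t * (L.Z n zs b + L.winner (L.u n) (α - D.α₀)) - curv / 2 * t ^ 2

/-- `max {t², |t| n^{-1/2}, o(1/n)}`. -/
def rate (_L : Loc D) (n : ℕ) (t : ℝ) : ℝ := max (max (t ^ 2) (|t| / √n)) (D.η n)

/-- The local conditions: behaviour of the criteria near the true parameter, and local behaviour
of the functional. -/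
structure Regular : Prop where
  -- rates
  δbar_tendsto : Tendsto L.δbar atTop (𝓝 0)
  δ_pos : ∀ n, 0 < L.δ n
  δ_tendsto : Tendsto L.δ atTop (𝓝 0)
  δ_le : ∀ n, L.δ n ≤ L.δbar n
  δbarB_tendsto : Tendsto L.δbarB atTop (𝓝 0)
  δ_leB : ∀ n, L.δ n ≤ L.δbarB n
  δ_max : ∀ᶠ n in atTop, max (max (D.Q (D.projA n)) (D.lam n)) (D.η n) ≤ L.δ n ^ 2
  δs_pos : ∀ᶠ n in atTop, 0 < L.δs n
  δs_tendsto : Tendsto L.δs atTop (𝓝 0)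
  -- lower bounds on the sample criterion
  lower : ∃ c > 0, ∀ ε > 0, ∃ K > 0, ∀ᶠ n in atTop,
    D.P {z | ∃ α ∈ L.penSieve n, D.Qhat n (obs n z) α < c * D.Q α - K * L.δbar n ^ 2}
      ≤ ENNReal.ofReal ε
  lower_loc : ∃ c > 0, ∀ ε > 0, ∃ K > 0, ∀ᶠ n in atTop,
    D.P {z | ∃ α ∈ L.Aosn n, D.Qhat n (obs n z) α < c * D.Q α - K * L.δ n ^ 2}
      ≤ ENNReal.ofReal ε
  -- lower bounds on the bootstrap criterion
  lowerB : ∃ c > 0, ∀ ε > 0, ∃ K > 0, Tendsto (fun n => D.P {z | ENNReal.ofReal ε <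
    D.R {w | ∃ α ∈ L.penSieve n, D.QB n (obs n z) (D.wts n w) α
      < c * D.Qhat n (obs n z) α - K * L.δbarB n ^ 2}}) atTop (𝓝 0)
  lowerB_loc : ∃ c > 0, ∀ ε > 0, ∃ K > 0, Tendsto (fun n => D.P {z | ENNReal.ofReal ε <
    D.R {w | ∃ α ∈ L.Aosn n, D.QB n (obs n z) (D.wts n w) α
      < c * D.Qhat n (obs n z) α - K * L.δ n ^ 2}}) atTop (𝓝 0)
  -- the neighbourhood, the pathwise derivative and the local curvature
  Aos_convex : Convex ℝ L.Aos
  Aos_sub : ∀ α ∈ L.Aos, α ∈ D.space ∧ snorm (α - D.α₀) < L.M₀ ∧ D.Pen α.2 ≤ L.M₀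
  Aos_nhd : ∃ r > 0, ∀ α ∈ D.space, snorm (α - D.α₀) < r → D.Pen α.2 ≤ L.M₀ → α ∈ L.Aos
  dm_sq_int : ∀ v, MemLp (L.dm v) 2 D.PX
  dm_deriv : ∀ α ∈ L.Aos, ∀ᵐ x ∂D.PX,
    HasDerivWithinAt (fun s : ℝ => D.m x (D.α₀ + s • (α - D.α₀))) (L.dm (α - D.α₀) x) (Icc 0 1) 0
  weak_le : ∃ C, ∀ α ∈ L.Aos, L.wnorm (α - D.α₀) ≤ C * snorm (α - D.α₀)
  curvature : ∃ c > 0, ∃ C, ∀ α ∈ L.Aos,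
    c * L.wnorm (α - D.α₀) ^ 2 ≤ D.Q α ∧ D.Q α ≤ C * L.wnorm (α - D.α₀) ^ 2
  -- negligible penalty
  pen_negl : ∀ ε > 0, ∀ᶠ n : ℕ in atTop,
    ∀ α ∈ L.Nosn n, ∀ α' ∈ L.Nosn n, ∀ t ∈ L.T n, ∀ t' ∈ L.T n,
      n * (D.lam n * |D.Pen (α + t • L.u n).2 - D.Pen (α' + t' • L.u n).2|) ≤ ε
  -- sieve Riesz representer
  α₀n_mem : ∀ᶠ n in atTop, (L.α₀n n).2 ∈ D.sieve (D.k n)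
  α₀n_min : ∀ᶠ n in atTop, ∀ α : Par dθ H, α.2 ∈ D.sieve (D.k n) →
    L.wnorm (L.α₀n n - D.α₀) ≤ L.wnorm (α - D.α₀)
  nondeg : ∀ᶠ n in atTop, ∀ v ∈ L.Vbar n, L.wnorm v = 0 → v = 0
  v_mem : ∀ᶠ n in atTop, L.v n ∈ L.Vbar n
  riesz : ∀ᶠ n in atTop, ∀ w ∈ L.Vbar n, D.dφ w = L.winner (L.v n) w
  -- local behaviour of the functional
  dφ_ne : ∃ α ∈ L.Aos, D.dφ (α - D.α₀) ≠ 0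
  v_small : Tendsto (fun n : ℕ => L.wnorm (L.v n) / √n) atTop (𝓝 0)
  φ_nonlin : ∀ ε > 0, ∀ᶠ n : ℕ in atTop, ∀ α ∈ L.Nosn n, ∀ t ∈ L.T n,
    √n * |D.φ (α + t • L.u n) - D.φ D.α₀ - D.dφ (α + t • L.u n - D.α₀)| ≤ ε * L.wnorm (L.v n)
  φ_bias : ∀ ε > 0, ∀ᶠ n : ℕ in atTop,
    √n * |D.dφ (L.α₀n n - D.α₀)| ≤ ε * L.wnorm (L.v n)

/-- Local quadratic approximation of the sample criterion, with asymptotic normality of the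
score. -/
structure LQA : Prop where
  perturb : ∀ᶠ n in atTop, ∀ α ∈ L.Nosn n, ∀ t ∈ L.T n, α + t • L.u n ∈ D.sieveSpace n
  expansion : ∀ ε > 0, Tendsto (fun n => D.P {z | ∃ α ∈ L.Nosn n, ∃ t ∈ L.T n,
    ε * L.rate n t < |L.remainder n (obs n z) (fun _ => 1) (L.B n (obs n z)) α t|}) atTop (𝓝 0)
  B_meas : ∀ n, Measurable (L.B n)
  B_pos : ∀ n zs, 0 < L.B n zs
  B_bdd : BigOP D.P fun n z => L.B n (obs n z)
  normal : TendstoInDistribution (fun (n : ℕ) z => √n * L.Z n (obs n z) fun _ => 1) atTop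
    (id : ℝ → ℝ) (fun _ => D.P) (gaussianReal 0 1)

/-- `√n Z_n^{ω-1}`. -/
def bootScore (n : ℕ) (z : ℕ → 𝒳 × 𝒴) (w : W) : ℝ :=
  √n * L.Z n (obs n z) fun i => D.wts n w i - 1

/-- Local quadratic approximation of the bootstrap criterion, with conditional asymptotic normality
of the bootstrap score in the bounded Lipschitz distance. -/
structure LQAB : Prop where
  perturb : ∀ᶠ n in atTop, ∀ α ∈ L.Nosn n, ∀ t ∈ L.T n, α + t • L.u n ∈ D.sieveSpace n
  expansion : ∀ ε > 0, Tendsto (fun n => D.P {z | ENNReal.ofReal ε < D.R {w |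
    ∃ α ∈ L.Nosn n, ∃ t ∈ L.T n, ε * L.rate n t <
      |L.remainder n (obs n z) (D.wts n w) (L.Bω n (obs n z) (D.wts n w)) α t|}}) atTop (𝓝 0)
  Bω_meas : ∀ n, Measurable fun p : (Fin n → 𝒳 × 𝒴) × (Fin n → ℝ) => L.Bω n p.1 p.2
  Bω_pos : ∀ n zs ws, 0 < L.Bω n zs ws
  Bω_bdd : CondBigOP D.P D.R fun n z w => L.Bω n (obs n z) (D.wts n w)
  normal : ∀ ε > 0, Tendsto (fun n => D.P {z | ∃ f : ℝ → ℝ, (∀ x, |f x| ≤ 1) ∧ LipschitzWith 1 f ∧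
    ε < |∫ w, f (L.bootScore n z w / D.σ) ∂D.R - ∫ x, f x ∂(gaussianReal 0 1)|}) atTop (𝓝 0)

end Loc

/-! ### Test statistics -/

/-- `TB` is a bootstrap SQLR statistic:
`n (Q^B(αhatRB) - Q^B(αhatB))` up to a negligible term. -/
def IsBootSQLR (TB : (n : ℕ) → (Fin n → 𝒳 × 𝒴) → (Fin n → ℝ) → ℝ) : Prop :=
  CondLittleOP D.P D.R fun n z w => TB n (obs n z) (D.wts n w) -
    n * (D.QB n (obs n z) (D.wts n w) (D.αhatRB n (obs n z) (D.wts n w))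
      - D.QB n (obs n z) (D.wts n w) (D.αhatB n (obs n z) (D.wts n w)))

/-- `αR` is a restricted PSMD estimator under the restriction `φ(α) = φ₀`. -/
def IsRestrictedEst (φ₀ : ℝ) (αR : (n : ℕ) → (Fin n → 𝒳 × 𝒴) → Par dθ H) : Prop :=
  Wpa1 D.P fun n z => D.ApproxMin n (obs n z) (fun _ => 1) {α ∈ D.sieveSpace n | D.φ α = φ₀}
    (αR n (obs n z))

/-- `T` is an SQLR statistic based on the restricted estimator `αR`:
`n (Qhat(αR) - Qhat(αhat))` up to a negligible term. -/
def IsSQLR (αR : (n : ℕ) → (Fin n → 𝒳 × 𝒴) → Par dθ H)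
    (T : (n : ℕ) → (Fin n → 𝒳 × 𝒴) → ℝ) : Prop :=
  LittleOP D.P fun n z => T n (obs n z) -
    n * (D.Qhat n (obs n z) (αR n (obs n z)) - D.Qhat n (obs n z) (D.αhat n (obs n z)))

/-- Conditional distribution function, given the data, of `TB / σ²`. -/
def bootCDF (TB : (n : ℕ) → (Fin n → 𝒳 × 𝒴) → (Fin n → ℝ) → ℝ) (n : ℕ) (z : ℕ → 𝒳 × 𝒴)
    (t : ℝ) : ℝ :=
  D.R.real {w | TB n (obs n z) (D.wts n w) / D.σ ^ 2 ≤ t}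

/-- The `a`-quantile of the conditional distribution, given the data, of `TB / σ²`. -/
def bootQuantile (TB : (n : ℕ) → (Fin n → 𝒳 × 𝒴) → (Fin n → ℝ) → ℝ) (n : ℕ) (z : ℕ → 𝒳 × 𝒴)
    (a : ℝ) : ℝ :=
  sInf {t | a ≤ D.bootCDF TB n z t}

end Model

end PSMD

end

namespace PSMD

/-! ### Calculus of stochastic orders -/

section Orders

variable {S W : Type*} [MeasurableSpace S] [MeasurableSpace W] {P : Measure S} {R : Measure W}

/-! Everything happens on the paths `α + (x / √n) • u_n`. Along such a path the local quadratic
approximation gives, for either criterion, n times its increment as approximately `2 x S(α) + B x²`,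
with slope `S(α) = √n (Z + ⟨u_n, α - α₀⟩)` and curvature close to `s = ‖u_n‖²`, while the functional
moves linearly: `√n (φ - φ(α₀)) / ‖v_n‖_sd` is close to `√n ⟨u_n, α - α₀⟩ + x s`. The penalty is
negligible on this scale, so an unrestricted minimizer must have slope close to 0, and a restricted
one has its value of `√n ⟨u_n, α - α₀⟩` prescribed by the restriction. If `y` denotes the resulting
slope at the restricted minimizer, then n times the gap between the two minima is close to `y² / s`.
For the lower bound, move from the restricted minimizer by `x = -y / s`; for the upper bound, move
from the unrestricted one until the restriction holds exactly, which the intermediate value theorem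
makes possible at some `x` near `y / s`. This is `abs_sub_sq_div_le_of_approx_quadratic`, applied in
`eventually_abs_crit_sub_le`.

For the original sample under the null, `y = √n Z_n`. For the bootstrap, the restriction is `φ(α) =
φ(αhat)`, so `y = √n (Z_n^ω + ⟨u_n, αhat - α₀⟩)`, which is `√n Z_n^{ω-1}` plus the slope of the
original criterion at `αhat`. That last slope is negligible because `αhat` minimizes the original
criterion, which is how the bootstrap score becomes centred.

Three facts make this applicable. The estimators lie in the shrinking neighbourhoods: comparing them
with `projA` or with `αhat` bounds penalty and criterion (`exists_admissible`), compactness and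
lower semicontinuity give consistency, and the lower bounds on the criteria together with the
ill-posedness measure `τ` give rates (`mem_Nosn_of_Q_le`). Next, `s` stays between positive
constants, since the variance of the score and the squared weak norm are both comparable to `E[b'b]`
with `b = Σ⁻¹ dm[v]` (`variance_score_bounds`). Finally, steps of order `n^{-1/2}` must be allowed
perturbations. This is not assumed but forced by asymptotic normality: if `√n M_n² δ_n` stayed
bounded, nonnegativity of the criterion and the rates would make `√n Z_n` too small to be standard
normal (`eventually_div_sqrt_mem_T`).

Since `s` need not converge, neither statistic need have a limit law. Both are compared, uniformly
in the argument, with the same law depending on n, that of the square of a standard normal variable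
divided by `s`; this yields the statement on distribution functions and, by sandwiching the
bootstrap quantile, the one on critical values. -/

theorem Wpa1.mono {E E' : ℕ → S → Prop} (h : Wpa1 P E)
    (hE : ∀ᶠ n in atTop, ∀ z, E n z → E' n z) : Wpa1 P E' := by
  refine tendsto_of_tendsto_of_tendsto_of_le_of_le' tendsto_const_nhds h
    (Eventually.of_forall fun _ => zero_le) ?_
  filter_upwards [hE] with n hn
  exact measure_mono fun z hz hz' => hz (hn z hz')

theorem Wpa1.and {E E' : ℕ → S → Prop} (h : Wpa1 P E) (h' : Wpa1 P E') :
    Wpa1 P fun n z => E n z ∧ E' n z := by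
  have := Tendsto.add h h'
  rw [add_zero] at this
  refine tendsto_of_tendsto_of_tendsto_of_le_of_le tendsto_const_nhds this
    (fun _ => zero_le) fun n => ?_
  refine (measure_mono fun z hz => ?_).trans (measure_union_le _ _)
  by_cases hE : E n z
  · exact Or.inr fun h2 => hz ⟨hE, h2⟩
  · exact Or.inl hE

theorem wpa1_iff {E : ℕ → S → Prop} :
    Wpa1 P E ↔ ∀ ε > 0, ∀ᶠ n in atTop, P {z | ¬ E n z} ≤ ENNReal.ofReal ε := by
  unfold Wpa1
  rw [ENNReal.tendsto_nhds_zero]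
  constructor
  · intro h ε hε
    exact h _ (ENNReal.ofReal_pos.2 hε)
  · intro h ε hε
    rcases eq_or_ne ε ⊤ with rfl | ht
    · simp
    · filter_upwards [h ε.toReal (ENNReal.toReal_pos hε.ne' ht)] with n hn
      rwa [ENNReal.ofReal_toReal ht] at hn

/-- A family of events indexed by a constant which hold with probability close to one for large
constants may be assumed to hold for some constant. -/
theorem Wpa1.of_tight {G : ℝ → ℕ → S → Prop} {E : ℕ → S → Prop}
    (hG : ∀ ε > 0, ∃ K > 0, ∀ᶠ n in atTop, P {z | ¬ G K n z} ≤ ENNReal.ofReal ε)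
    (h : ∀ K > 0, Wpa1 P fun n z => G K n z → E n z) : Wpa1 P E := by
  rw [wpa1_iff]
  intro ε hε
  obtain ⟨K, hK, hG⟩ := hG (ε / 2) (by positivity)
  filter_upwards [hG, wpa1_iff.1 (h K hK) (ε / 2) (by positivity)] with n h1 h2
  calc P {z | ¬ E n z} ≤ P ({z | ¬ G K n z} ∪ {z | ¬ (G K n z → E n z)}) := by
        refine measure_mono fun z hz => ?_
        by_cases hg : G K n z
        · exact Or.inr fun h => hz (h hg)
        · exact Or.inl hg
    _ ≤ ENNReal.ofReal (ε / 2) + ENNReal.ofReal (ε / 2) :=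
        (measure_union_le _ _).trans (add_le_add h1 h2)
    _ = ENNReal.ofReal ε := by
        rw [← ENNReal.ofReal_add (by positivity) (by positivity), add_halves]

theorem littleOP_iff {X : ℕ → S → ℝ} :
    LittleOP P X ↔ ∀ ε > 0, Wpa1 P fun n z => |X n z| ≤ ε := by
  simp only [LittleOP, Wpa1, not_le]

theorem BigOP.tight {X : ℕ → S → ℝ} (h : BigOP P X) :
    ∀ ε > 0, ∃ K > 0, ∀ᶠ n in atTop, P {z | ¬ |X n z| ≤ K} ≤ ENNReal.ofReal ε := by
  simpa only [not_le] using! h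

theorem condWpa1_iff {E : ℕ → S → W → Prop} :
    CondWpa1 P R E ↔ ∀ ε > 0, Wpa1 P fun n z => R {w | ¬ E n z w} ≤ ENNReal.ofReal ε := by
  simp only [CondWpa1, Wpa1, not_le]

theorem CondWpa1.mono {E E' : ℕ → S → W → Prop} (h : CondWpa1 P R E)
    (hE : ∀ᶠ n in atTop, ∀ z w, E n z w → E' n z w) : CondWpa1 P R E' := by
  rw [condWpa1_iff] at h ⊢
  intro ε hε
  refine (h ε hε).mono ?_
  filter_upwards [hE] with n hn z hz
  exact le_trans (measure_mono fun w hw hw' => hw (hn z w hw')) hz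

theorem CondWpa1.and {E E' : ℕ → S → W → Prop} (h : CondWpa1 P R E) (h' : CondWpa1 P R E') :
    CondWpa1 P R fun n z w => E n z w ∧ E' n z w := by
  rw [condWpa1_iff] at h h' ⊢
  intro ε hε
  refine ((h (ε / 2) (by positivity)).and (h' (ε / 2) (by positivity))).mono
    (Eventually.of_forall fun n z hz => ?_)
  calc R {w | ¬ (E n z w ∧ E' n z w)} ≤ R ({w | ¬ E n z w} ∪ {w | ¬ E' n z w}) := by
        refine measure_mono fun w hw => ?_
        by_cases hE : E n z w
        · exact Or.inr fun h2 => hw ⟨hE, h2⟩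
        · exact Or.inl hE
    _ ≤ ENNReal.ofReal (ε / 2) + ENNReal.ofReal (ε / 2) :=
        (measure_union_le _ _).trans (add_le_add hz.1 hz.2)
    _ = ENNReal.ofReal ε := by
        rw [← ENNReal.ofReal_add (by positivity) (by positivity), add_halves]

theorem Wpa1.cond {E : ℕ → S → Prop} (h : Wpa1 P E) : CondWpa1 P R fun n z _ => E n z := by
  rw [condWpa1_iff]
  intro ε hε
  refine h.mono (Eventually.of_forall fun n z hz => ?_)
  simp [hz]

/-- Remainders of order one come with a constant that depends on the tolerated probability.
Splitting the tolerance in two allows the constant to be frozen before arguing on events. -/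
theorem CondWpa1.of_tight {G : ℝ → ℕ → S → W → Prop} {E : ℕ → S → W → Prop}
    (hG : ∀ ε > 0, ∃ K > 0,
      Tendsto (fun n => P {z | ENNReal.ofReal ε < R {w | ¬ G K n z w}}) atTop (𝓝 0))
    (h : ∀ K > 0, CondWpa1 P R fun n z w => G K n z w → E n z w) : CondWpa1 P R E := by
  rw [condWpa1_iff]
  intro ε hε
  obtain ⟨K, hK, hG⟩ := hG (ε / 2) (by positivity)
  have hG' : Wpa1 P fun n z => R {w | ¬ G K n z w} ≤ ENNReal.ofReal (ε / 2) := by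
    simpa only [Wpa1, not_le] using hG
  refine (hG'.and (condWpa1_iff.1 (h K hK) (ε / 2) (by positivity))).mono
    (Eventually.of_forall fun n z hz => ?_)
  calc R {w | ¬ E n z w} ≤ R ({w | ¬ G K n z w} ∪ {w | ¬ (G K n z w → E n z w)}) := by
        refine measure_mono fun w hw => ?_
        by_cases hg : G K n z w
        · exact Or.inr fun h => hw (h hg)
        · exact Or.inl hg
    _ ≤ ENNReal.ofReal (ε / 2) + ENNReal.ofReal (ε / 2) :=
        (measure_union_le _ _).trans (add_le_add hz.1 hz.2)
    _ = ENNReal.ofReal ε := by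
        rw [← ENNReal.ofReal_add (by positivity) (by positivity), add_halves]

/-- Variant for constants governed by the data alone, where the tolerance is spent on the outer
probability. -/
theorem CondWpa1.of_tight_data {G : ℝ → ℕ → S → Prop} {E : ℕ → S → W → Prop}
    (hG : ∀ ε > 0, ∃ K > 0, ∀ᶠ n in atTop, P {z | ¬ G K n z} ≤ ENNReal.ofReal ε)
    (h : ∀ K > 0, CondWpa1 P R fun n z w => G K n z → E n z w) : CondWpa1 P R E := by
  rw [condWpa1_iff]
  intro ε hε
  refine Wpa1.of_tight hG fun K hK => (condWpa1_iff.1 (h K hK) ε hε).mono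
    (Eventually.of_forall fun n z hz hg => ?_)
  simpa [hg] using hz

/-- The definition uses one `ε` both as size of the deviation and as bound on its conditional
probability. Taking the minimum of two tolerances decouples them. -/
theorem condLittleOP_iff {X : ℕ → S → W → ℝ} :
    CondLittleOP P R X ↔ ∀ ε > 0, CondWpa1 P R fun n z w => |X n z w| ≤ ε := by
  constructor
  · intro h ε hε
    rw [condWpa1_iff]
    intro ε' hε'
    have h1 : Wpa1 P fun n z => R {w | min ε ε' < |X n z w|} ≤ ENNReal.ofReal (min ε ε') := by
      simpa only [Wpa1, not_le] using! h (min ε ε') (lt_min hε hε')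
    refine h1.mono (Eventually.of_forall fun n z hz => ?_)
    refine (measure_mono fun w hw => ?_).trans
      (hz.trans (ENNReal.ofReal_le_ofReal (min_le_right _ _)))
    exact (min_le_left _ _).trans_lt (not_le.1 hw)
  · intro h ε hε
    have := h ε hε ε hε
    simpa only [not_le] using this

theorem CondBigOP.tight {X : ℕ → S → W → ℝ} (h : CondBigOP P R X) :
    ∀ ε > 0, ∃ K > 0,
      Tendsto (fun n => P {z | ENNReal.ofReal ε < R {w | ¬ |X n z w| ≤ K}}) atTop (𝓝 0) := by
  simpa only [not_le] using! h

theorem CondBigOP.of_condWpa1 {X Y : ℕ → S → W → ℝ} {f : ℝ → ℝ} (h : CondBigOP P R X)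
    (hY : ∀ K > 0, CondWpa1 P R fun n z w => |X n z w| ≤ K → |Y n z w| ≤ f K)
    : CondBigOP P R Y := by
  intro ε hε
  obtain ⟨K, hK, hG⟩ := h (ε / 2) (by positivity)
  refine ⟨max (f K) 1, lt_max_of_lt_right one_pos, ?_⟩
  have hG' : Wpa1 P fun n z => R {w | K < |X n z w|} ≤ ENNReal.ofReal (ε / 2) := by
    simpa only [Wpa1, not_le] using hG
  suffices Wpa1 P fun n z => R {w | max (f K) 1 < |Y n z w|} ≤ ENNReal.ofReal ε by
    simpa only [Wpa1, not_le] using this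
  refine (hG'.and (condWpa1_iff.1 (hY K hK) (ε / 2) (by positivity))).mono
    (Eventually.of_forall fun n z hz => ?_)
  calc R {w | max (f K) 1 < |Y n z w|}
      ≤ R ({w | K < |X n z w|} ∪ {w | ¬ (|X n z w| ≤ K → |Y n z w| ≤ f K)}) := by
        refine measure_mono fun w hw => ?_
        by_cases hg : |X n z w| ≤ K
        · exact Or.inr fun h => absurd ((h hg).trans (le_max_left _ 1)) (not_le.2 hw)
        · exact Or.inl (not_le.1 hg)
    _ ≤ ENNReal.ofReal (ε / 2) + ENNReal.ofReal (ε / 2) :=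
        (measure_union_le _ _).trans (add_le_add hz.1 hz.2)
    _ = ENNReal.ofReal ε := by
        rw [← ENNReal.ofReal_add (by positivity) (by positivity), add_halves]

theorem condLittleOP_of_littleOP {X : ℕ → S → ℝ} (h : LittleOP P X) :
    CondLittleOP P R fun n z _ => X n z :=
  condLittleOP_iff.2 fun ε hε => (littleOP_iff.1 h ε hε).cond

end Orders


/-! ### Approximately quadratic functions of one variable -/

/-- The slope at `0` of an approximately quadratic function with an approximate minimum at `0` is
small. -/
theorem abs_slope_le_of_approx_quadratic {F : ℝ → ℝ} {d B e : ℝ} (he0 : 0 < e) (he1 : e ≤ 1)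
    (hF : ∀ x, |x| ≤ 1 → |F x - (2 * x * d + B * x ^ 2)| ≤ e) (hmin : ∀ x, |x| ≤ 1 → -e ≤ F x) :
    |d| ≤ (|B| + 2) * √e := by
  have hr : 0 < √e := Real.sqrt_pos.2 he0
  have hr1 : √e ≤ 1 := Real.sqrt_le_one.2 he1
  have hr2 : √e ^ 2 = e := Real.sq_sqrt he0.le
  -- At distance `√e` the quadratic term and the two errors are all of order `e`, so the linear term
  -- cannot exceed that order; the two signs of `x` bound the slope on both sides.
  have key : ∀ x, |x| = √e → -(2 * x * d) ≤ (|B| + 2) * √e ^ 2 := by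
    intro x hx
    have h1 := (abs_le.1 (hF x (hx ▸ hr1))).2
    have h2 := hmin x (hx ▸ hr1)
    have h3 : x ^ 2 = √e ^ 2 := by rw [← sq_abs, hx]
    have h4 : B * x ^ 2 ≤ |B| * √e ^ 2 := by
      rw [h3]; exact mul_le_mul_of_nonneg_right (le_abs_self B) (by positivity)
    rw [hr2] at h4 ⊢
    linarith
  have h1 := key (√e) (abs_of_pos hr)
  have h2 := key (-√e) (by rw [abs_neg, abs_of_pos hr])
  have hB := abs_nonneg B
  rw [abs_le]
  constructor <;> nlinarith

/-- Difference `Δ` between the restricted and the unrestricted minimum of an approximately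
quadratic criterion of curvature `s`; `h = 0` is the restriction, which is approximately linear. -/
theorem abs_sub_sq_div_le_of_approx_quadratic {FU FR h : ℝ → ℝ} {Δ s s₀ y Y B dU dR e : ℝ}
    (hs₀ : 0 < s₀) (hs : s₀ ≤ s) (hy : |y| ≤ Y) (he0 : 0 ≤ e) (he1 : e ≤ 1)
    (hB : |B - s| ≤ e) (hU : |dU| ≤ e) (hR : |dR - y| ≤ e) (hcont : Continuous h)
    (hh : ∀ x, |x| ≤ (Y + 2) / s₀ → |h x - (x * s + dU - y)| ≤ e)
    (hFU : ∀ x, |x| ≤ (Y + 2) / s₀ → |FU x - (2 * x * dU + B * x ^ 2)| ≤ e)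
    (hFR : ∀ x, |x| ≤ (Y + 2) / s₀ → |FR x - (2 * x * dR + B * x ^ 2)| ≤ e)
    (hΔU : ∀ x, |x| ≤ (Y + 2) / s₀ → h x = 0 → Δ ≤ FU x + e)
    (hΔR : ∀ x, |x| ≤ (Y + 2) / s₀ → -e ≤ FR x + Δ) :
    |Δ - y ^ 2 / s| ≤ (((Y + 2) / s₀) ^ 2 + 6 * ((Y + 2) / s₀) + 2) * e := by
  have hspos : 0 < s := hs₀.trans_le hs
  have hY : 0 ≤ Y := (abs_nonneg y).trans hy
  -- Every displacement used below has the form `z / s` with `|z| ≤ |y| + |dU| + e ≤ Y + 2`, or lies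
  -- between two such values.
  set K := (Y + 2) / s₀ with hK
  have hK0 : 0 < K := by positivity
  have hdiv : ∀ z, |z| ≤ Y + 2 → |z / s| ≤ K := fun z hz => by
    rw [abs_div, abs_of_pos hspos]
    exact div_le_div₀ (by positivity) hz hs₀ hs
  have hB' : ∀ x, |x| ≤ K → |(B - s) * x ^ 2| ≤ K ^ 2 * e := fun x hx => by
    rw [abs_mul, abs_of_nonneg (sq_nonneg x), ← sq_abs, mul_comm (K ^ 2)]
    exact mul_le_mul hB (pow_le_pow_left₀ (abs_nonneg x) hx 2) (by positivity) he0
  have hy' := abs_le.1 hy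
  have hU' := abs_le.1 hU
  have hR' := abs_le.1 hR
  rw [abs_le]
  constructor
  -- Lower bound: `x = -y / s` minimizes `2 x y + s x²`, with value `-y² / s`.
  · have hx : |-y / s| ≤ K := hdiv _ (by rw [abs_neg]; linarith)
    have h1 := hΔR _ hx
    have h2 := (abs_le.1 (hFR _ hx)).2
    have h3 := (abs_le.1 (hB' _ hx)).2
    have h4 : 2 * (-y / s) * (dR - y) ≤ 2 * K * e := by
      have := mul_le_mul hx hR (abs_nonneg _) hK0.le
      rw [← abs_mul] at this
      have := (le_abs_self _).trans this
      linarith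
    have h5 : 2 * (-y / s) * dR + B * (-y / s) ^ 2
        = 2 * (-y / s) * (dR - y) + (B - s) * (-y / s) ^ 2 - y ^ 2 / s := by
      field_simp; ring
    nlinarith
  -- Upper bound: the margin `e` makes `h` change sign between these two points, so the restriction
  -- holds exactly at some `x` with `x s` within `2 e` of `y`. There `FU x` is about `s x²`, hence
  -- about `y² / s`.
  · have ha : |(y - dU - e) / s| ≤ K := hdiv _ (abs_le.2 ⟨by linarith, by linarith⟩)
    have hb : |(y - dU + e) / s| ≤ K := hdiv _ (abs_le.2 ⟨by linarith, by linarith⟩)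
    have h1 : h ((y - dU - e) / s) ≤ 0 := by
      have := (abs_le.1 (hh _ ha)).2
      rw [div_mul_cancel₀ _ hspos.ne'] at this
      linarith
    have h2 : 0 ≤ h ((y - dU + e) / s) := by
      have := (abs_le.1 (hh _ hb)).1
      rw [div_mul_cancel₀ _ hspos.ne'] at this
      linarith
    have hle : (y - dU - e) / s ≤ (y - dU + e) / s := by gcongr; linarith
    obtain ⟨x, ⟨hxa, hxb⟩, hx0⟩ := intermediate_value_Icc hle hcont.continuousOn ⟨h1, h2⟩
    have hx : |x| ≤ K :=
      abs_le.2 ⟨(abs_le.1 ha).1.trans hxa, hxb.trans (abs_le.1 hb).2⟩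
    have h3 := hΔU x hx hx0
    have h4 := (abs_le.1 (hFU x hx)).2
    have h5 := (abs_le.1 (hB' x hx)).2
    have h6 : 2 * (x * dU) ≤ 2 * (K * e) := by
      have := mul_le_mul hx hU (abs_nonneg _) hK0.le
      rw [← abs_mul] at this
      have := (le_abs_self _).trans this
      linarith
    rw [div_le_iff₀ hspos] at hxa
    rw [le_div_iff₀ hspos] at hxb
    have h7 : |x * s - y| ≤ 2 * e := abs_le.2 ⟨by linarith, by linarith⟩
    have h8 : |(x * s + y) / s| ≤ 2 * K := by
      have : (x * s + y) / s = x + y / s := by field_simp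
      rw [this, two_mul]
      exact (abs_add_le _ _).trans (add_le_add hx (hdiv _ (by linarith)))
    have h9 : s * x ^ 2 - y ^ 2 / s ≤ 2 * e * (2 * K) := by
      have h10 : s * x ^ 2 - y ^ 2 / s = (x * s - y) * ((x * s + y) / s) := by field_simp; ring
      rw [h10]
      refine (le_abs_self _).trans ?_
      rw [abs_mul]
      exact mul_le_mul h7 h8 (abs_nonneg _) (by positivity)
    nlinarith


/-! ### The law of the absolute value of a standard normal variable -/

/-- Distribution function of the absolute value of a standard normal variable. -/
noncomputable def absNormalCDF (y : ℝ) : ℝ := (gaussianReal 0 1).real {x | |x| ≤ y}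

theorem absNormalCDF_mono : Monotone absNormalCDF := fun _ _ h =>
  measureReal_mono fun _ hx => le_trans hx h

/-- The density is at most `1 / √(2π) ≤ 1`. This crude bound already makes the distribution function
Lipschitz and free of an atom at 0. -/
theorem gaussianReal_le_volume : gaussianReal 0 1 ≤ (volume : Measure ℝ) := by
  rw [gaussianReal_of_var_ne_zero _ one_ne_zero]
  have h : gaussianPDF 0 1 ≤ fun _ => 1 := by
    intro x
    rw [gaussianPDF, ← ENNReal.ofReal_one]
    refine ENNReal.ofReal_le_ofReal ?_
    rw [gaussianPDFReal]
    have h1 : (1 : ℝ) ≤ √(2 * Real.pi * ((1 : ℝ≥0) : ℝ)) := by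
      rw [Real.one_le_sqrt, NNReal.coe_one]
      linarith [Real.pi_gt_three]
    have h2 : Real.exp (-(x - 0) ^ 2 / (2 * ((1 : ℝ≥0) : ℝ))) ≤ 1 := by
      rw [Real.exp_le_one_iff]
      refine div_nonpos_of_nonpos_of_nonneg ?_ (by positivity)
      nlinarith [sq_nonneg (x - 0)]
    calc _ ≤ (1 : ℝ)⁻¹ * 1 := by gcongr
      _ = 1 := by norm_num
  calc volume.withDensity (gaussianPDF 0 1) ≤ volume.withDensity fun _ => 1 :=
        withDensity_mono (Eventually.of_forall h)
    _ = volume := withDensity_one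

theorem absNormalCDF_add_le (y : ℝ) {δ : ℝ} (hδ : 0 ≤ δ) :
    absNormalCDF (y + δ) ≤ absNormalCDF y + 2 * δ := by
  have hsub : {x : ℝ | |x| ≤ y + δ} ⊆ {x | |x| ≤ y} ∪ (Icc (-(y + δ)) (-y) ∪ Icc y (y + δ)) := by
    intro x hx
    simp only [mem_ofPred_eq, mem_union, mem_Icc, abs_le] at hx ⊢
    by_cases h1 : x < -y
    · exact Or.inr (Or.inl ⟨hx.1, h1.le⟩)
    · by_cases h2 : y < x
      · exact Or.inr (Or.inr ⟨h2.le, hx.2⟩)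
      · exact Or.inl ⟨not_lt.1 h1, not_lt.1 h2⟩
  have hI : ∀ a b : ℝ, b - a = δ → (gaussianReal 0 1).real (Icc a b) ≤ δ := fun a b hab => by
    refine ENNReal.toReal_le_of_le_ofReal hδ ?_
    refine (gaussianReal_le_volume _).trans ?_
    rw [Real.volume_Icc, hab]
  calc absNormalCDF (y + δ)
      ≤ (gaussianReal 0 1).real ({x | |x| ≤ y} ∪ (Icc (-(y + δ)) (-y) ∪ Icc y (y + δ))) :=
        measureReal_mono hsub
    _ ≤ absNormalCDF y + (δ + δ) := by
        refine (measureReal_union_le _ _).trans (add_le_add le_rfl ?_)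
        exact (measureReal_union_le _ _).trans
          (add_le_add (hI _ _ (by ring)) (hI _ _ (by ring)))
    _ = absNormalCDF y + 2 * δ := by ring

theorem continuous_absNormalCDF : Continuous absNormalCDF := by
  have : LipschitzWith 2 absNormalCDF := by
    refine LipschitzWith.of_le_add_mul 2 fun x y => ?_
    have h1 : absNormalCDF x ≤ absNormalCDF (y + |x - y|) :=
      absNormalCDF_mono (by linarith [le_abs_self (x - y)])
    exact h1.trans (absNormalCDF_add_le y (abs_nonneg _))
  exact this.continuous

theorem absNormalCDF_zero : absNormalCDF 0 = 0 := by
  have h : {x : ℝ | |x| ≤ 0} = {0} := by ext x; simp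
  rw [absNormalCDF, h, measureReal_def]
  have := gaussianReal_le_volume {(0 : ℝ)}
  rw [Real.volume_singleton, nonpos_iff_eq_zero] at this
  rw [this, ENNReal.toReal_zero]

theorem tendsto_absNormalCDF : Tendsto absNormalCDF atTop (𝓝 1) := by
  have h := tendsto_measure_iUnion_atTop (μ := gaussianReal 0 1) (s := fun y : ℝ => {x | |x| ≤ y})
    fun _ _ h _ hx => le_trans hx h
  have h1 : (⋃ y : ℝ, {x : ℝ | |x| ≤ y}) = univ := eq_univ_of_forall fun x =>
    mem_iUnion.2 ⟨|x|, le_refl |x|⟩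
  rw [h1, measure_univ] at h
  exact (ENNReal.tendsto_toReal ENNReal.one_ne_top).comp h

theorem exists_absNormalCDF_eq {p : ℝ} (hp : p ∈ Ioo (0 : ℝ) 1) :
    ∃ y > 0, absNormalCDF y = p := by
  obtain ⟨b, hb, hb0⟩ := ((tendsto_absNormalCDF.eventually (lt_mem_nhds hp.2)).and
    (eventually_ge_atTop 0)).exists
  obtain ⟨y, hy, hyp⟩ := intermediate_value_Icc hb0 continuous_absNormalCDF.continuousOn
    ⟨absNormalCDF_zero.trans_le hp.1.le, hb.le⟩
  refine ⟨y, hy.1.lt_of_ne fun h => ?_, hyp⟩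
  rw [← h, absNormalCDF_zero] at hyp
  exact hp.1.ne hyp

/-! ### Approximately normal variables -/

/-- The trapezoidal function which is `ε` on `[-v, v]` and `0` outside `[-v - ε, v + ε]`. -/
noncomputable def trapezoid (ε v x : ℝ) : ℝ := max 0 (min ε (ε - (|x| - v)))

theorem trapezoid_nonneg (ε v x : ℝ) : 0 ≤ trapezoid ε v x := le_max_left _ _

theorem trapezoid_le {ε : ℝ} (hε : 0 ≤ ε) (v x : ℝ) : trapezoid ε v x ≤ ε :=
  max_le hε (min_le_left _ _)

theorem lipschitzWith_trapezoid (ε v : ℝ) : LipschitzWith 1 (trapezoid ε v) := by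
  have h1 : LipschitzWith 1 fun x : ℝ => ε - (|x| - v) := by
    refine LipschitzWith.of_le_add fun x z => ?_
    have := abs_abs_sub_abs_le z x
    have := le_abs_self (|z| - |x|)
    rw [Real.dist_eq, abs_sub_comm]
    linarith
  exact (h1.const_min ε).const_max 0

/-- The trapezoid lies between `ε` times two indicators. Its height is `ε` rather than 1 so that its
slopes are `±1` and it is an admissible test function for the bounded Lipschitz distance. -/
theorem integral_trapezoid_mem_Icc {Ω : Type*} [MeasurableSpace Ω] (ν : Measure Ω)
    [IsProbabilityMeasure ν] {V : Ω → ℝ} (hV : Measurable V) {ε : ℝ} (hε : 0 < ε) (v : ℝ) :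
    ∫ w, trapezoid ε v (V w) ∂ν ∈
      Icc (ε * ν.real {w | |V w| ≤ v}) (ε * ν.real {w | |V w| ≤ v + ε}) := by
  have hint : Integrable (fun w => trapezoid ε v (V w)) ν :=
    Integrable.of_bound
      ((lipschitzWith_trapezoid ε v).continuous.measurable.comp hV).aestronglyMeasurable ε
      (Eventually.of_forall fun w => by
        rw [Real.norm_eq_abs, abs_of_nonneg (trapezoid_nonneg _ _ _)]
        exact trapezoid_le hε.le _ _)
  have hm : ∀ v, MeasurableSet {w | |V w| ≤ v} := fun v =>
    measurableSet_le hV.abs measurable_const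
  have hi : ∀ v, ∫ w, {w | |V w| ≤ v}.indicator (fun _ => ε) w ∂ν = ε * ν.real {w | |V w| ≤ v} :=
    fun v => by rw [integral_indicator_const _ (hm v), smul_eq_mul, mul_comm]
  have hii : ∀ v, Integrable ({w | |V w| ≤ v}.indicator fun _ => ε) ν := fun v =>
    (integrable_const ε).indicator (hm v)
  constructor
  · rw [← hi]
    refine integral_mono (hii _) hint fun w => ?_
    by_cases hw : |V w| ≤ v
    · have : trapezoid ε v (V w) = ε := by
        rw [trapezoid, min_eq_left (by linarith), max_eq_right hε.le]
      simp [hw, this]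
    · simp [hw, trapezoid_nonneg]
  · rw [← hi]
    refine integral_mono hint (hii _) fun w => ?_
    by_cases hw : |V w| ≤ v + ε
    · simp [hw, trapezoid_le hε.le]
    · have : trapezoid ε v (V w) = 0 :=
        max_eq_left ((min_le_right _ _).trans (by linarith [not_le.1 hw]))
      simp [hw, this]

/-- The bounded Lipschitz distance controls the distribution function of the absolute value. -/
theorem abs_measureReal_sub_absNormalCDF_le {W : Type*} [MeasurableSpace W] {ν : Measure W}
    [IsProbabilityMeasure ν] {X : W → ℝ} (hX : Measurable X) {ε : ℝ} (hε0 : 0 < ε) (hε1 : ε ≤ 1)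
    (h : ∀ f : ℝ → ℝ, (∀ x, |f x| ≤ 1) → LipschitzWith 1 f →
      |∫ w, f (X w) ∂ν - ∫ x, f x ∂(gaussianReal 0 1)| ≤ ε ^ 2) (y : ℝ) :
    |ν.real {w | |X w| ≤ y} - absNormalCDF y| ≤ 3 * ε := by
  -- Dividing the bound `ε ^ 2` by the height `ε` leaves an error `ε`; shifting the argument by `ε`
  -- costs another `2 * ε`.
  have hb : ∀ v, |∫ w, trapezoid ε v (X w) ∂ν - ∫ x, trapezoid ε v x ∂(gaussianReal 0 1)|
      ≤ ε ^ 2 := fun v => h _ (fun x => by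
        rw [abs_of_nonneg (trapezoid_nonneg _ _ _)]
        exact (trapezoid_le hε0.le _ _).trans hε1) (lipschitzWith_trapezoid ε v)
  rw [abs_le]
  constructor
  · have h1 := (integral_trapezoid_mem_Icc ν hX hε0 (y - ε)).2
    have h2 : ε * absNormalCDF (y - ε) ≤ _ :=
      (integral_trapezoid_mem_Icc (gaussianReal 0 1) measurable_id hε0 (y - ε)).1
    have h3 := (abs_le.1 (hb (y - ε))).1
    have h4 := absNormalCDF_add_le (y - ε) hε0.le
    rw [sub_add_cancel] at h1 h4
    have h5 : ε * absNormalCDF (y - ε) ≤ ε * (ν.real {w | |X w| ≤ y} + ε) := by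
      simp only [id_eq] at h2
      linarith
    have := le_of_mul_le_mul_left h5 hε0
    linarith
  · have h1 := (integral_trapezoid_mem_Icc ν hX hε0 y).1
    have h2 : _ ≤ ε * absNormalCDF (y + ε) :=
      (integral_trapezoid_mem_Icc (gaussianReal 0 1) measurable_id hε0 y).2
    have h3 := (abs_le.1 (hb y)).2
    have h4 := absNormalCDF_add_le y hε0.le
    have h5 : ε * ν.real {w | |X w| ≤ y} ≤ ε * (absNormalCDF (y + ε) + ε) := by
      simp only [id_eq] at h2
      linarith
    have := le_of_mul_le_mul_left h5 hε0
    linarith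

/-- Convergence in distribution to a standard normal law implies uniform convergence of the
distribution functions of the absolute values. -/
theorem eventually_abs_measureReal_sub_absNormalCDF_le {S : Type*} [MeasurableSpace S]
    {P : Measure S} [IsProbabilityMeasure P] {X : ℕ → S → ℝ}
    (h : TendstoInDistribution X atTop (id : ℝ → ℝ) (fun _ => P) (gaussianReal 0 1)) {ε : ℝ}
    (hε : 0 < ε) : ∀ᶠ n in atTop, ∀ y, |P.real {z | |X n z| ≤ y} - absNormalCDF y| ≤ 3 * ε := by
  -- Weak convergence is read in the Lévy–Prokhorov distance, whose smallness controls all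
  -- measurable sets at once; this is where uniformity in `y` comes from.
  have h1 := (LevyProkhorov.continuous_ofMeasure_probabilityMeasure.tendsto _).comp h.tendsto
  rw [EMetric.tendsto_atTop] at h1
  obtain ⟨N, hN⟩ := h1 (ENNReal.ofReal ε) (ENNReal.ofReal_pos.2 hε)
  filter_upwards [eventually_ge_atTop N] with n hn y
  have hd := hN n hn
  simp only [LevyProkhorov.edist_probabilityMeasure_def] at hd
  have hm : ∀ v, MeasurableSet {x : ℝ | |x| ≤ v} := fun v =>
    measurableSet_le measurable_id.abs measurable_const
  have hth : ∀ v, Metric.thickening ε {x : ℝ | |x| ≤ v} ⊆ {x | |x| ≤ v + ε} := fun v x hx => by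
    obtain ⟨z, hz, hxz⟩ := Metric.mem_thickening_iff.1 hx
    rw [Real.dist_eq] at hxz
    have := abs_sub_abs_le_abs_sub x z
    simp only [mem_ofPred_eq] at hz ⊢
    linarith
  have hmap : ∀ v, (P.map (X n)) {x | |x| ≤ v} = P {z | |X n z| ≤ v} := fun v =>
    Measure.map_apply_of_aemeasurable (h.forall_aemeasurable n) (hm v)
  have hlim : ∀ v, ((gaussianReal 0 1).map id) {x | |x| ≤ v} = gaussianReal 0 1 {x | |x| ≤ v} :=
    fun v => by rw [Measure.map_id]
  have hL : ∀ v, P.real {z | |X n z| ≤ v} ≤ absNormalCDF (v + ε) + ε := fun v => by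
    have := left_measure_le_of_levyProkhorovEDist_lt hd (hm v)
    rw [ENNReal.toReal_ofReal hε.le] at this
    have h2 : P {z | |X n z| ≤ v} ≤ gaussianReal 0 1 {x | |x| ≤ v + ε} + ENNReal.ofReal ε := by
      rw [← hmap, ← hlim]
      exact this.trans (add_le_add (measure_mono (hth v)) le_rfl)
    have h3 := ENNReal.toReal_mono (by finiteness) h2
    rwa [ENNReal.toReal_add (by finiteness) (by finiteness), ENNReal.toReal_ofReal hε.le] at h3
  have hR : ∀ v, absNormalCDF v ≤ P.real {z | |X n z| ≤ v + ε} + ε := fun v => by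
    have := right_measure_le_of_levyProkhorovEDist_lt hd (hm v)
    rw [ENNReal.toReal_ofReal hε.le] at this
    have h2 : gaussianReal 0 1 {x | |x| ≤ v} ≤ P {z | |X n z| ≤ v + ε} + ENNReal.ofReal ε := by
      rw [← hmap, ← hlim]
      exact this.trans (add_le_add (measure_mono (hth v)) le_rfl)
    have h3 := ENNReal.toReal_mono (by finiteness) h2
    rwa [ENNReal.toReal_add (by finiteness) (by finiteness), ENNReal.toReal_ofReal hε.le] at h3
  rw [abs_le]
  constructor
  · have h2 := hR (y - ε)
    have h4 := absNormalCDF_add_le (y - ε) hε.le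
    rw [sub_add_cancel] at h2 h4
    linarith
  · have h2 := hL y
    have h4 := absNormalCDF_add_le y hε.le
    linarith

/-- Distribution and survival functions of a variable which is close to the square of an
approximately normal variable. -/
theorem abs_measureReal_sub_absNormalCDF_sqrt_le {S : Type*} [MeasurableSpace S]
    {P : Measure S} [IsProbabilityMeasure P] {ζ U : S → ℝ} (hζ : AEMeasurable ζ P) {ε : ℝ}
    (hε : 0 < ε) (h : ∀ y, |P.real {z | |ζ z| ≤ y} - absNormalCDF y| ≤ ε)
    (hU : P.real {z | ¬ |U z - ζ z ^ 2| ≤ ε ^ 2} ≤ ε) (v : ℝ) :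
    |P.real {z | U z ≤ v} - absNormalCDF √v| ≤ 6 * ε ∧
      |P.real {z | v ≤ U z} - (1 - absNormalCDF √v)| ≤ 6 * ε := by
  have hv0 := Real.sqrt_nonneg v
  -- Complements are taken only for `ζ`: `U` need not be measurable, so its survival function is
  -- bounded separately from its distribution function.
  have hcompl : ∀ y, P.real {z | y < |ζ z|} = 1 - P.real {z | |ζ z| ≤ y} := fun y => by
    have hm : NullMeasurableSet {z | |ζ z| ≤ y} P := by
      have h1 : MeasurableSet {x : ℝ | |x| ≤ y} := measurableSet_le measurable_id.abs measurable_const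
      exact hζ.nullMeasurableSet_preimage h1
    have h2 : {z | y < |ζ z|} = {z | |ζ z| ≤ y}ᶜ := by ext; simp
    rw [h2, measureReal_compl₀ hm, probReal_univ]
  have hsplit : ∀ A B : Set S, (∀ z ∈ A, |U z - ζ z ^ 2| ≤ ε ^ 2 → z ∈ B) →
      P.real A ≤ P.real B + ε := fun A B hAB =>
    (measureReal_mono (s₂ := B ∪ {z | ¬ |U z - ζ z ^ 2| ≤ ε ^ 2}) fun z hz => by
      by_cases hz' : |U z - ζ z ^ 2| ≤ ε ^ 2
      · exact Or.inl (hAB z hz hz')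
      · exact Or.inr hz').trans ((measureReal_union_le _ _).trans (add_le_add le_rfl hU))
  have hbig : ∀ z, U z ≤ v → |U z - ζ z ^ 2| ≤ ε ^ 2 → |ζ z| ≤ √v + ε := fun z hz hz' => by
    have h1 := (abs_le.1 hz').1
    refine abs_le_of_sq_le_sq ?_ (by positivity)
    rcases le_total 0 v with hv | hv
    · nlinarith [Real.sq_sqrt hv, mul_nonneg hv0 hε.le]
    · rw [Real.sqrt_eq_zero_of_nonpos hv]; nlinarith
  -- A margin of `2 * ε` instead of `ε` is needed for a strict inequality. If it failed, then `√v ≥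
  -- 2 * ε` would force `ζ² + ε² < v`; negative `v` is covered because its square root is 0.
  have hlow : ∀ z, v ≤ U z → |U z - ζ z ^ 2| ≤ ε ^ 2 → √v - 2 * ε < |ζ z| := fun z hz hz' => by
    by_contra! hcon
    have h1 := (abs_le.1 hz').2
    have h0 := abs_nonneg (ζ z)
    have h2 : √v ^ 2 = v := Real.sq_sqrt (Real.sqrt_pos.1 (by linarith)).le
    rw [← sq_abs] at h1
    nlinarith
  have hlow' : ∀ z, |ζ z| ≤ √v - ε → |U z - ζ z ^ 2| ≤ ε ^ 2 → U z ≤ v := fun z hcon hz' => by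
    have h1 := (abs_le.1 hz').2
    have h0 := abs_nonneg (ζ z)
    have h2 : √v ^ 2 = v := Real.sq_sqrt (Real.sqrt_pos.1 (by linarith)).le
    rw [← sq_abs] at h1
    nlinarith
  have hbig' : ∀ z, √v + ε < |ζ z| → |U z - ζ z ^ 2| ≤ ε ^ 2 → v ≤ U z := fun z hz hz' => by
    by_contra! hcon
    exact absurd (hbig z hcon.le hz') (not_le.2 hz)
  have e1 := absNormalCDF_add_le √v hε.le
  have e2 := absNormalCDF_add_le (√v - ε) hε.le
  have e3 := absNormalCDF_add_le (√v - 2 * ε) (mul_nonneg zero_le_two hε.le)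
  rw [sub_add_cancel] at e2 e3
  have a1 := abs_le.1 (h (√v + ε))
  have a2 := abs_le.1 (h (√v - ε))
  have a3 := abs_le.1 (h (√v - 2 * ε))
  refine ⟨abs_le.2 ⟨?_, ?_⟩, abs_le.2 ⟨?_, ?_⟩⟩
  · have := hsplit {z | |ζ z| ≤ √v - ε} {z | U z ≤ v} hlow'
    linarith [a2.1]
  · have := hsplit {z | U z ≤ v} {z | |ζ z| ≤ √v + ε} hbig
    linarith [a1.2]
  · have := hsplit {z | √v + ε < |ζ z|} {z | v ≤ U z} hbig'
    rw [hcompl] at this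
    linarith [a1.2]
  · have := hsplit {z | v ≤ U z} {z | √v - 2 * ε < |ζ z|} hlow
    rw [hcompl] at this
    linarith [a3.1]

/-- Quantiles of a distribution function which is close to that of the square of a normal
variable. -/
theorem sInf_mem_Icc_of_approx {F : ℝ → ℝ} {s p ε y₁ y₂ : ℝ} (hs : 0 < s)
    (hF : ∀ t, |F t - absNormalCDF √(s * t)| ≤ ε) (hy₁ : 0 ≤ y₁) (hy₂ : 0 ≤ y₂)
    (h₁ : absNormalCDF y₁ < p - ε) (h₂ : p + ε ≤ absNormalCDF y₂) :
    sInf {t | p ≤ F t} ∈ Icc (y₁ ^ 2 / s) (y₂ ^ 2 / s) := by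
  have hmem : y₂ ^ 2 / s ∈ {t | p ≤ F t} := by
    have := (abs_le.1 (hF (y₂ ^ 2 / s))).1
    rw [mul_div_cancel₀ _ hs.ne', Real.sqrt_sq hy₂] at this
    simp only [mem_ofPred_eq]
    linarith
  have hlb : ∀ t ∈ {t | p ≤ F t}, y₁ ^ 2 / s ≤ t := fun t ht => by
    by_contra! hcon
    have h3 := (abs_le.1 (hF t)).2
    have h4 : √(s * t) ≤ y₁ := by
      rw [Real.sqrt_le_left hy₁, mul_comm]
      exact ((lt_div_iff₀ hs).1 hcon).le
    have h5 := absNormalCDF_mono h4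
    simp only [mem_ofPred_eq] at ht
    linarith
  exact ⟨le_csInf ⟨_, hmem⟩ hlb, csInf_le ⟨_, hlb⟩ hmem⟩


/-! ### Symmetric matrices with eigenvalues in a compact interval -/

namespace Model

section Matrices

variable {d : ℕ}

theorem EigenvaluesIn.mono {c C C' : ℝ} {S : Matrix (Fin d) (Fin d) ℝ} (h : EigenvaluesIn c C S)
    (hC : C ≤ C') : EigenvaluesIn c C' S :=
  ⟨h.1, fun a => ⟨(h.2 a).1, (h.2 a).2.trans
    (mul_le_mul_of_nonneg_right hC (dotProduct_self_star_nonneg a))⟩⟩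

theorem EigenvaluesIn.mulVec_inv_mulVec {c C : ℝ} (hc : 0 < c) {S : Matrix (Fin d) (Fin d) ℝ}
    (h : EigenvaluesIn c C S) (a : Fin d → ℝ) : S *ᵥ (S⁻¹ *ᵥ a) = a := by
  have hdet : IsUnit S.det := by
    rw [isUnit_iff_ne_zero]
    intro h0
    obtain ⟨b, hb, hSb⟩ := Matrix.exists_mulVec_eq_zero_iff.2 h0
    have h1 := (h.2 b).1
    rw [hSb, dotProduct_zero] at h1
    have h2 : 0 < b ⬝ᵥ b := lt_of_le_of_ne (dotProduct_self_star_nonneg b)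
      fun h3 => hb (dotProduct_self_eq_zero.1 h3.symm)
    nlinarith
  rw [Matrix.mulVec_mulVec, Matrix.mul_nonsing_inv _ hdet, Matrix.one_mulVec]

theorem EigenvaluesIn.dotProduct_inv_comm {c C : ℝ} {S : Matrix (Fin d) (Fin d) ℝ}
    (h : EigenvaluesIn c C S) (a b : Fin d → ℝ) : a ⬝ᵥ (S⁻¹ *ᵥ b) = (S⁻¹ *ᵥ a) ⬝ᵥ b := by
  have hs : S⁻¹ᵀ = S⁻¹ := by rw [Matrix.transpose_nonsing_inv, h.1]
  rw [Matrix.dotProduct_mulVec, ← Matrix.mulVec_transpose, hs]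

theorem EigenvaluesIn.le_dotProduct_inv {c C : ℝ} (hc : 0 < c) {S : Matrix (Fin d) (Fin d) ℝ}
    (h : EigenvaluesIn c C S) (a : Fin d → ℝ) :
    c * ((S⁻¹ *ᵥ a) ⬝ᵥ (S⁻¹ *ᵥ a)) ≤ a ⬝ᵥ (S⁻¹ *ᵥ a) ∧
      a ⬝ᵥ (S⁻¹ *ᵥ a) ≤ C * ((S⁻¹ *ᵥ a) ⬝ᵥ (S⁻¹ *ᵥ a)) := by
  have := h.2 (S⁻¹ *ᵥ a)
  rwa [h.mulVec_inv_mulVec hc, dotProduct_comm _ a] at this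

theorem EigenvaluesIn.dotProduct_inv_nonneg {c C : ℝ} (hc : 0 < c) {S : Matrix (Fin d) (Fin d) ℝ}
    (h : EigenvaluesIn c C S) (a : Fin d → ℝ) : 0 ≤ a ⬝ᵥ (S⁻¹ *ᵥ a) :=
  (mul_nonneg hc.le (dotProduct_self_star_nonneg _)).trans (h.le_dotProduct_inv hc a).1

theorem EigenvaluesIn.eq_zero_of_dotProduct_inv {c C : ℝ} (hc : 0 < c)
    {S : Matrix (Fin d) (Fin d) ℝ} (h : EigenvaluesIn c C S) {a : Fin d → ℝ}
    (ha : a ⬝ᵥ (S⁻¹ *ᵥ a) = 0) : a = 0 := by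
  have h1 := (h.le_dotProduct_inv hc a).1
  have h2 : 0 ≤ (S⁻¹ *ᵥ a) ⬝ᵥ (S⁻¹ *ᵥ a) := dotProduct_self_star_nonneg _
  have h3 : (S⁻¹ *ᵥ a) ⬝ᵥ (S⁻¹ *ᵥ a) = 0 := by nlinarith
  rw [← h.mulVec_inv_mulVec hc a, dotProduct_self_eq_zero.1 h3, Matrix.mulVec_zero]

/-- With `b = S⁻¹ a`, expand `|a - c b|² ≥ 0` and use `c |b|² ≤ a ⬝ᵥ b`. The bound transfers square
integrability from `f` to `Σ⁻¹ f`. -/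
theorem EigenvaluesIn.inv_mulVec_sq_le {c C : ℝ} (hc : 0 < c) {S : Matrix (Fin d) (Fin d) ℝ}
    (h : EigenvaluesIn c C S) (a : Fin d → ℝ) :
    c ^ 2 * ((S⁻¹ *ᵥ a) ⬝ᵥ (S⁻¹ *ᵥ a)) ≤ a ⬝ᵥ a := by
  have h1 := (h.le_dotProduct_inv hc a).1
  set b := S⁻¹ *ᵥ a
  have h2 : 0 ≤ (a - c • b) ⬝ᵥ (a - c • b) := dotProduct_self_star_nonneg _
  simp only [sub_dotProduct, dotProduct_sub, smul_dotProduct, dotProduct_smul, smul_eq_mul,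
    dotProduct_comm b a] at h2
  nlinarith

/-- By Cramer's rule an entry of the inverse is the inverted determinant times a cofactor, both
continuous in the entries; singular matrices need no separate case. -/
theorem measurable_inv_apply {X : Type*} [MeasurableSpace X] {S : X → Matrix (Fin d) (Fin d) ℝ}
    (h : ∀ i j, Measurable fun x => S x i j) (i j : Fin d) : Measurable fun x => (S x)⁻¹ i j := by
  have hS : Measurable fun x => (fun i j => S x i j : Fin d → Fin d → ℝ) :=
    measurable_pi_iff.2 fun i => measurable_pi_iff.2 fun j => h i j
  have hof : Continuous fun M : Fin d → Fin d → ℝ => Matrix.of M := continuous_id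
  have h1 : Continuous fun M : Fin d → Fin d → ℝ => (Matrix.of M).det := hof.matrix_det
  have h2 : Continuous fun M : Fin d → Fin d → ℝ => (Matrix.of M).adjugate i j :=
    hof.matrix_adjugate.matrix_elem i j
  have h3 : (fun x => (S x)⁻¹ i j) = fun x => ((S x).det)⁻¹ * (S x).adjugate i j := by
    ext x
    rw [Matrix.inv_def, Ring.inverse_eq_inv']
    rfl
  rw [h3]
  exact (h1.measurable.comp hS).inv.mul (h2.measurable.comp hS)

end Matrices

variable {dθ dρ : ℕ} {H 𝒳 𝒴 W : Type*} [NormedAddCommGroup H] [NormedSpace ℝ H]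
  [MeasurableSpace 𝒳] [MeasurableSpace 𝒴] [MeasurableSpace W]
  {D : Model dθ dρ H 𝒳 𝒴 W}

/-! ### Population and sample criteria -/

theorem Basic.eigen_pos (hD : D.Basic) : ∃ c > 0, ∃ C > 0, ∀ᵐ x ∂D.PX,
    EigenvaluesIn c C (D.Sig x) ∧ EigenvaluesIn c C (D.Sig₀ x) := by
  obtain ⟨c, hc, C, h⟩ := hD.eigen
  refine ⟨c, hc, max C c, lt_max_of_lt_right hc, h.mono fun x hx => ?_⟩
  exact ⟨hx.1.mono (le_max_left _ _), hx.2.mono (le_max_left _ _)⟩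

theorem Basic.Q_nonneg (hD : D.Basic) (α : Par dθ H) : 0 ≤ D.Q α := by
  obtain ⟨c, hc, C, -, h⟩ := hD.eigen_pos
  exact integral_nonneg_of_ae (h.mono fun x hx => hx.1.dotProduct_inv_nonneg hc _)

theorem Basic.snorm_eq_zero_of_Q_eq_zero (hD : D.Basic) {α : Par dθ H} (hα : α ∈ D.space)
    (h0 : D.Q α = 0) : snorm (α - D.α₀) = 0 := by
  obtain ⟨c, hc, C, -, h⟩ := hD.eigen_pos
  rw [Q, integral_eq_zero_iff_of_nonneg_ae (h.mono fun x hx => hx.1.dotProduct_inv_nonneg hc _)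
    (hD.int_Q α hα)] at h0
  refine (hD.ident α hα).1 ?_
  filter_upwards [h, h0] with x hx hx0
  exact hx.1.eq_zero_of_dotProduct_inv hc hx0

theorem Basic.α₀_mem_space (hD : D.Basic) : D.α₀ ∈ D.space :=
  (interior_subset hD.α₀_mem : D.α₀.1 ∈ D.Θ)

theorem Basic.m_α₀ (hD : D.Basic) : ∀ᵐ x ∂D.PX, D.m x D.α₀ = 0 :=
  (hD.ident _ hD.α₀_mem_space).2 (by simp [snorm])

theorem crit_nonneg {n : ℕ} {zs : Fin n → 𝒳 × 𝒴} (h : ∀ i, (D.SigHat n zs (zs i).1).PosDef)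
    (b : Fin n → ℝ) (α : Par dθ H) : 0 ≤ D.crit n zs b α := by
  refine mul_nonneg (by positivity) (Finset.sum_nonneg fun i _ => ?_)
  have := (h i).inv.posSemidef.dotProduct_mulVec_nonneg (D.mhat n zs b (zs i).1 α)
  simpa using this

/-! ### The weak norm -/

section Weak

variable {L : Loc D}

theorem memLp_apply {X : Type*} [MeasurableSpace X] {μ : Measure X} {d : ℕ} {f : X → Fin d → ℝ}
    (hf : MemLp f 2 μ) (i : Fin d) : MemLp (fun x => f x i) 2 μ :=
  hf.mono (((continuous_apply i).comp_aestronglyMeasurable hf.1))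
    (Eventually.of_forall fun x => norm_le_pi_norm (f x) i)

theorem memLp_inv_mulVec (hD : D.Basic) {f : 𝒳 → Fin dρ → ℝ} (hf : MemLp f 2 D.PX) (i : Fin dρ) :
    MemLp (fun x => ((D.Sig x)⁻¹ *ᵥ f x) i) 2 D.PX := by
  obtain ⟨c, hc, C, -, h⟩ := hD.eigen_pos
  have hm : AEStronglyMeasurable (fun x => ((D.Sig x)⁻¹ *ᵥ f x) i) D.PX := by
    simp only [Matrix.mulVec, dotProduct]
    refine Finset.aestronglyMeasurable_fun_sum _ fun j _ => ?_
    exact (measurable_inv_apply hD.meas_Sig i j).aestronglyMeasurable.mul (memLp_apply hf j).1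
  rw [memLp_two_iff_integrable_sq hm]
  have hint : Integrable (fun x => (c ^ 2)⁻¹ * ∑ j, f x j ^ 2) D.PX :=
    (integrable_finsetSum _ fun j _ => (memLp_apply hf j).integrable_sq).const_mul _
  refine hint.mono' (hm.pow 2) ?_
  filter_upwards [h] with x hx
  have h1 := hx.1.inv_mulVec_sq_le hc (f x)
  rw [Real.norm_eq_abs, abs_of_nonneg (sq_nonneg _), le_inv_mul_iff₀ (by positivity)]
  have h2 : f x ⬝ᵥ f x = ∑ j, f x j ^ 2 := by simp only [dotProduct, sq]
  have h3 : ((D.Sig x)⁻¹ *ᵥ f x) i ^ 2 ≤ ((D.Sig x)⁻¹ *ᵥ f x) ⬝ᵥ ((D.Sig x)⁻¹ *ᵥ f x) := by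
    simp only [dotProduct, ← sq]
    exact Finset.single_le_sum (f := fun j => ((D.Sig x)⁻¹ *ᵥ f x) j ^ 2)
      (fun j _ => sq_nonneg _) (Finset.mem_univ i)
  rw [← h2]
  exact (mul_le_mul_of_nonneg_left h3 (by positivity)).trans h1

theorem integrable_winner (hD : D.Basic) (hL : L.Regular) (v w : Par dθ H) :
    Integrable (fun x => L.dm v x ⬝ᵥ ((D.Sig x)⁻¹ *ᵥ L.dm w x)) D.PX := by
  simp only [dotProduct]
  exact integrable_finsetSum _ fun i _ =>
    (memLp_apply (hL.dm_sq_int v) i).integrable_mul (memLp_inv_mulVec hD (hL.dm_sq_int w) i)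

/-- The weak inner product as a bilinear form. -/
noncomputable def winnerForm (hD : D.Basic) (hL : L.Regular) : LinearMap.BilinForm ℝ (Par dθ H) :=
  LinearMap.mk₂ ℝ L.winner
    (fun v v' w => by
      simp only [Loc.winner]
      rw [← integral_add (integrable_winner hD hL _ _) (integrable_winner hD hL _ _)]
      simp only [map_add, Pi.add_apply, add_dotProduct])
    (fun a v w => by
      simp only [Loc.winner, smul_eq_mul]
      rw [← integral_const_mul]
      simp only [map_smul, Pi.smul_apply, smul_dotProduct, smul_eq_mul])
    (fun v w w' => by
      simp only [Loc.winner]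
      rw [← integral_add (integrable_winner hD hL _ _) (integrable_winner hD hL _ _)]
      simp only [map_add, Pi.add_apply, Matrix.mulVec_add, dotProduct_add])
    (fun a v w => by
      simp only [Loc.winner, smul_eq_mul]
      rw [← integral_const_mul]
      simp only [map_smul, Pi.smul_apply, Matrix.mulVec_smul, dotProduct_smul, smul_eq_mul])

theorem winner_eq (hD : D.Basic) (hL : L.Regular) (v w : Par dθ H) :
    L.winner v w = winnerForm hD hL v w := rfl

theorem winner_comm (hD : D.Basic) (v w : Par dθ H) : L.winner v w = L.winner w v := by
  obtain ⟨c, hc, C, -, h⟩ := hD.eigen_pos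
  refine integral_congr_ae (h.mono fun x hx => ?_)
  simp only
  rw [hx.1.dotProduct_inv_comm, dotProduct_comm]

theorem winner_self_nonneg (hD : D.Basic) (v : Par dθ H) : 0 ≤ L.winner v v := by
  obtain ⟨c, hc, C, -, h⟩ := hD.eigen_pos
  exact integral_nonneg_of_ae (h.mono fun x hx => hx.1.dotProduct_inv_nonneg hc _)

theorem wnorm_nonneg (v : Par dθ H) : 0 ≤ L.wnorm v := Real.sqrt_nonneg _

theorem wnorm_sq (hD : D.Basic) (v : Par dθ H) : L.wnorm v ^ 2 = L.winner v v :=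
  Real.sq_sqrt (winner_self_nonneg hD v)

/-- Cauchy–Schwarz for a form that is only positive semidefinite: the weak norm may vanish off zero,
so no inner product structure is available on the whole space. -/
theorem abs_winner_le (hD : D.Basic) (hL : L.Regular) (v w : Par dθ H) :
    |L.winner v w| ≤ L.wnorm v * L.wnorm w := by
  refine abs_le_of_sq_le_sq ?_ (mul_nonneg (wnorm_nonneg _) (wnorm_nonneg _))
  rw [mul_pow, wnorm_sq hD, wnorm_sq hD, sq]
  nth_rw 2 [winner_comm hD]
  exact LinearMap.BilinForm.apply_mul_apply_le_of_forall_zero_le (winnerForm hD hL)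
    (winner_self_nonneg hD) v w

theorem wnorm_add_le (hD : D.Basic) (hL : L.Regular) (v w : Par dθ H) :
    L.wnorm (v + w) ≤ L.wnorm v + L.wnorm w := by
  refine le_of_sq_le_sq ?_ (add_nonneg (wnorm_nonneg _) (wnorm_nonneg _))
  have h1 : L.winner (v + w) (v + w) = L.winner v v + 2 * L.winner v w + L.winner w w := by
    simp only [winner_eq hD hL, map_add, LinearMap.add_apply]
    rw [← winner_eq hD hL w v, winner_comm hD w v, winner_eq hD hL]
    ring
  rw [wnorm_sq hD, h1, add_sq, wnorm_sq hD, wnorm_sq hD]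
  linarith [(le_abs_self _).trans (abs_winner_le hD hL v w)]

theorem wnorm_smul (hD : D.Basic) (hL : L.Regular) (a : ℝ) (v : Par dθ H) :
    L.wnorm (a • v) = |a| * L.wnorm v := by
  have h1 : L.winner (a • v) (a • v) = a ^ 2 * L.winner v v := by
    simp only [winner_eq hD hL, map_smul, LinearMap.smul_apply, smul_eq_mul]
    ring
  rw [Loc.wnorm, h1, Real.sqrt_mul (sq_nonneg a), Real.sqrt_sq_eq_abs, Loc.wnorm]

theorem wnorm_sub_le (hD : D.Basic) (hL : L.Regular) (v w : Par dθ H) :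
    L.wnorm (v - w) ≤ L.wnorm v + L.wnorm w := by
  have h := wnorm_smul hD hL (-1) w
  rw [abs_neg, abs_one, one_mul, neg_one_smul] at h
  rw [sub_eq_add_neg, ← h]
  exact wnorm_add_le hD hL _ _

/-! ### The variance of the score -/

theorem score_eq (hD : D.Basic) (v : Par dθ H) : ∀ᵐ z ∂D.P1,
    L.score v z = ∑ i, ((D.Sig z.1)⁻¹ *ᵥ L.dm v z.1) i * D.ρ z D.α₀ i := by
  obtain ⟨c, hc, C, -, h⟩ := hD.eigen_pos
  have h1 : ∀ᵐ z ∂D.P1, EigenvaluesIn c C (D.Sig z.1) := by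
    have : ∀ᵐ x ∂(D.P1.map Prod.fst), EigenvaluesIn c C (D.Sig x) := by
      rw [P1, ← Measure.fst, Measure.fst_compProd]
      exact h.mono fun x hx => hx.1
    exact ae_of_ae_map measurable_fst.aemeasurable this
  filter_upwards [h1] with z hz
  rw [Loc.score, hz.dotProduct_inv_comm, dotProduct]

theorem memLp_residual (hD : D.Basic) :
    ∀ᵐ x ∂D.PX, ∀ i, MemLp (fun y => D.ρ (x, y) D.α₀ i) 2 (D.κ x) := by
  rw [ae_all_iff]
  intro i
  have h1 := (memLp_apply hD.sq_int_ρ i).integrable_sq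
  have h2 := ((Measure.integrable_compProd_iff h1.1).1 h1).1
  have hm : Measurable fun z => D.ρ z D.α₀ i := (measurable_pi_iff.1
    (hD.meas_ρ _ hD.α₀_mem_space)) i
  filter_upwards [h2] with x hx
  exact (memLp_two_iff_integrable_sq (hm.comp measurable_prodMk_left).aestronglyMeasurable).2 hx

/-- The null set is chosen before `b`, because the result is applied to a coefficient vector that
itself depends on `x`. -/
theorem integral_sq_residual (hD : D.Basic) : ∀ᵐ x ∂D.PX, ∀ b : Fin dρ → ℝ,
    Integrable (fun y => ∑ i, b i * D.ρ (x, y) D.α₀ i) (D.κ x) ∧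
    Integrable (fun y => (∑ i, b i * D.ρ (x, y) D.α₀ i) ^ 2) (D.κ x) ∧
    ∫ y, (∑ i, b i * D.ρ (x, y) D.α₀ i) ∂(D.κ x) = 0 ∧
    ∫ y, (∑ i, b i * D.ρ (x, y) D.α₀ i) ^ 2 ∂(D.κ x) = b ⬝ᵥ (D.Sig₀ x *ᵥ b) := by
  filter_upwards [memLp_residual hD, hD.m_α₀] with x hx hm b
  have hsum : MemLp (fun y => ∑ i, b i * D.ρ (x, y) D.α₀ i) 2 (D.κ x) :=
    memLp_finsetSum _ fun i _ => (hx i).const_mul (b i)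
  refine ⟨hsum.integrable one_le_two, hsum.integrable_sq, ?_, ?_⟩
  · rw [integral_finsetSum _ fun i _ => ((hx i).integrable one_le_two).const_mul (b i)]
    refine Finset.sum_eq_zero fun i _ => ?_
    rw [integral_const_mul]
    have : ∫ y, D.ρ (x, y) D.α₀ i ∂(D.κ x) = 0 := congrFun hm i
    rw [this, mul_zero]
  · have hexp : ∀ y, (∑ i, b i * D.ρ (x, y) D.α₀ i) ^ 2
        = ∑ i, ∑ j, b i * b j * (D.ρ (x, y) D.α₀ i * D.ρ (x, y) D.α₀ j) := fun y => by
      rw [sq, Finset.sum_mul_sum]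
      exact Finset.sum_congr rfl fun i _ => Finset.sum_congr rfl fun j _ => by ring
    have hij : ∀ i j, Integrable (fun y => b i * b j * (D.ρ (x, y) D.α₀ i * D.ρ (x, y) D.α₀ j))
        (D.κ x) := fun i j => ((hx i).integrable_mul (hx j)).const_mul _
    simp_rw [hexp]
    rw [integral_finsetSum _ fun i _ => integrable_finsetSum _ fun j _ => hij i j]
    simp only [dotProduct, Matrix.mulVec, Finset.mul_sum]
    refine Finset.sum_congr rfl fun i _ => ?_
    rw [integral_finsetSum _ fun j _ => hij i j]
    refine Finset.sum_congr rfl fun j _ => ?_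
    rw [integral_const_mul, Sig₀]
    simp only [hm, Pi.zero_apply, sub_zero]
    ring

/-- With `b = Σ⁻¹ dm[v]`, the score is `b'ρ`, with conditional mean 0, so its variance is
`E[b'Σ₀b]`, while the squared weak norm is `E[b'Σb]`. Both lie between `c E[b'b]` and `C E[b'b]`.
This replaces optimal weighting. -/
theorem variance_score_bounds (hD : D.Basic) : ∃ c > 0, ∃ C > 0, ∀ L : Loc D, L.Regular →
    ∀ v, c * L.winner v v ≤ variance (L.score v) D.P1 ∧
      variance (L.score v) D.P1 ≤ C * L.winner v v := by
  obtain ⟨c, hc, C, hC, h⟩ := hD.eigen_pos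
  refine ⟨c / C, by positivity, C / c, by positivity, fun L hL v => ?_⟩
  set b : 𝒳 → Fin dρ → ℝ := fun x => (D.Sig x)⁻¹ *ᵥ L.dm v x with hb
  have hbL : ∀ i, MemLp (fun x => b x i) 2 D.PX := memLp_inv_mulVec hD (hL.dm_sq_int v)
  have hbb : Integrable (fun x => b x ⬝ᵥ b x) D.PX := by
    simp only [dotProduct]
    exact integrable_finsetSum _ fun i _ => (hbL i).integrable_mul (hbL i)
  set f : 𝒳 × 𝒴 → ℝ := fun z => ∑ i, b z.1 i * D.ρ z D.α₀ i with hf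
  have hfm : AEStronglyMeasurable f (D.PX ⊗ₘ D.κ) := by
    refine Finset.aestronglyMeasurable_fun_sum _ fun i _ => ?_
    refine AEStronglyMeasurable.mul ?_ (memLp_apply hD.sq_int_ρ i).1
    have h1 : AEStronglyMeasurable (fun x => b x i) ((D.PX ⊗ₘ D.κ).map Prod.fst) := by
      rw [← Measure.fst, Measure.fst_compProd]
      exact (hbL i).1
    exact h1.comp_measurable measurable_fst
  have hsq := integral_sq_residual hD
  -- A product of square integrable functions need not be square integrable; conditioning on `X`
  -- helps, because the conditional second moment `b'Σ₀b` is at most `C b'b`.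
  have hint : Integrable (fun z => f z ^ 2) (D.PX ⊗ₘ D.κ) := by
    refine (Measure.integrable_compProd_iff (hfm.pow 2)).2 ⟨hsq.mono fun x hx => (hx (b x)).2.1, ?_⟩
    refine (hbb.const_mul C).mono' ?_ ?_
    · exact (hfm.pow 2).norm.integral_kernel_compProd
    · filter_upwards [h, hsq] with x hx hx2
      have h1 : ∀ y, ‖f (x, y) ^ 2‖ = f (x, y) ^ 2 := fun y => by
        rw [Real.norm_eq_abs, abs_of_nonneg (sq_nonneg _)]
      have h2 : ∫ y, ‖(f ^ 2) (x, y)‖ ∂(D.κ x) = b x ⬝ᵥ (D.Sig₀ x *ᵥ b x) :=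
        (integral_congr_ae (Eventually.of_forall h1)).trans (hx2 (b x)).2.2.2
      rw [h2, Real.norm_eq_abs, abs_of_nonneg]
      · exact (hx.2.2 (b x)).2
      · exact (mul_nonneg hc.le (dotProduct_self_star_nonneg _)).trans (hx.2.2 (b x)).1
  have hf2 : MemLp f 2 (D.PX ⊗ₘ D.κ) := (memLp_two_iff_integrable_sq hfm).2 hint
  have hvar : variance (L.score v) D.P1 = ∫ x, b x ⬝ᵥ (D.Sig₀ x *ᵥ b x) ∂D.PX := by
    rw [variance_congr (score_eq hD v)]
    change variance f (D.PX ⊗ₘ D.κ) = _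
    rw [variance_eq_sub hf2]
    have h0 : ∫ z, f z ∂(D.PX ⊗ₘ D.κ) = 0 := by
      rw [Measure.integral_compProd (hf2.integrable one_le_two)]
      exact integral_eq_zero_of_ae (hsq.mono fun x hx => (hx (b x)).2.2.1)
    rw [h0]
    have h1 : ∫ z, (f ^ 2) z ∂(D.PX ⊗ₘ D.κ) = _ := Measure.integral_compProd hint
    rw [h1, zero_pow two_ne_zero, sub_zero]
    exact integral_congr_ae (hsq.mono fun x hx => (hx (b x)).2.2.2)
  have hS : Integrable (fun x => b x ⬝ᵥ (D.Sig₀ x *ᵥ b x)) D.PX :=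
    (hint.integral_compProd).congr (hsq.mono fun x hx => (hx (b x)).2.2.2)
  have hw := integrable_winner hD hL v v
  have e1 : c * ∫ x, b x ⬝ᵥ b x ∂D.PX ≤ variance (L.score v) D.P1 := by
    rw [hvar, ← integral_const_mul]
    exact integral_mono_ae (hbb.const_mul c) hS (h.mono fun x hx => (hx.2.2 (b x)).1)
  have e2 : variance (L.score v) D.P1 ≤ C * ∫ x, b x ⬝ᵥ b x ∂D.PX := by
    rw [hvar, ← integral_const_mul]
    exact integral_mono_ae hS (hbb.const_mul C) (h.mono fun x hx => (hx.2.2 (b x)).2)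
  have e3 : c * ∫ x, b x ⬝ᵥ b x ∂D.PX ≤ L.winner v v := by
    rw [← integral_const_mul]
    exact integral_mono_ae (hbb.const_mul c) hw
      (h.mono fun x hx => (hx.1.le_dotProduct_inv hc _).1)
  have e4 : L.winner v v ≤ C * ∫ x, b x ⬝ᵥ b x ∂D.PX := by
    rw [← integral_const_mul]
    exact integral_mono_ae hw (hbb.const_mul C)
      (h.mono fun x hx => (hx.1.le_dotProduct_inv hc _).2)
  constructor
  · rw [div_mul_eq_mul_div, div_le_iff₀ hC]
    nlinarith
  · rw [div_mul_eq_mul_div, le_div_iff₀ hc]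
    nlinarith

end Weak

end Model


/-! ### The strong norm -/

section Snorm

variable {dθ : ℕ} {H : Type*} [NormedAddCommGroup H]

theorem snorm_nonneg (α : Par dθ H) : 0 ≤ snorm α := add_nonneg (norm_nonneg _) (norm_nonneg _)

theorem snorm_le_two_mul_norm (α : Par dθ H) : snorm α ≤ 2 * ‖α‖ := by
  rw [two_mul]
  exact add_le_add (norm_fst_le α) (norm_snd_le α)

theorem snorm_add_le (α β : Par dθ H) : snorm (α + β) ≤ snorm α + snorm β := by
  have h1 := norm_add_le α.1 β.1
  have h2 := norm_add_le α.2 β.2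
  simp only [snorm, Prod.fst_add, Prod.snd_add]
  linarith

theorem continuous_snorm : Continuous (snorm : Par dθ H → ℝ) :=
  continuous_fst.norm.add continuous_snd.norm

end Snorm

namespace Model

variable {dθ dρ : ℕ} {H 𝒳 𝒴 W : Type*} [NormedAddCommGroup H] [NormedSpace ℝ H]
  [MeasurableSpace 𝒳] [MeasurableSpace 𝒴] [MeasurableSpace W]
  {D : Model dθ dρ H 𝒳 𝒴 W} {L : Loc D}

/-! ### Geometry of the shrinking neighbourhoods -/

theorem tendsto_Mseq (hL : L.Regular) : Tendsto L.Mseq atTop atTop := by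
  have h1 : Tendsto (fun n : ℕ => Real.log (Real.log ((n : ℝ) + 1))) atTop atTop :=
    Real.tendsto_log_atTop.comp (Real.tendsto_log_atTop.comp
      (tendsto_atTop_add_const_right _ _ tendsto_natCast_atTop_atTop))
  have h0 : Tendsto L.δs atTop (𝓝[>] 0) :=
    tendsto_nhdsWithin_iff.2 ⟨hL.δs_tendsto, hL.δs_pos⟩
  have h2 : Tendsto (fun n : ℕ => Real.log ((L.δs n)⁻¹ + 1)) atTop atTop :=
    Real.tendsto_log_atTop.comp (tendsto_atTop_add_const_right _ _
      (tendsto_inv_nhdsGT_zero.comp h0))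
  refine tendsto_atTop.2 fun b => ?_
  filter_upwards [h1.eventually_ge_atTop b, h2.eventually_ge_atTop b] with n ha hb
  exact le_min ha hb

/-- The cap `log (δs⁻¹ + 1)` in `Mseq` serves this purpose: since `log y ≤ 2 √y`, the product tends
to 0 with `δs`, which keeps the neighbourhoods inside the fixed ball of `Aos_nhd`. -/
theorem eventually_Mseq_mul_δs_lt (hL : L.Regular) {r : ℝ} (hr : 0 < r) :
    ∀ᶠ n in atTop, L.Mseq n * L.δs n < r := by
  have h1 : Tendsto (fun n => 2 * √(L.δs n ^ 2 + L.δs n)) atTop (𝓝 0) := by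
    have := (((hL.δs_tendsto.pow 2).add hL.δs_tendsto).sqrt).const_mul 2
    simpa using this
  filter_upwards [h1.eventually (gt_mem_nhds hr), hL.δs_pos] with n hn hpos
  refine lt_of_le_of_lt ?_ hn
  have hy : 0 < (L.δs n)⁻¹ + 1 := by positivity
  have hlog : Real.log ((L.δs n)⁻¹ + 1) ≤ 2 * √((L.δs n)⁻¹ + 1) := by
    have h2 := Real.log_le_sub_one_of_pos (Real.sqrt_pos.2 hy)
    rw [Real.log_sqrt hy.le] at h2
    linarith
  have hsq : L.δs n * √((L.δs n)⁻¹ + 1) = √(L.δs n ^ 2 + L.δs n) := by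
    rw [← Real.sqrt_sq hpos.le, ← Real.sqrt_mul (sq_nonneg _), Real.sqrt_sq hpos.le]
    congr 1
    field_simp
    ring
  calc L.Mseq n * L.δs n ≤ (2 * √((L.δs n)⁻¹ + 1)) * L.δs n :=
        mul_le_mul_of_nonneg_right ((min_le_right _ _).trans hlog) hpos.le
    _ = 2 * √(L.δs n ^ 2 + L.δs n) := by rw [← hsq]; ring

theorem Nosn_subset_Aosn (hL : L.Regular) : ∀ᶠ n in atTop, L.Nosn n ⊆ L.Aosn n := by
  obtain ⟨r, hr, h⟩ := hL.Aos_nhd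
  filter_upwards [eventually_Mseq_mul_δs_lt hL hr] with n hn α hα
  exact ⟨h α hα.1.1 (hα.2.2.1.trans_lt hn) hα.2.2.2, hα.1⟩

theorem snorm_projA_sub (n : ℕ) : snorm (D.projA n - D.α₀) = ‖D.projH n - D.α₀.2‖ := by
  simp [snorm, projA]

theorem projA_mem_sieveSpace (hD : D.Basic) (n : ℕ) : D.projA n ∈ D.sieveSpace n :=
  ⟨(interior_subset hD.α₀_mem : D.α₀.1 ∈ D.Θ), hD.projH_mem n⟩

theorem projA_mem_Aosn (hD : D.Basic) (hL : L.Regular)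
    (hP : ∀ᶠ n in atTop, D.Pen (D.projH n) ≤ L.M₀) : ∀ᶠ n in atTop, D.projA n ∈ L.Aosn n := by
  obtain ⟨r, hr, h⟩ := hL.Aos_nhd
  filter_upwards [hP, hD.projH_tendsto.eventually (gt_mem_nhds hr)] with n hn hn2
  exact ⟨h _ (projA_mem_sieveSpace hD n).1 (by rwa [snorm_projA_sub]) hn,
    projA_mem_sieveSpace hD n⟩

theorem sub_α₀n_mem_Vbar {n : ℕ} {α : Par dθ H} (hα : α ∈ L.Aosn n) : α - L.α₀n n ∈ L.Vbar n :=
  Submodule.subset_span ⟨α, hα, rfl⟩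

theorem Vbar_le (hL : L.Regular) : ∀ᶠ n in atTop,
    L.Vbar n ≤ (D.sieve (D.k n)).comap (LinearMap.snd ℝ (EuclideanSpace ℝ (Fin dθ)) H) := by
  filter_upwards [hL.α₀n_mem] with n hn
  refine Submodule.span_le.2 ?_
  rintro _ ⟨α, hα, rfl⟩
  exact (D.sieve (D.k n)).sub_mem hα.2.2 hn

theorem finiteDimensional_comap_snd {V : Submodule ℝ H} [FiniteDimensional ℝ V] :
    FiniteDimensional ℝ (V.comap (LinearMap.snd ℝ (EuclideanSpace ℝ (Fin dθ)) H)) := by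
  let f : V.comap (LinearMap.snd ℝ (EuclideanSpace ℝ (Fin dθ)) H) →ₗ[ℝ]
      EuclideanSpace ℝ (Fin dθ) × V :=
    { toFun := fun x => (x.1.1, ⟨x.1.2, x.2⟩)
      map_add' := fun _ _ => rfl
      map_smul' := fun _ _ => rfl }
  refine FiniteDimensional.of_injective f fun x y h => ?_
  have h1 : x.1.1 = y.1.1 := congrArg (fun p : EuclideanSpace ℝ (Fin dθ) × V => p.1) h
  have h2 : x.1.2 = y.1.2 := congrArg (fun p : EuclideanSpace ℝ (Fin dθ) × V => (p.2 : H)) h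
  exact Subtype.ext (Prod.ext h1 h2)

/-- On a finite-dimensional space the unit sphere is compact, so a nondegenerate quadratic form has
a positive minimum on it; homogeneity does the rest. -/
theorem exists_snorm_le_mul_wnorm (hD : D.Basic) (hL : L.Regular) (V : Submodule ℝ (Par dθ H))
    [FiniteDimensional ℝ V] (h : ∀ v ∈ V, L.wnorm v = 0 → v = 0) :
    ∃ K, ∀ v ∈ V, snorm v ≤ K * L.wnorm v := by
  have hproper : ProperSpace V := FiniteDimensional.proper ℝ V
  let B : V →ₗ[ℝ] V →L[ℝ] ℝ := (LinearMap.toContinuousLinearMap : (V →ₗ[ℝ] ℝ) ≃ₗ[ℝ] _).toLinearMap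
    ∘ₗ ((winnerForm hD hL).restrict V)
  have hB : ∀ x : V, B x x = L.wnorm (x : Par dθ H) ^ 2 := fun x => (wnorm_sq hD _).symm
  have hcont : Continuous fun x : V => B x x :=
    (LinearMap.continuous_of_finiteDimensional B).clm_apply continuous_id
  rcases (Metric.sphere (0 : V) 1).eq_empty_or_nonempty with he | hne
  · refine ⟨0, fun v hv => ?_⟩
    have hv0 : v = 0 := by
      by_contra hv0
      have : (‖v‖⁻¹ • (⟨v, hv⟩ : V)) ∈ Metric.sphere (0 : V) 1 := by
        rw [mem_sphere_zero_iff_norm, norm_smul, norm_inv, norm_norm]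
        exact inv_mul_cancel₀ (norm_ne_zero_iff.2 hv0)
      rw [he] at this
      exact this
    simp [hv0, snorm]
  · obtain ⟨x₀, hx₀, hmin⟩ := (isCompact_sphere (0 : V) 1).exists_isMinOn hne hcont.continuousOn
    have hw : 0 < L.wnorm (x₀ : Par dθ H) := by
      refine (wnorm_nonneg _).lt_of_ne fun h0 => ?_
      have : x₀ = 0 := Subtype.ext (h _ x₀.2 h0.symm)
      rw [this, mem_sphere_zero_iff_norm, norm_zero] at hx₀
      exact zero_ne_one hx₀
    refine ⟨2 / L.wnorm (x₀ : Par dθ H), fun v hv => ?_⟩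
    rcases eq_or_ne v 0 with rfl | hv0
    · have h0 : snorm (0 : Par dθ H) = 0 := by simp [snorm]
      rw [h0]
      exact mul_nonneg (by positivity) (wnorm_nonneg _)
    · have hn : 0 < ‖v‖ := norm_pos_iff.2 hv0
      have hs : (‖v‖⁻¹ • (⟨v, hv⟩ : V)) ∈ Metric.sphere (0 : V) 1 := by
        rw [mem_sphere_zero_iff_norm, norm_smul, norm_inv, norm_norm]
        exact inv_mul_cancel₀ hn.ne'
      have h1 := hmin hs
      simp only [mem_ofPred_eq, hB] at h1
      have h2 := le_of_sq_le_sq h1 (wnorm_nonneg _)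
      have h3 : L.wnorm (((‖v‖⁻¹ • (⟨v, hv⟩ : V) : V)) : Par dθ H) = ‖v‖⁻¹ * L.wnorm v := by
        have := wnorm_smul hD hL ‖v‖⁻¹ v
        rwa [abs_of_pos (inv_pos.2 hn)] at this
      rw [h3, le_inv_mul_iff₀ hn] at h2
      refine (snorm_le_two_mul_norm v).trans ?_
      rw [div_mul_eq_mul_div, le_div_iff₀ hw]
      nlinarith

/-- The point is that the ratios defining `τ` are bounded, by finite dimension and nondegeneracy of
`Vbar`; on an unbounded set `sSup` would be 0 and `τ` would carry no information. -/
theorem snorm_sub_projA_le (hD : D.Basic) (hL : L.Regular)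
    (hP : ∀ᶠ n in atTop, D.Pen (D.projH n) ≤ L.M₀) : ∀ᶠ n in atTop, ∀ α ∈ L.Aosn n,
      snorm (α - D.projA n) ≤ L.τ n * L.wnorm (α - D.projA n) := by
  filter_upwards [hL.nondeg, Vbar_le hL, projA_mem_Aosn hD hL hP] with n hn hV hp
  have := hD.finDim_sieve (D.k n)
  have hfd : FiniteDimensional ℝ
      ((D.sieve (D.k n)).comap (LinearMap.snd ℝ (EuclideanSpace ℝ (Fin dθ)) H)) :=
    finiteDimensional_comap_snd
  have hfdV : FiniteDimensional ℝ (L.Vbar n) := Submodule.finiteDimensional_of_le hV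
  obtain ⟨K, hK⟩ := exists_snorm_le_mul_wnorm hD hL (L.Vbar n) hn
  have hmem : ∀ α ∈ L.Aosn n, α - D.projA n ∈ L.Vbar n := fun α hα => by
    have := (L.Vbar n).sub_mem (sub_α₀n_mem_Vbar hα) (sub_α₀n_mem_Vbar hp)
    rwa [sub_sub_sub_cancel_right] at this
  intro α hα
  by_cases h0 : L.wnorm (α - D.projA n) = 0
  · have := hn _ (hmem α hα) h0
    rw [this]
    have hw0 : L.wnorm (0 : Par dθ H) = 0 := by rw [← this, h0]
    simp [hw0, snorm]
  · have hpos := (wnorm_nonneg (L := L) (α - D.projA n)).lt_of_ne' h0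
    rw [← div_le_iff₀ hpos]
    refine le_csSup ⟨K, ?_⟩ ⟨α, hα, h0, rfl⟩
    rintro _ ⟨β, hβ, hβ0, rfl⟩
    rw [div_le_iff₀ ((wnorm_nonneg (L := L) (β - D.projA n)).lt_of_ne' hβ0)]
    exact hK _ (hmem β hβ)

theorem τ_nonneg (n : ℕ) : 0 ≤ L.τ n := by
  refine Real.sSup_nonneg ?_
  rintro _ ⟨α, -, -, rfl⟩
  exact div_nonneg (snorm_nonneg _) (wnorm_nonneg _)

/-! ### Consistency and rates of convergence -/

/-- The true parameter is a well-separated zero of `Q`: outside a ball, the parameters of bounded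
penalty form a compact set, on which the lower semicontinuous `Q` attains a minimum, positive by
identification. -/
theorem exists_Q_le_imp_snorm_lt (hD : D.Basic) (M : ℝ) {r : ℝ} (hr : 0 < r) :
    ∃ ε > 0, ∀ α ∈ D.space, D.Pen α.2 ≤ M → D.Q α ≤ ε → snorm (α - D.α₀) < r := by
  set C : Set (Par dθ H) := (D.Θ ×ˢ {h | D.Pen h ≤ M}) ∩ {α | r ≤ snorm (α - D.α₀)} with hC
  have hcomp : IsCompact C := (hD.compact_Θ.prod (hD.pen_compact M)).inter_right
    (isClosed_le continuous_const (continuous_snorm.comp (continuous_id.sub continuous_const)))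
  have hsub : C ⊆ D.space := fun α hα => hα.1.1
  rcases C.eq_empty_or_nonempty with he | hne
  · refine ⟨1, one_pos, fun α hα hP _ => ?_⟩
    by_contra! hcon
    have : α ∈ C := ⟨⟨hα, hP⟩, hcon⟩
    rw [he] at this
    exact this
  · obtain ⟨a, ha, hmin⟩ := (hD.lsc_Q.mono hsub).exists_isMinOn hne hcomp
    have hQ : 0 < D.Q a := by
      refine (hD.Q_nonneg a).lt_of_ne fun h0 => ?_
      have h1 := hD.snorm_eq_zero_of_Q_eq_zero (hsub ha) h0.symm
      have h2 : r ≤ snorm (a - D.α₀) := ha.2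
      linarith
    refine ⟨D.Q a / 2, by positivity, fun α hα hP hq => ?_⟩
    by_contra! hcon
    have h1 : D.Q a ≤ D.Q α := hmin ⟨⟨hα, hP⟩, hcon⟩
    linarith

/-- Smallness of `Q` gives consistency, hence membership in `Aosn`; only then is the sharper bound
`K δ²` invoked, and curvature turns it into a weak rate. The same holds for `projA`, so `τ` converts
the weak distance to `projA` into a strong one. The divergence of `Mseq` absorbs all constants. -/
theorem mem_Nosn_of_Q_le (hD : D.Basic) (hL : L.Regular)
    (hP : ∀ᶠ n in atTop, D.Pen (D.projH n) ≤ L.M₀) (K : ℝ) {e : ℕ → ℝ}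
    (he : Tendsto e atTop (𝓝 0)) : ∀ᶠ n in atTop, ∀ a ∈ D.sieveSpace n, D.Pen a.2 ≤ L.M₀ →
      D.Q a ≤ e n → (a ∈ L.Aosn n → D.Q a ≤ K * L.δ n ^ 2) → a ∈ L.Nosn n := by
  obtain ⟨r, hr, hnhd⟩ := hL.Aos_nhd
  obtain ⟨ε, hε, hcons⟩ := exists_Q_le_imp_snorm_lt hD L.M₀ hr
  obtain ⟨c, hc, C, hcurv⟩ := hL.curvature
  set K₁ := √(max K 0 / c) with hK₁
  set K₂ := √(1 / c) with hK₂
  have hroot : ∀ (q k d : ℝ), 0 ≤ k → 0 < d → ∀ w, 0 ≤ w → c * w ^ 2 ≤ q → q ≤ k * d ^ 2 →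
      w ≤ √(k / c) * d := by
    intro q k d hk hd w hw h1 h2
    refine le_of_sq_le_sq ?_ (by positivity)
    rw [mul_pow, Real.sq_sqrt (by positivity), div_mul_eq_mul_div, le_div_iff₀ hc]
    linarith
  filter_upwards [he.eventually (gt_mem_nhds hε), hL.δ_max, hL.δs_pos,
    projA_mem_Aosn hD hL hP, snorm_sub_projA_le hD hL hP,
    (tendsto_Mseq hL).eventually_ge_atTop (K₁ + K₂ + 1)] with n hen hmax hδs hpA hτ hM a ha hPen hQ hloc
  have hδ := hL.δ_pos n
  have haos : a ∈ L.Aosn n := ⟨hnhd a ha.1 (hcons a ha.1 hPen (hQ.trans hen.le)) hPen, ha⟩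
  have hw : L.wnorm (a - D.α₀) ≤ K₁ * L.δ n :=
    hroot _ _ _ (le_max_right _ _) hδ _ (wnorm_nonneg _) (hcurv a haos.1).1
      ((hloc haos).trans (mul_le_mul_of_nonneg_right (le_max_left _ _) (sq_nonneg _)))
  have hwp : L.wnorm (D.projA n - D.α₀) ≤ K₂ * L.δ n :=
    hroot _ _ _ zero_le_one hδ _ (wnorm_nonneg _) (hcurv _ hpA.1).1
      (by rw [one_mul]; exact ((le_max_left _ _).trans (le_max_left _ _)).trans hmax)
  have hK₁0 : 0 ≤ K₁ := Real.sqrt_nonneg _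
  have hK₂0 : 0 ≤ K₂ := Real.sqrt_nonneg _
  have h0 := norm_nonneg (D.α₀.2 - D.projH n)
  have hτ0 := τ_nonneg (L := L) n
  refine ⟨ha, hw.trans (mul_le_mul_of_nonneg_right (by linarith) hδ.le), ?_, hPen⟩
  have h1 : snorm (a - D.α₀) ≤ snorm (a - D.projA n) + snorm (D.projA n - D.α₀) := by
    have := snorm_add_le (a - D.projA n) (D.projA n - D.α₀)
    rwa [sub_add_sub_cancel] at this
  have h2 : L.wnorm (a - D.projA n) ≤ (K₁ + K₂) * L.δ n := by
    have := wnorm_sub_le hD hL (a - D.α₀) (D.projA n - D.α₀)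
    rw [sub_sub_sub_cancel_right] at this
    linarith
  have h3 := hτ a haos
  have h4 : L.τ n * L.wnorm (a - D.projA n) ≤ (K₁ + K₂) * (L.τ n * L.δ n) := by
    have := mul_le_mul_of_nonneg_left h2 hτ0
    linarith
  have h5 := mul_nonneg hτ0 hδ.le
  rw [snorm_projA_sub, norm_sub_rev] at h1
  calc snorm (a - D.α₀) ≤ (K₁ + K₂ + 1) * L.δs n := by
        rw [Loc.δs]
        nlinarith [mul_nonneg (add_nonneg hK₁0 hK₂0) h0]
    _ ≤ L.Mseq n * L.δs n := mul_le_mul_of_nonneg_right hM hδs.le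

/-! ### The sieve Riesz representer -/

/-- Normal equations of the weak projection: the squared distance along the line through `α₀n` in
direction `w` is minimal at 0, so its linear coefficient vanishes. -/
theorem winner_α₀n_sub (hD : D.Basic) (hL : L.Regular) : ∀ᶠ n in atTop, ∀ w : Par dθ H,
    w.2 ∈ D.sieve (D.k n) → L.winner (L.α₀n n - D.α₀) w = 0 := by
  filter_upwards [hL.α₀n_mem, hL.α₀n_min] with n hmem hmin w hw
  set x := L.α₀n n - D.α₀ with hx
  have key : ∀ t : ℝ, 0 ≤ 2 * t * L.winner x w + t ^ 2 * L.winner w w := by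
    intro t
    have h1 := hmin (L.α₀n n + t • w)
      ((D.sieve (D.k n)).add_mem hmem ((D.sieve (D.k n)).smul_mem t hw))
    have h2 := pow_le_pow_left₀ (wnorm_nonneg _) h1 2
    have h3 : L.α₀n n + t • w - D.α₀ = x + t • w := by rw [hx]; abel
    rw [wnorm_sq hD, wnorm_sq hD, h3] at h2
    have h4 : L.winner (x + t • w) (x + t • w)
        = L.winner x x + 2 * t * L.winner x w + t ^ 2 * L.winner w w := by
      simp only [winner_eq hD hL, map_add, map_smul, LinearMap.add_apply, LinearMap.smul_apply,
        smul_eq_mul]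
      rw [← winner_eq hD hL w x, winner_comm hD w x, winner_eq hD hL]
      ring
    rw [h4] at h2
    linarith
  have hww := winner_self_nonneg (L := L) hD w
  by_contra hne
  -- Adding 1 to the denominator covers directions of zero weak norm without a case distinction.
  have h5 := key (-(L.winner x w) / (L.winner w w + 1))
  have h6 : 2 * (-(L.winner x w) / (L.winner w w + 1)) * L.winner x w
      + (-(L.winner x w) / (L.winner w w + 1)) ^ 2 * L.winner w w
      = -(L.winner x w ^ 2 * (L.winner w w + 2)) / (L.winner w w + 1) ^ 2 := by
    have : L.winner w w + 1 ≠ 0 := by positivity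
    field_simp
    ring
  rw [h6] at h5
  have h7 : 0 < L.winner x w ^ 2 * (L.winner w w + 2) / (L.winner w w + 1) ^ 2 := by positivity
  rw [neg_div] at h5
  linarith

theorem exists_wnorm_u_bounds (hD : D.Basic) (hL : L.Regular) : ∃ c > 0, ∃ C > 0, ∀ n,
    0 < L.sd n → c ≤ L.wnorm (L.u n) ^ 2 ∧ L.wnorm (L.u n) ^ 2 ≤ C ∧
      L.wnorm (L.v n) = L.sd n * L.wnorm (L.u n) ∧ L.v n = L.sd n • L.u n := by
  obtain ⟨c, hc, C, hC, h⟩ := variance_score_bounds hD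
  refine ⟨1 / C, by positivity, 1 / c, by positivity, fun n hn => ?_⟩
  have hv := h L hL (L.v n)
  have hsq : L.sd n ^ 2 = variance (L.score (L.v n)) D.P1 := Real.sq_sqrt (variance_nonneg _ _)
  have hvu : L.v n = L.sd n • L.u n := by rw [Loc.u, smul_inv_smul₀ hn.ne']
  have hw : L.wnorm (L.v n) = L.sd n * L.wnorm (L.u n) := by
    conv_lhs => rw [hvu]
    rw [wnorm_smul hD hL, abs_of_pos hn]
  rw [← hsq, ← wnorm_sq hD, hw, mul_pow] at hv
  have hn2 : 0 < L.sd n ^ 2 := by positivity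
  refine ⟨?_, ?_, hw, hvu⟩
  · rw [div_le_iff₀ hC]
    nlinarith [hv.2]
  · rw [le_div_iff₀ hc]
    nlinarith [hv.1]

/-- If `sd` vanished, then `u`, being scaled by the inverse of 0, would be 0 and so would the score,
contradicting its approximate normality at the point 0. -/
theorem eventually_sd_pos (hQ : L.LQA) : ∀ᶠ n in atTop, 0 < L.sd n := by
  filter_upwards [eventually_abs_measureReal_sub_absNormalCDF_le hQ.normal
    (show (0 : ℝ) < 1 / 6 by norm_num)] with n hn
  refine (Real.sqrt_nonneg _).lt_of_ne fun h0 => ?_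
  have hu : L.u n = 0 := by
    have : L.sd n = 0 := h0.symm
    rw [Loc.u, this, inv_zero, zero_smul]
  have hZ : ∀ z, √n * L.Z n (obs n z) (fun _ => 1) = 0 := fun z => by
    simp [Loc.Z, Loc.score, hu]
  have h1 := hn 0
  simp only [hZ, abs_zero, le_refl, absNormalCDF_zero] at h1
  norm_num at h1

/-- Linearization of the functional over the shrinking neighbourhoods. -/
theorem eventually_φ_linear (hD : D.Basic) (hL : L.Regular) (hQ : L.LQA) {ε : ℝ} (hε : 0 < ε) :
    ∀ᶠ n : ℕ in atTop, ∀ α ∈ L.Nosn n, ∀ t ∈ L.T n,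
      |√n * ((D.φ (α + t • L.u n) - D.φ D.α₀) / L.sd n)
        - √n * (L.winner (L.u n) (α - D.α₀) + t * L.wnorm (L.u n) ^ 2)| ≤ ε := by
  obtain ⟨c, hc, C, hC, hu⟩ := exists_wnorm_u_bounds hD hL
  set ε' := ε / (2 * √C) with hε'
  have hCs : 0 < √C := Real.sqrt_pos.2 hC
  have hε0 : 0 < ε' := by positivity
  filter_upwards [hL.φ_nonlin ε' hε0, hL.φ_bias ε' hε0, hL.riesz, hL.v_mem, Vbar_le hL,
    winner_α₀n_sub hD hL, Nosn_subset_Aosn hL, eventually_sd_pos hQ] with n h1 h2 h3 h4 h5 h6 h7 h8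
  obtain ⟨-, huC, hwv, hvu⟩ := hu n h8
  intro α hα t ht
  have e1 := h1 α hα t ht
  -- The representer acts only on `Vbar`, so `α - α₀` is split at `α₀n`: by orthogonality the weak
  -- product with `v` ignores `α₀n - α₀`, and the value of the derivative there is the bias term.
  have e3 : L.winner (L.v n) (L.α₀n n - D.α₀) = 0 := by
    rw [winner_comm hD]
    exact h6 _ (h5 h4)
  have e4 := h3 _ (sub_α₀n_mem_Vbar (h7 hα))
  have e5 : D.dφ (L.v n) = L.winner (L.v n) (L.v n) := h3 _ h4
  have e6 : L.winner (L.v n) (α - D.α₀) = L.winner (L.v n) (α - L.α₀n n) := by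
    have : α - D.α₀ = (α - L.α₀n n) + (L.α₀n n - D.α₀) := by abel
    rw [this, winner_eq hD hL, map_add, ← winner_eq hD hL, ← winner_eq hD hL, e3, add_zero]
  have e7 : D.dφ (L.u n) = L.sd n * L.wnorm (L.u n) ^ 2 := by
    have e8 : L.sd n * D.dφ (L.u n) = L.sd n ^ 2 * L.wnorm (L.u n) ^ 2 := by
      rw [← mul_pow, ← hwv, wnorm_sq hD, ← e5, ← smul_eq_mul, ← map_smul, ← hvu]
    have := mul_left_cancel₀ h8.ne' (e8.trans (by ring : _ = L.sd n * (L.sd n * L.wnorm (L.u n) ^ 2)))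
    exact this
  have e9 : L.winner (L.v n) (α - D.α₀) = L.sd n * L.winner (L.u n) (α - D.α₀) := by
    conv_lhs => rw [hvu]
    rw [winner_eq hD hL, map_smul, LinearMap.smul_apply, smul_eq_mul, ← winner_eq hD hL]
  have e10 : D.dφ (α + t • L.u n - D.α₀) = L.sd n * L.winner (L.u n) (α - D.α₀)
      + t * (L.sd n * L.wnorm (L.u n) ^ 2) + D.dφ (L.α₀n n - D.α₀) := by
    have : α + t • L.u n - D.α₀ = (α - L.α₀n n) + t • L.u n + (L.α₀n n - D.α₀) := by abel
    rw [this, map_add, map_add, map_smul, smul_eq_mul, e7, e4, ← e6, e9]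
  have hw : L.wnorm (L.v n) ≤ L.sd n * √C := by
    rw [hwv]
    exact mul_le_mul_of_nonneg_left (Real.le_sqrt_of_sq_le huC) h8.le
  have e11 : √n * ((D.φ (α + t • L.u n) - D.φ D.α₀) / L.sd n)
        - √n * (L.winner (L.u n) (α - D.α₀) + t * L.wnorm (L.u n) ^ 2)
      = (√n * (D.φ (α + t • L.u n) - D.φ D.α₀ - D.dφ (α + t • L.u n - D.α₀))
        + √n * D.dφ (L.α₀n n - D.α₀)) / L.sd n := by
    rw [e10]
    field_simp
    ring
  rw [e11, abs_div, abs_of_pos h8, div_le_iff₀ h8]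
  refine (abs_add_le _ _).trans ?_
  rw [abs_mul, abs_mul, abs_of_nonneg (Real.sqrt_nonneg _)]
  have : ε' * (L.sd n * √C) = ε * L.sd n / 2 := by rw [hε']; field_simp
  nlinarith [mul_le_mul_of_nonneg_left hw hε0.le]

end Model


namespace Model

variable {dθ dρ : ℕ} {H 𝒳 𝒴 W : Type*} [NormedAddCommGroup H] [NormedSpace ℝ H]
  [MeasurableSpace 𝒳] [MeasurableSpace 𝒴] [MeasurableSpace W]
  {D : Model dθ dρ H 𝒳 𝒴 W} {L : Loc D}

/-! ### Localization of the estimators -/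

/-- `a` lies in the sieve space, and its penalty and its criterion are of the order of the
penalization. -/
def Admissible (D : Model dθ dρ H 𝒳 𝒴 W) (K : ℝ) (n : ℕ) (zs : Fin n → 𝒳 × 𝒴) (b : Fin n → ℝ)
    (a : Par dθ H) : Prop :=
  a ∈ D.sieveSpace n ∧ D.Pen a.2 ≤ K ∧ D.crit n zs b a ≤ K * D.lam n

/-- Criterion and penalty are both nonnegative, so a bound `K λ` on their penalized sum bounds each;
dividing by `λ > 0` bounds the penalty by `K`. -/
theorem Admissible.of_approxMin (hD : D.Basic) {n : ℕ} {zs : Fin n → 𝒳 × 𝒴} {b : Fin n → ℝ}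
    {C : Set (Par dθ H)} {a α : Par dθ H} {K : ℝ} (hpd : ∀ i, (D.SigHat n zs (zs i).1).PosDef)
    (ha : D.ApproxMin n zs b C a) (hC : C ⊆ D.sieveSpace n) (hα : α ∈ C)
    (hK : D.crit n zs b α + D.lam n * D.Pen α.2 + D.η n ≤ K * D.lam n) :
    D.Admissible K n zs b a := by
  have h1 := (ha.2 α hα).trans hK
  have hlam := hD.lam_pos n
  have h2 := crit_nonneg hpd b a
  have h3 := mul_nonneg hlam.le (hD.pen_nonneg a.2)
  refine ⟨hC ha.1, ?_, by linarith⟩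
  by_contra! hcon
  nlinarith

/-- The constant depends on the global conditions only, so it can serve as lower bound for `M₀`
before any local object is given. -/
theorem exists_admissible (hD : D.Basic) : ∃ K, (∀ᶠ n in atTop, D.Pen (D.projH n) ≤ K) ∧
    Wpa1 D.P (fun n z => D.Admissible K n (obs n z) (fun _ => 1) (D.αhat n (obs n z))) ∧
    CondWpa1 D.P D.R (fun n z w => D.Admissible K n (obs n z) (D.wts n w)
      (D.αhatB n (obs n z) (D.wts n w))) ∧
    CondWpa1 D.P D.R (fun n z w => D.Admissible K n (obs n z) (D.wts n w)
      (D.αhatRB n (obs n z) (D.wts n w))) := by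
  obtain ⟨c, hc, hup⟩ := hD.upper
  obtain ⟨c', hc', hupB⟩ := hD.upperB
  obtain ⟨C₁, hC₁⟩ := hD.lam_big
  obtain ⟨C₂, hC₂⟩ := hD.pen_bdd
  set K₀ := c * C₁ + 2 * C₁ + (D.Pen D.α₀.2 + C₂) with hK₀
  set K₁ := c' * K₀ + 2 * C₁ + K₀ with hK₁
  have hsmall : ∀ᶠ n in atTop, D.Q (D.projA n) ≤ C₁ * D.lam n ∧ D.η n ≤ C₁ * D.lam n ∧
      D.Pen (D.projH n) ≤ D.Pen D.α₀.2 + C₂ := by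
    filter_upwards [hC₁, hC₂] with n h1 h2
    have := hD.Q_nonneg (D.projA n)
    have := hD.η_pos n
    exact ⟨by linarith, by linarith, by linarith [(abs_le.1 h2).2]⟩
  have hest : Wpa1 D.P fun n z =>
      D.Admissible K₀ n (obs n z) (fun _ => 1) (D.αhat n (obs n z)) := by
    refine ((hD.est.and hup).and hD.posDef_SigHat).mono ?_
    filter_upwards [hsmall] with n ⟨h1, h2, h3⟩ z ⟨⟨he, hu⟩, hpd⟩
    refine Admissible.of_approxMin hD hpd he subset_rfl (projA_mem_sieveSpace hD n) ?_
    have h4 : D.crit n (obs n z) (fun _ => 1) (D.projA n) ≤ c * D.Q (D.projA n) + D.η n := hu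
    have h5 := mul_le_mul_of_nonneg_left h1 hc.le
    have h6 : D.lam n * D.Pen (D.projA n).2 ≤ D.lam n * (D.Pen D.α₀.2 + C₂) :=
      mul_le_mul_of_nonneg_left h3 (hD.lam_pos n).le
    rw [hK₀]
    linarith
  -- One argument for both bootstrap estimators: `αhat` is a feasible competitor in either problem,
  -- as it satisfies the restriction by construction.
  have hboot : ∀ (a : (n : ℕ) → (ℕ → 𝒳 × 𝒴) → W → Par dθ H)
      (C : (n : ℕ) → (ℕ → 𝒳 × 𝒴) → Set (Par dθ H)), (∀ n z, C n z ⊆ D.sieveSpace n) →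
      (∀ n z, D.αhat n (obs n z) ∈ D.sieveSpace n → D.αhat n (obs n z) ∈ C n z) →
      CondWpa1 D.P D.R (fun n z w => D.ApproxMin n (obs n z) (D.wts n w) (C n z) (a n z w)) →
      CondWpa1 D.P D.R (fun n z w => D.Admissible K₁ n (obs n z) (D.wts n w) (a n z w)) := by
    intro a C hCs hCm ha
    refine (((ha.and hupB).and hD.posDef_SigHat.cond).and hest.cond).mono ?_
    filter_upwards [hsmall] with n ⟨h1, h2, h3⟩ z w ⟨⟨⟨he, hu⟩, hpd⟩, hadm⟩
    refine Admissible.of_approxMin hD hpd he (hCs n z) (hCm n z hadm.1) ?_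
    have h4 : D.crit n (obs n z) (D.wts n w) (D.αhat n (obs n z))
      ≤ c' * D.crit n (obs n z) (fun _ => 1) (D.αhat n (obs n z)) + D.η n := hu
    have h5 := mul_le_mul_of_nonneg_left hadm.2.2 hc'.le
    have h6 := mul_le_mul_of_nonneg_left hadm.2.1 (hD.lam_pos n).le
    rw [hK₁]
    linarith
  have hmono : ∀ {K K' : ℝ} {n : ℕ} {zs : Fin n → 𝒳 × 𝒴} {b : Fin n → ℝ} {a : Par dθ H},
      K ≤ K' → D.Admissible K n zs b a → D.Admissible K' n zs b a := fun h ha =>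
    ⟨ha.1, ha.2.1.trans h, ha.2.2.trans (mul_le_mul_of_nonneg_right h (hD.lam_pos _).le)⟩
  refine ⟨max (max K₀ K₁) (D.Pen D.α₀.2 + C₂), hsmall.mono fun n hn => hn.2.2.trans
    (le_max_right _ _), hest.mono (Eventually.of_forall fun n z => hmono ?_),
    (hboot _ (fun n _ => D.sieveSpace n) (fun _ _ => subset_rfl) (fun _ _ h => h) hD.estB).mono
      (Eventually.of_forall fun n z w => hmono ?_),
    (hboot _ (fun n z => {α ∈ D.sieveSpace n | D.φ α = D.φ (D.αhat n (obs n z))})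
      (fun _ _ => sep_subset _ _) (fun _ _ h => ⟨h, rfl⟩) hD.estRB).mono
      (Eventually.of_forall fun n z w => hmono ?_)⟩
  · exact (le_max_left _ _).trans (le_max_left _ _)
  · exact (le_max_right _ _).trans (le_max_left _ _)
  · exact (le_max_right _ _).trans (le_max_left _ _)

/-- `q` stands for the sample criterion at `a`. The coarse rate `δbar` only has to give consistency;
the final rate comes from the local bound. -/
theorem eventually_mem_Nosn_of_lower (hD : D.Basic) (hL : L.Regular)
    (hP : ∀ᶠ n in atTop, D.Pen (D.projH n) ≤ L.M₀) {c c' : ℝ} (hc : 0 < c) (hc' : 0 < c')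
    (K₁ K₂ : ℝ) {e : ℕ → ℝ} (he : Tendsto e atTop (𝓝 0)) (K₃ : ℝ) :
    ∀ᶠ n in atTop, ∀ a ∈ D.sieveSpace n, ∀ q, D.Pen a.2 ≤ L.M₀ →
      c * D.Q a - K₁ * L.δbar n ^ 2 ≤ q → (a ∈ L.Aosn n → c' * D.Q a - K₂ * L.δ n ^ 2 ≤ q) →
      q ≤ e n → (a ∈ L.Aosn n → q ≤ K₃ * L.δ n ^ 2) → a ∈ L.Nosn n := by
  have h1 : Tendsto (fun n => (e n + K₁ * L.δbar n ^ 2) / c) atTop (𝓝 0) := by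
    have := (he.add ((hL.δbar_tendsto.pow 2).const_mul K₁)).div_const c
    simpa using this
  filter_upwards [mem_Nosn_of_Q_le hD hL hP ((K₃ + K₂) / c') h1] with n hn a ha q hPen hlow hloc hq hq2
  refine hn a ha hPen ?_ fun haos => ?_
  · rw [le_div_iff₀ hc]
    linarith
  · rw [div_mul_eq_mul_div, le_div_iff₀ hc']
    have := hloc haos
    have := hq2 haos
    linarith

theorem wpa1_lower (hL : L.Regular) : ∃ c > 0, ∃ c' > 0, ∀ ε > 0, ∃ K > 0, ∀ᶠ n in atTop,
    D.P {z | ¬ ((∀ α ∈ L.penSieve n, c * D.Q α - K * L.δbar n ^ 2 ≤ D.Qhat n (obs n z) α) ∧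
      ∀ α ∈ L.Aosn n, c' * D.Q α - K * L.δ n ^ 2 ≤ D.Qhat n (obs n z) α)}
      ≤ ENNReal.ofReal ε := by
  obtain ⟨c, hc, h⟩ := hL.lower
  obtain ⟨c', hc', h'⟩ := hL.lower_loc
  refine ⟨c, hc, c', hc', fun ε hε => ?_⟩
  obtain ⟨K, hK, h⟩ := h (ε / 2) (by positivity)
  obtain ⟨K', hK', h'⟩ := h' (ε / 2) (by positivity)
  refine ⟨max K K', lt_max_of_lt_left hK, ?_⟩
  filter_upwards [h, h'] with n hn hn'
  rw [← add_halves ε, ENNReal.ofReal_add (by positivity) (by positivity)]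
  refine le_trans ?_ ((measure_union_le _ _).trans (add_le_add hn hn'))
  refine measure_mono fun z hz => ?_
  by_contra hcon
  simp only [mem_union, mem_ofPred_eq, not_or, not_exists, not_and, not_lt] at hcon
  rw [mem_ofPred_eq, not_and] at hz
  refine hz (fun α hα => le_trans ?_ (hcon.1 α hα)) fun α hα => le_trans ?_ (hcon.2 α hα)
  · gcongr
    exact le_max_left _ _
  · gcongr
    exact le_max_right _ _

theorem wpa1_αhat_mem_Nosn (hD : D.Basic) (hL : L.Regular) {K : ℝ} (hK : K ≤ L.M₀)
    (hP : ∀ᶠ n in atTop, D.Pen (D.projH n) ≤ K)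
    (ha : Wpa1 D.P fun n z =>
      D.Admissible K n (obs n z) (fun _ => 1) (D.αhat n (obs n z))) :
    Wpa1 D.P fun n z => D.αhat n (obs n z) ∈ L.Nosn n := by
  obtain ⟨c, hc, c', hc', hlow⟩ := wpa1_lower hL
  refine Wpa1.of_tight (G := fun K n z =>
    (∀ α ∈ L.penSieve n, c * D.Q α - K * L.δbar n ^ 2 ≤ D.Qhat n (obs n z) α) ∧
      ∀ α ∈ L.Aosn n, c' * D.Q α - K * L.δ n ^ 2 ≤ D.Qhat n (obs n z) α) hlow fun K₁ _ => ?_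
  refine ha.mono ?_
  have he : Tendsto (fun n => K * D.lam n) atTop (𝓝 0) := by
    simpa using hD.lam_tendsto.const_mul K
  filter_upwards [eventually_mem_Nosn_of_lower hD hL (hP.mono fun n h => h.trans hK) hc hc' K₁ K₁
    he |K|, hL.δ_max] with n hn hmax z ⟨hs, hPen, hq⟩ ⟨h1, h2⟩
  have hPen' := hPen.trans hK
  refine hn _ hs _ hPen' (h1 _ ⟨hs, hPen'⟩) (fun h => h2 _ h) hq fun _ => hq.trans ?_
  have hlam : D.lam n ≤ L.δ n ^ 2 := ((le_max_right _ _).trans (le_max_left _ _)).trans hmax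
  calc K * D.lam n ≤ |K| * D.lam n := mul_le_mul_of_nonneg_right (le_abs_self K) (hD.lam_pos n).le
    _ ≤ |K| * L.δ n ^ 2 := mul_le_mul_of_nonneg_left hlam (abs_nonneg K)

theorem condWpa1_lowerB (hL : L.Regular) : ∃ c > 0, ∃ c' > 0, ∀ ε > 0, ∃ K > 0,
    Tendsto (fun n => D.P {z | ENNReal.ofReal ε < D.R {w | ¬ (
      (∀ α ∈ L.penSieve n, c * D.Qhat n (obs n z) α - K * L.δbarB n ^ 2
        ≤ D.QB n (obs n z) (D.wts n w) α) ∧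
      ∀ α ∈ L.Aosn n, c' * D.Qhat n (obs n z) α - K * L.δ n ^ 2
        ≤ D.QB n (obs n z) (D.wts n w) α)}}) atTop (𝓝 0) := by
  obtain ⟨c, hc, h⟩ := hL.lowerB
  obtain ⟨c', hc', h'⟩ := hL.lowerB_loc
  refine ⟨c, hc, c', hc', fun ε hε => ?_⟩
  obtain ⟨K, hK, h⟩ := h (ε / 2) (by positivity)
  obtain ⟨K', hK', h'⟩ := h' (ε / 2) (by positivity)
  refine ⟨max K K', lt_max_of_lt_left hK, ?_⟩
  have h1 : Wpa1 D.P fun n z => D.R {w | ∃ α ∈ L.penSieve n, D.QB n (obs n z) (D.wts n w) α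
      < c * D.Qhat n (obs n z) α - K * L.δbarB n ^ 2} ≤ ENNReal.ofReal (ε / 2) := by
    simpa only [Wpa1, not_le] using h
  have h2 : Wpa1 D.P fun n z => D.R {w | ∃ α ∈ L.Aosn n, D.QB n (obs n z) (D.wts n w) α
      < c' * D.Qhat n (obs n z) α - K' * L.δ n ^ 2} ≤ ENNReal.ofReal (ε / 2) := by
    simpa only [Wpa1, not_le] using h'
  suffices Wpa1 D.P fun n z => D.R {w | ¬ (
      (∀ α ∈ L.penSieve n, c * D.Qhat n (obs n z) α - max K K' * L.δbarB n ^ 2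
        ≤ D.QB n (obs n z) (D.wts n w) α) ∧
      ∀ α ∈ L.Aosn n, c' * D.Qhat n (obs n z) α - max K K' * L.δ n ^ 2
        ≤ D.QB n (obs n z) (D.wts n w) α)} ≤ ENNReal.ofReal ε by
    simpa only [Wpa1, not_le] using this
  refine (h1.and h2).mono (Eventually.of_forall fun n z ⟨hn, hn'⟩ => ?_)
  rw [← add_halves ε, ENNReal.ofReal_add (by positivity) (by positivity)]
  refine le_trans ?_ ((measure_union_le _ _).trans (add_le_add hn hn'))
  refine measure_mono fun w hw => ?_
  by_contra hcon
  simp only [mem_union, mem_ofPred_eq, not_or, not_exists, not_and, not_lt] at hcon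
  rw [mem_ofPred_eq, not_and] at hw
  refine hw (fun α hα => le_trans ?_ (hcon.1 α hα)) fun α hα => le_trans ?_ (hcon.2 α hα)
  · gcongr
    exact le_max_left _ _
  · gcongr
    exact le_max_right _ _

/-- Two lower bounds are chained: the bootstrap criterion controls the original one, which controls
`Q`. Both are used with coarse rates for consistency and with local rates afterwards. -/
theorem condWpa1_mem_Nosn (hD : D.Basic) (hL : L.Regular) {K : ℝ} (hK : K ≤ L.M₀)
    (hP : ∀ᶠ n in atTop, D.Pen (D.projH n) ≤ K) {a : (n : ℕ) → (ℕ → 𝒳 × 𝒴) → W → Par dθ H}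
    (ha : CondWpa1 D.P D.R fun n z w => D.Admissible K n (obs n z) (D.wts n w) (a n z w)) :
    CondWpa1 D.P D.R fun n z w => a n z w ∈ L.Nosn n := by
  obtain ⟨c, hc, c', hc', hlow⟩ := wpa1_lower hL
  obtain ⟨b, hb, b', hb', hlowB⟩ := condWpa1_lowerB hL
  refine CondWpa1.of_tight_data (G := fun K n z =>
    (∀ α ∈ L.penSieve n, c * D.Q α - K * L.δbar n ^ 2 ≤ D.Qhat n (obs n z) α) ∧
      ∀ α ∈ L.Aosn n, c' * D.Q α - K * L.δ n ^ 2 ≤ D.Qhat n (obs n z) α) hlow fun K₁ _ => ?_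
  refine CondWpa1.of_tight (G := fun K n z w =>
    (∀ α ∈ L.penSieve n, b * D.Qhat n (obs n z) α - K * L.δbarB n ^ 2
        ≤ D.QB n (obs n z) (D.wts n w) α) ∧
      ∀ α ∈ L.Aosn n, b' * D.Qhat n (obs n z) α - K * L.δ n ^ 2
        ≤ D.QB n (obs n z) (D.wts n w) α) hlowB fun K₂ _ => ?_
  refine ha.mono ?_
  have he : Tendsto (fun n => (K * D.lam n + K₂ * L.δbarB n ^ 2) / b) atTop (𝓝 0) := by
    have := ((hD.lam_tendsto.const_mul K).add ((hL.δbarB_tendsto.pow 2).const_mul K₂)).div_const b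
    simpa using this
  filter_upwards [eventually_mem_Nosn_of_lower hD hL (hP.mono fun n h => h.trans hK) hc hc' K₁ K₁
    he ((|K| + K₂) / b'), hL.δ_max] with n hn hmax z w ⟨hs, hPen, hq⟩ ⟨h3, h4⟩ ⟨h1, h2⟩
  have hPen' := hPen.trans hK
  have hlam : D.lam n ≤ L.δ n ^ 2 := ((le_max_right _ _).trans (le_max_left _ _)).trans hmax
  have hq' : D.QB n (obs n z) (D.wts n w) (a n z w) ≤ K * D.lam n := hq
  refine hn _ hs _ hPen' (h1 _ ⟨hs, hPen'⟩) (fun h => h2 _ h) ?_ fun haos => ?_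
  · have := h3 _ ⟨hs, hPen'⟩
    rw [le_div_iff₀ hb]
    linarith
  · have := h4 _ haos
    have h5 : K * D.lam n ≤ |K| * L.δ n ^ 2 :=
      (mul_le_mul_of_nonneg_right (le_abs_self K) (hD.lam_pos n).le).trans
        (mul_le_mul_of_nonneg_left hlam (abs_nonneg K))
    rw [div_mul_eq_mul_div, le_div_iff₀ hb']
    linarith

end Model


namespace Model

variable {dθ dρ : ℕ} {H 𝒳 𝒴 W : Type*} [NormedAddCommGroup H] [NormedSpace ℝ H]
  [MeasurableSpace 𝒳] [MeasurableSpace 𝒴] [MeasurableSpace W]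
  {D : Model dθ dρ H 𝒳 𝒴 W} {L : Loc D}

/-! ### Local expansions on the scale `n^{-1/2}` -/

/-- The local quadratic expansion of the criterion with weights `b` holds up to `e`. -/
def Expands (L : Loc D) (e : ℝ) (n : ℕ) (zs : Fin n → 𝒳 × 𝒴) (b : Fin n → ℝ) (curv : ℝ) : Prop :=
  ∀ α ∈ L.Nosn n, ∀ t ∈ L.T n, |L.remainder n zs b curv α t| ≤ e * L.rate n t

/-- Rescaled slope of the criterion with weights `b` at `α` along the representer. -/
noncomputable def slope (L : Loc D) (n : ℕ) (zs : Fin n → 𝒳 × 𝒴) (b : Fin n → ℝ)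
    (α : Par dθ H) : ℝ :=
  √n * (L.Z n zs b + L.winner (L.u n) (α - D.α₀))

/-- Rescaled increment of the criterion with weights `b` at `α` along the representer. -/
noncomputable def incr (L : Loc D) (n : ℕ) (zs : Fin n → 𝒳 × 𝒴) (b : Fin n → ℝ)
    (α : Par dθ H) (x : ℝ) : ℝ :=
  n * (D.crit n zs b (α + (x / √n) • L.u n) - D.crit n zs b α)

theorem wpa1_expands (hQ : L.LQA) {e : ℝ} (he : 0 < e) : Wpa1 D.P fun n z =>
    Expands L e n (obs n z) (fun _ => 1) (L.B n (obs n z)) := by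
  have := hQ.expansion e he
  simpa only [Wpa1, Expands, not_forall, not_le, exists_prop] using this

theorem Expands.mono {e e' : ℝ} (hee : e ≤ e') {n : ℕ} {zs : Fin n → 𝒳 × 𝒴} {b : Fin n → ℝ}
    {curv : ℝ} (h : Expands L e n zs b curv) : Expands L e' n zs b curv := fun α hα t ht =>
  (h α hα t ht).trans (mul_le_mul_of_nonneg_right hee
    (((sq_nonneg t).trans (le_max_left _ _)).trans (le_max_left _ _)))

theorem condWpa1_expands (hB : L.LQAB) {e : ℝ} (he : 0 < e) : CondWpa1 D.P D.R fun n z w =>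
    Expands L e n (obs n z) (D.wts n w) (L.Bω n (obs n z) (D.wts n w)) := by
  refine condWpa1_iff.2 fun ε hε => ?_
  have h : Wpa1 D.P fun n z => D.R {w | ¬ Expands L (min e ε) n (obs n z) (D.wts n w)
      (L.Bω n (obs n z) (D.wts n w))} ≤ ENNReal.ofReal (min e ε) := by
    have := hB.expansion (min e ε) (lt_min he hε)
    simpa only [Wpa1, Expands, not_forall, not_le, exists_prop] using this
  refine h.mono (Eventually.of_forall fun n z hz => ?_)
  refine (measure_mono ?_).trans (hz.trans (ENNReal.ofReal_le_ofReal (min_le_right _ _)))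
  intro w hw hw'
  exact hw (Expands.mono (min_le_left _ _) hw')

theorem zero_mem_T (hL : L.Regular) : ∀ n, (0 : ℝ) ∈ L.T n := fun n => by
  have := (hL.δ_pos n).le
  simp only [Loc.T, mem_ofPred_eq, abs_zero]
  positivity

/-- On the scale `t = x / √n` the allowed remainder, multiplied by n, stays bounded for bounded `x`.
-/
theorem mul_rate_div_sqrt {n : ℕ} (hn : 0 < n) (x : ℝ) :
    n * L.rate n (x / √n) = max (max (x ^ 2) |x|) (n * D.η n) := by
  have hn0 : (0 : ℝ) < n := by exact_mod_cast hn
  have hs : 0 < √(n : ℝ) := Real.sqrt_pos.2 hn0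
  have h1 : (n : ℝ) * (x / √n) ^ 2 = x ^ 2 := by
    rw [div_pow, Real.sq_sqrt hn0.le, mul_div_cancel₀ _ hn0.ne']
  have h2 : (n : ℝ) * (|x / √n| / √n) = |x| := by
    rw [abs_div, abs_of_pos hs, div_div, Real.mul_self_sqrt hn0.le, mul_div_cancel₀ _ hn0.ne']
  rw [Loc.rate, mul_max_of_nonneg _ _ hn0.le, mul_max_of_nonneg _ _ hn0.le, h1, h2]

theorem abs_incr_sub_le_max {e : ℝ} {n : ℕ} (hn : 0 < n) {zs : Fin n → 𝒳 × 𝒴} {b : Fin n → ℝ}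
    {curv : ℝ} (h : Expands L e n zs b curv) {α : Par dθ H} (hα : α ∈ L.Nosn n) {x : ℝ}
    (ht : x / √n ∈ L.T n) :
    |incr L n zs b α x - (2 * x * slope L n zs b α + curv * x ^ 2)|
      ≤ 2 * e * max (max (x ^ 2) |x|) (n * D.η n) := by
  have hn0 : (0 : ℝ) < n := by exact_mod_cast hn
  have h1 := h α hα _ ht
  have h2 : incr L n zs b α x - (2 * x * slope L n zs b α + curv * x ^ 2)
      = 2 * n * L.remainder n zs b curv α (x / √n) := by
    have h3 : (n : ℝ) * (x / √n) = x * √n := by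
      rw [mul_div_assoc', mul_comm, mul_div_assoc, Real.div_sqrt]
    have h4 : (n : ℝ) * (x / √n) ^ 2 = x ^ 2 := by
      rw [div_pow, Real.sq_sqrt hn0.le, mul_div_cancel₀ _ hn0.ne']
    rw [incr, slope, Loc.remainder]
    linear_combination (2 * (L.Z n zs b + L.winner (L.u n) (α - D.α₀))) * h3 + curv * h4
  rw [h2, abs_mul, abs_of_nonneg (by positivity), ← mul_rate_div_sqrt hn]
  have h3 := mul_le_mul_of_nonneg_left h1 hn0.le
  linarith

theorem abs_incr_sub_le {e : ℝ} (he : 0 ≤ e) {n : ℕ} (hn : 0 < n) (hη : n * D.η n ≤ 1)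
    {zs : Fin n → 𝒳 × 𝒴} {b : Fin n → ℝ} {curv : ℝ} (h : Expands L e n zs b curv) {α : Par dθ H}
    (hα : α ∈ L.Nosn n) {x K : ℝ} (hx : |x| ≤ K) (ht : x / √n ∈ L.T n) :
    |incr L n zs b α x - (2 * x * slope L n zs b α + curv * x ^ 2)| ≤ 2 * e * (K ^ 2 + K + 1) := by
  have hK : 0 ≤ K := (abs_nonneg x).trans hx
  refine (abs_incr_sub_le_max hn h hα ht).trans ?_
  have h6 : x ^ 2 ≤ K ^ 2 := by
    rw [← sq_abs]
    exact pow_le_pow_left₀ (abs_nonneg x) hx 2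
  have hK2 := sq_nonneg K
  gcongr
  exact max_le (max_le (by linarith) (by linarith)) (by linarith)

/-- Approximate minimality on the scale `n^{-1/2}`. -/
theorem eventually_neg_le_crit_sub (hD : D.Basic) (hL : L.Regular) {e : ℝ} (he : 0 < e) :
    ∀ᶠ n : ℕ in atTop, ∀ (zs : Fin n → 𝒳 × 𝒴) (b : Fin n → ℝ) (C : Set (Par dθ H)) (a : Par dθ H),
      D.ApproxMin n zs b C a → a ∈ L.Nosn n → ∀ a' ∈ L.Nosn n, ∀ t ∈ L.T n,
      a' + t • L.u n ∈ C → -e ≤ n * (D.crit n zs b (a' + t • L.u n) - D.crit n zs b a) := by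
  filter_upwards [hL.pen_negl (e / 2) (by positivity),
    hD.η_small.eventually (gt_mem_nhds (show (0 : ℝ) < e / 2 by positivity))] with n h1 h2
    zs b C a ha haN a' ha' t ht hmem
  have h3 := h1 a' ha' a haN t ht 0 (zero_mem_T hL n)
  rw [zero_smul, add_zero] at h3
  have h4 := ha.2 _ hmem
  have hn0 : (0 : ℝ) ≤ n := Nat.cast_nonneg n
  have h5 : n * (D.lam n * (D.Pen (a' + t • L.u n).2 - D.Pen a.2)) ≤ e / 2 :=
    (mul_le_mul_of_nonneg_left
      (mul_le_mul_of_nonneg_left (le_abs_self _) (hD.lam_pos n).le) hn0).trans h3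
  nlinarith [mul_le_mul_of_nonneg_left h4 hn0]

/-- Here `p = √n δ_n` and the minimum is the step length `x` used below. Since `4 M² p < K`, the
step is at least a fixed multiple of `p`, while `p ≤ K / M`; hence `p²` is small compared with `x`
once `M` is large. -/
theorem sq_radius_le {K κ M p : ℝ} (hK : 1 ≤ K) (hκ0 : 0 < κ) (hκ1 : κ ≤ 1) (hM1 : 1 ≤ M)
    (hp0 : 0 < p) (hbad : 4 * M ^ 2 * p < K) :
    p ^ 2 ≤ min κ (4 * M ^ 2 * p) * (K * K / κ / M) ∧ M * p ≤ K / M := by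
  have hM0 : 0 < M := by linarith
  have hK0 : 0 < K := by linarith
  set x := min κ (4 * M ^ 2 * p) with hx
  have hx0 : 0 < x := lt_min hκ0 (by positivity)
  have h1 : κ / K * (4 * M ^ 2 * p) ≤ x := by
    refine le_min ?_ ?_
    · calc κ / K * (4 * M ^ 2 * p) ≤ κ / K * K := by gcongr
        _ = κ := by field_simp
    · refine mul_le_of_le_one_left (by positivity) ?_
      rw [div_le_one (by linarith)]
      linarith
  have h2 : M * p ≤ K / M := by
    rw [le_div_iff₀ hM0]
    have := mul_pos (mul_pos hM0 hM0) hp0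
    linarith
  have h4 : p ≤ M * p := le_mul_of_one_le_left hp0.le hM1
  have h5 : p ≤ 4 * M ^ 2 * p := le_mul_of_one_le_left hp0.le (by nlinarith)
  have h3 : p ≤ x * (K / κ) := by
    calc p ≤ (κ / K * (4 * M ^ 2 * p)) * (K / κ) := by
          have : (κ / K * (4 * M ^ 2 * p)) * (K / κ) = 4 * M ^ 2 * p := by field_simp
          rw [this]; exact h5
      _ ≤ x * (K / κ) := by gcongr
  refine ⟨?_, h2⟩
  calc p ^ 2 = p * p := sq p
    _ ≤ (x * (K / κ)) * (K / M) := mul_le_mul h3 (h4.trans h2) hp0.le (by positivity)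
    _ = x * (K * K / κ / M) := by ring

/-- At sample sizes for which the neighbourhoods are small compared to `n^{-1/2}`, the score is
small. -/
theorem wpa1_score_le_of_radius_lt (hD : D.Basic) (hL : L.Regular) (hQ : L.LQA) {K₀ : ℝ}
    (hest : Wpa1 D.P fun n z => D.Admissible K₀ n (obs n z) (fun _ => 1) (D.αhat n (obs n z)))
    (hN : Wpa1 D.P fun n z => D.αhat n (obs n z) ∈ L.Nosn n) {K : ℝ} (hK : 1 ≤ K) :
    Wpa1 D.P fun n z => 4 * L.Mseq n ^ 2 * (√n * L.δ n) < K →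
      |√n * L.Z n (obs n z) fun _ => 1| ≤ 1 / 8 := by
  obtain ⟨c, hc, C, hC, hu⟩ := exists_wnorm_u_bounds hD hL
  refine Wpa1.of_tight hQ.B_bdd.tight fun β hβ => ?_
  -- With steps at most `κ`, both `x²` and the curvature term `B x²` are at most `x / 64`.
  set κ := 1 / (64 * (β + 1)) with hκ
  have hκ0 : 0 < κ := by positivity
  have hκβ : β * κ ≤ 1 / 64 := by
    rw [hκ, mul_one_div, div_le_div_iff₀ (by positivity) (by norm_num)]
    linarith
  have hκ64 : κ ≤ 1 / 64 := by
    rw [hκ]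
    exact one_div_le_one_div_of_le (by norm_num) (by linarith)
  set K₁ := |K₀| + 1 with hK₁
  have hK₁0 : 0 < K₁ := by positivity
  refine (((hest.and hN).and (wpa1_expands hQ (show (0 : ℝ) < 1 / 64 by norm_num))).and
    hD.posDef_SigHat).mono ?_
  filter_upwards [hL.δ_max, eventually_sd_pos hQ, eventually_gt_atTop 0,
    (tendsto_Mseq hL).eventually_ge_atTop (1 + 64 * (K₁ * (K * K) / κ) + 64 * (√C * K))]
    with n hmax hsd hn hM z ⟨⟨⟨hadm, hα⟩, hexp⟩, hpd⟩ hB hbad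
  have hlam : D.lam n ≤ L.δ n ^ 2 := ((le_max_right _ _).trans (le_max_left _ _)).trans hmax
  have hη : D.η n ≤ L.δ n ^ 2 := (le_max_right _ _).trans hmax
  have hcrit0 := hadm.2.2
  have hα2 := hα.2.1
  have huC := (hu n hsd).2.1
  have hexpa := fun y => abs_incr_sub_le_max hn hexp hα (x := y)
  have hpos := fun y : ℝ => crit_nonneg hpd (fun _ => 1) (D.αhat n (obs n z) + (y / √n) • L.u n)
  generalize D.αhat n (obs n z) = a at *
  generalize hslope : slope L n (obs n z) (fun _ => 1) a = S at *
  have hδ := hL.δ_pos n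
  have hn0 : (0 : ℝ) < n := by exact_mod_cast hn
  have hs : 0 < √(n : ℝ) := Real.sqrt_pos.2 hn0
  have hs2 : √(n : ℝ) ^ 2 = n := Real.sq_sqrt hn0.le
  have hTdef : ∀ t, |t| ≤ 4 * L.Mseq n ^ 2 * L.δ n → t ∈ L.T n := fun t h => h
  generalize L.Mseq n = M at *
  have hp0 : 0 < √n * L.δ n := by positivity
  have hX1 : 0 ≤ K₁ * (K * K) / κ := by positivity
  have hX2 : 0 ≤ √C * K := by positivity
  have hM1 : 1 ≤ M := by linarith
  have hM0 : 0 < M := by linarith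
  obtain ⟨hp2, hMp⟩ := sq_radius_le hK hκ0 (hκ64.trans (by norm_num)) hM1 hp0 hbad
  have hpn : (√n * L.δ n) ^ 2 = n * L.δ n ^ 2 := by rw [mul_pow, hs2]
  have hT : ∀ y, |y| = min κ (4 * M ^ 2 * (√n * L.δ n)) → y / √n ∈ L.T n := fun y hy => by
    refine hTdef _ ?_
    rw [abs_div, hy, abs_of_pos hs, div_le_iff₀ hs]
    calc _ ≤ 4 * M ^ 2 * (√n * L.δ n) := min_le_right _ _
      _ = _ := by ring
  have hx0 : 0 < min κ (4 * M ^ 2 * (√n * L.δ n)) := lt_min hκ0 (by positivity)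
  have hxκ : min κ (4 * M ^ 2 * (√n * L.δ n)) ≤ κ := min_le_left _ _
  generalize min κ (4 * M ^ 2 * (√n * L.δ n)) = x at *
  have hK₁p : K₁ * (√n * L.δ n) ^ 2 ≤ x * (1 / 64) := by
    have h1 : K₁ * (K * K / κ / M) ≤ 1 / 64 := by
      have : K₁ * (K * K / κ / M) = (K₁ * (K * K) / κ) / M := by ring
      rw [this, div_le_iff₀ hM0]
      linarith
    calc K₁ * (√n * L.δ n) ^ 2 ≤ K₁ * (x * (K * K / κ / M)) := by gcongr
      _ = x * (K₁ * (K * K / κ / M)) := by ring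
      _ ≤ x * (1 / 64) := by gcongr
  -- The criterion is at most `|K₀| δ²` at the estimator and nonnegative at the perturbed point, so
  -- its rescaled increment is at least `-|K₀| p²`. No minimality is used, and `p²` is negligible
  -- relative to the step.
  have hcrit : ∀ y, |y| = x → -(2 * y * S) ≤ x * (1 / 8) := fun y hy => by
    have h1 := (abs_le.1 (hexpa y (hT y hy))).2
    have h4 : n * D.crit n (obs n z) (fun _ => 1) a ≤ |K₀| * (√n * L.δ n) ^ 2 := by
      have h5 : D.crit n (obs n z) (fun _ => 1) a ≤ |K₀| * L.δ n ^ 2 :=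
        hcrit0.trans ((mul_le_mul_of_nonneg_right (le_abs_self K₀) (hD.lam_pos n).le).trans
          (mul_le_mul_of_nonneg_left hlam (abs_nonneg K₀)))
      rw [hpn, mul_left_comm]
      exact mul_le_mul_of_nonneg_left h5 hn0.le
    have h2 : -(|K₀| * (√n * L.δ n) ^ 2) ≤ incr L n (obs n z) (fun _ => 1) a y := by
      rw [incr]
      linarith [mul_nonneg hn0.le (hpos y)]
    have h9 : n * D.η n ≤ (√n * L.δ n) ^ 2 := by
      rw [hpn]
      exact mul_le_mul_of_nonneg_left hη hn0.le
    have hy2 : y ^ 2 = x ^ 2 := by rw [← sq_abs, hy]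
    have hx2 : x ^ 2 ≤ x * (1 / 64) := by
      rw [sq]
      exact mul_le_mul_of_nonneg_left (hxκ.trans hκ64) hx0.le
    have hBx : L.B n (obs n z) * x ^ 2 ≤ x * (1 / 64) := by
      calc L.B n (obs n z) * x ^ 2 ≤ β * x ^ 2 :=
            mul_le_mul_of_nonneg_right ((le_abs_self _).trans hB) (sq_nonneg x)
        _ = x * (β * x) := by ring
        _ ≤ x * (β * κ) := by gcongr
        _ ≤ x * (1 / 64) := by gcongr
    rw [hy2, hy] at h1
    have hp2' := sq_nonneg (√n * L.δ n)
    have hmx : max (max (x ^ 2) x) (n * D.η n) ≤ x ^ 2 + x + (√n * L.δ n) ^ 2 :=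
      max_le (max_le (by linarith) (by linarith [sq_nonneg x])) (by linarith [sq_nonneg x])
    have hK₁' : K₁ * (√n * L.δ n) ^ 2 = |K₀| * (√n * L.δ n) ^ 2 + (√n * L.δ n) ^ 2 := by
      rw [hK₁]; ring
    linarith
  have hS : |S| ≤ 1 / 16 := by
    have h1 := hcrit x (abs_of_pos hx0)
    have h2 := hcrit (-x) (by rw [abs_neg, abs_of_pos hx0])
    rw [abs_le]
    constructor
    · by_contra! hcon
      nlinarith
    · by_contra! hcon
      nlinarith
  -- The drift is at most `√C M p ≤ √C K / M`, so the score inherits the smallness of the slope.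
  have hγ : |√n * L.winner (L.u n) (a - D.α₀)| ≤ 1 / 64 := by
    have h1 := abs_winner_le hD hL (L.u n) (a - D.α₀)
    have h2 : L.wnorm (L.u n) ≤ √C := Real.le_sqrt_of_sq_le huC
    rw [abs_mul, abs_of_pos hs]
    calc √n * |L.winner (L.u n) (a - D.α₀)| ≤ √n * (√C * (M * L.δ n)) :=
          mul_le_mul_of_nonneg_left
            (h1.trans (mul_le_mul h2 hα2 (wnorm_nonneg _) (Real.sqrt_nonneg _))) hs.le
      _ = √C * (M * (√n * L.δ n)) := by ring
      _ ≤ √C * (K / M) := by gcongr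
      _ ≤ 1 / 64 := by
          rw [← mul_div_assoc, div_le_iff₀ hM0]
          linarith
  have hZ : √n * L.Z n (obs n z) (fun _ => 1) = S - √n * L.winner (L.u n) (a - D.α₀) := by
    rw [← hslope, slope]; ring
  rw [hZ]
  have := abs_sub S (√n * L.winner (L.u n) (a - D.α₀))
  linarith

/-- The perturbations of size `n^{-1/2}` are eventually allowed. -/
theorem eventually_div_sqrt_mem_T (hD : D.Basic) (hL : L.Regular) (hQ : L.LQA) {K₀ : ℝ}
    (hest : Wpa1 D.P fun n z => D.Admissible K₀ n (obs n z) (fun _ => 1) (D.αhat n (obs n z)))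
    (hN : Wpa1 D.P fun n z => D.αhat n (obs n z) ∈ L.Nosn n) (K : ℝ) :
    ∀ᶠ n : ℕ in atTop, ∀ x, |x| ≤ K → x / √n ∈ L.T n := by
  wlog hK : 1 ≤ K generalizing K
  · exact (this (max K 1) (le_max_right _ _)).mono fun n hn x hx => hn x (hx.trans (le_max_left _ _))
  filter_upwards [wpa1_iff.1 (wpa1_score_le_of_radius_lt hD hL hQ hest hN hK) (1 / 4) (by norm_num),
    eventually_abs_measureReal_sub_absNormalCDF_le hQ.normal (show (0 : ℝ) < 1 / 12 by norm_num),
    eventually_gt_atTop 0] with n h1 h2 hn x hx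
  have hn0 : (0 : ℝ) < n := by exact_mod_cast hn
  have hs : 0 < √(n : ℝ) := Real.sqrt_pos.2 hn0
  by_cases hbad : 4 * L.Mseq n ^ 2 * (√n * L.δ n) < K
  · exfalso
    -- The score would be at most 1/8 in absolute value with probability at least 3/4, whereas
    -- approximate normality allows at most `2 / 8 + 3 / 12 = 1 / 2`.
    have h3 := (abs_le.1 (h2 (1 / 8))).2
    have h4 := absNormalCDF_add_le 0 (show (0 : ℝ) ≤ 1 / 8 by norm_num)
    rw [absNormalCDF_zero, zero_add] at h4
    have h5 : D.P.real {z | ¬ |√n * L.Z n (obs n z) fun _ => 1| ≤ 1 / 8} ≤ 1 / 4 := by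
      refine ENNReal.toReal_le_of_le_ofReal (by norm_num) ?_
      simpa only [hbad, true_imp_iff] using h1
    have h6 : D.P.real univ ≤ D.P.real ({z | |√n * L.Z n (obs n z) fun _ => 1| ≤ 1 / 8} ∪
        {z | ¬ |√n * L.Z n (obs n z) fun _ => 1| ≤ 1 / 8}) :=
      measureReal_mono fun z _ => em _
    have h7 := h6.trans (measureReal_union_le _ _)
    rw [probReal_univ] at h7
    linarith
  · have : |x / √n| ≤ 4 * L.Mseq n ^ 2 * L.δ n := by
      rw [abs_div, abs_of_pos hs, div_le_iff₀ hs]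
      calc |x| ≤ K := hx
        _ ≤ _ := not_lt.1 hbad
        _ = _ := by ring
    exact this

end Model


namespace Model

variable {dθ dρ : ℕ} {H 𝒳 𝒴 W : Type*} [NormedAddCommGroup H] [NormedSpace ℝ H]
  [MeasurableSpace 𝒳] [MeasurableSpace 𝒴] [MeasurableSpace W]
  {D : Model dθ dρ H 𝒳 𝒴 W} {L : Loc D}

/-! ### Quadratic representation of the likelihood ratio type statistics -/

/-- The slope at an unrestricted approximate minimizer is small. -/
theorem eventually_abs_slope_le (hD : D.Basic) (hL : L.Regular) (hQ : L.LQA)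
    (hT : ∀ K, ∀ᶠ n : ℕ in atTop, ∀ x, |x| ≤ K → x / √n ∈ L.T n) {β ε : ℝ} (hβ : 0 ≤ β)
    (hε : 0 < ε) : ∃ e > 0, ∀ᶠ n : ℕ in atTop,
      ∀ (zs : Fin n → 𝒳 × 𝒴) (b : Fin n → ℝ) (curv : ℝ) (a : Par dθ H), |curv| ≤ β →
        Expands L e n zs b curv → a ∈ L.Nosn n → D.ApproxMin n zs b (D.sieveSpace n) a →
        |slope L n zs b a| ≤ ε := by
  -- Chosen so that `(β + 2) √e₁ ≤ ε`. The factor 6 below is the expansion error `2 (K² + K + 1)` at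
  -- `K = 1`.
  set e₁ := min 1 ((ε / (β + 2)) ^ 2) with he₁
  have he₁0 : 0 < e₁ := lt_min one_pos (by positivity)
  refine ⟨e₁ / 6, by positivity, ?_⟩
  filter_upwards [hT 1, hQ.perturb, eventually_neg_le_crit_sub hD hL he₁0, eventually_gt_atTop 0,
    hD.η_small.eventually (gt_mem_nhds one_pos)] with n hT hpert hmin hn hη zs b curv a hcurv hexp haN ha
  have h1 := abs_slope_le_of_approx_quadratic (F := incr L n zs b a) (d := slope L n zs b a)
    (B := curv) he₁0 (min_le_left _ _)
    (fun x hx => by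
      refine (abs_incr_sub_le (by positivity) hn hη.le hexp haN hx (hT x hx)).trans (le_of_eq ?_)
      ring)
    (fun x hx => hmin zs b _ a ha haN a haN _ (hT x hx) (hpert a haN _ (hT x hx)))
  refine h1.trans ?_
  have h2 : √e₁ ≤ ε / (β + 2) := by
    rw [Real.sqrt_le_left (by positivity)]
    exact min_le_right _ _
  calc (|curv| + 2) * √e₁ ≤ (β + 2) * (ε / (β + 2)) := by gcongr
    _ = ε := by field_simp

/-- Difference between the restricted and the unrestricted minimum of a criterion. -/
theorem eventually_abs_crit_sub_le (hD : D.Basic) (hL : L.Regular) (hQ : L.LQA)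
    (hT : ∀ K, ∀ᶠ n : ℕ in atTop, ∀ x, |x| ≤ K → x / √n ∈ L.T n) {Y ε : ℝ} (hY : 0 ≤ Y)
    (hε : 0 < ε) : ∃ e > 0, ∀ᶠ n : ℕ in atTop,
      ∀ (zs : Fin n → 𝒳 × 𝒴) (b : Fin n → ℝ) (curv : ℝ) (aU aR : Par dθ H) (φ₀ g : ℝ),
        |√n * (L.Z n zs b + g)| ≤ Y → |curv - L.wnorm (L.u n) ^ 2| ≤ e →
        Expands L e n zs b curv → aU ∈ L.Nosn n → aR ∈ L.Nosn n →
        D.ApproxMin n zs b (D.sieveSpace n) aU →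
        D.ApproxMin n zs b {α ∈ D.sieveSpace n | D.φ α = φ₀} aR →
        |√n * ((φ₀ - D.φ D.α₀) / L.sd n) - √n * g| ≤ e →
        |n * (D.crit n zs b aR - D.crit n zs b aU)
          - (√n * (L.Z n zs b + g)) ^ 2 / L.wnorm (L.u n) ^ 2| ≤ ε := by
  -- The number `g` is the value of `⟨u, α - α₀⟩` that the restriction prescribes: 0 for the
  -- original sample under the null, and its value at `αhat` for the bootstrap.
  obtain ⟨c, hc, C, hC, hu⟩ := exists_wnorm_u_bounds hD hL
  set K := (Y + 2) / c with hK
  have hK0 : 0 < K := by positivity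
  set e₁ := min 1 (ε / (K ^ 2 + 6 * K + 2)) with he₁
  have he₁0 : 0 < e₁ := lt_min one_pos (by positivity)
  have he₁1 : e₁ ≤ 1 := min_le_left _ _
  obtain ⟨e₂, he₂, hslope⟩ := eventually_abs_slope_le hD hL hQ hT
    (show (0 : ℝ) ≤ C + 1 by positivity) he₁0
  -- Makes the expansion error over displacements `|x| ≤ K` equal to `e₁`.
  set e₃ := e₁ / (2 * (K ^ 2 + K + 1)) with he₃
  have he₃0 : 0 < e₃ := by positivity
  have he₃1 : e₃ ≤ e₁ / 2 := by
    rw [he₃]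
    refine div_le_div_of_nonneg_left he₁0.le two_pos ?_
    nlinarith [sq_nonneg K]
  refine ⟨min e₂ e₃, lt_min he₂ he₃0, ?_⟩
  filter_upwards [hslope, hT K, hQ.perturb, eventually_neg_le_crit_sub hD hL he₁0,
    eventually_gt_atTop 0, hD.η_small.eventually (gt_mem_nhds one_pos), eventually_sd_pos hQ,
    eventually_φ_linear hD hL hQ (show 0 < e₁ / 2 by positivity)]
    with n hslope hT hpert hmin hn hη hsd hφ zs b curv aU aR φ₀ g hy hcurv hexp hU hR haU haR hg
  have hn0 : (0 : ℝ) < n := by exact_mod_cast hn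
  have hs : 0 < √(n : ℝ) := Real.sqrt_pos.2 hn0
  obtain ⟨hcs, hsC, -, -⟩ := hu n hsd
  set s := L.wnorm (L.u n) ^ 2 with hs_def
  have hg' := hg.trans ((min_le_right _ _).trans he₃1)
  have hcurv' := hcurv.trans ((min_le_right _ _).trans he₃1)
  have hexp3 : Expands L e₃ n zs b curv := hexp.mono (min_le_right _ _)
  have hexpK : ∀ α ∈ L.Nosn n, ∀ x, |x| ≤ K →
      |incr L n zs b α x - (2 * x * slope L n zs b α + curv * x ^ 2)| ≤ e₁ := fun α hα x hx => by
    refine (abs_incr_sub_le he₃0.le hn hη.le hexp3 hα hx (hT x hx)).trans (le_of_eq ?_)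
    rw [he₃]
    field_simp
  have habs : |curv| ≤ C + 1 := by
    have h1 := abs_le.1 hcurv'
    rw [abs_le]
    constructor <;> nlinarith
  have hdU := hslope zs b curv aU habs (hexp.mono (min_le_left _ _)) hU haU
  have hdR : |slope L n zs b aR - √n * (L.Z n zs b + g)| ≤ e₁ := by
    have h1 := hφ aR hR 0 (zero_mem_T hL n)
    rw [zero_smul, add_zero, zero_mul, add_zero, haR.1.2] at h1
    have h2 : slope L n zs b aR - √n * (L.Z n zs b + g)
        = √n * L.winner (L.u n) (aR - D.α₀) - √n * g := by rw [slope]; ring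
    rw [h2]
    rw [abs_le] at h1 hg' ⊢
    constructor <;> linarith
  refine (abs_sub_sq_div_le_of_approx_quadratic (FU := incr L n zs b aU) (FR := incr L n zs b aR)
    (h := fun x => √n * ((D.φ (aU + (x / √n) • L.u n) - φ₀) / L.sd n)) (e := e₁)
    hc hcs hy he₁0.le he₁1 (hcurv'.trans (by linarith)) hdU hdR ?_ ?_ (hexpK aU hU) (hexpK aR hR)
    ?_ ?_).trans ?_
  · have := hD.cont_φ
    fun_prop
  · intro x hx
    have h1 := hφ aU hU _ (hT x hx)
    have h2 : √n * ((D.φ (aU + (x / √n) • L.u n) - φ₀) / L.sd n)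
        - (x * s + slope L n zs b aU - √n * (L.Z n zs b + g))
        = (√n * ((D.φ (aU + (x / √n) • L.u n) - D.φ D.α₀) / L.sd n)
          - √n * (L.winner (L.u n) (aU - D.α₀) + x / √n * s))
          - (√n * ((φ₀ - D.φ D.α₀) / L.sd n) - √n * g) := by
      have h3 : √n * (x / √n * s) = x * s := by field_simp
      rw [slope, mul_add √(n : ℝ) (L.winner (L.u n) (aU - D.α₀)), h3]
      ring
    rw [h2]
    rw [abs_le] at h1 hg' ⊢
    constructor <;> linarith
  · intro x hx hx0
    have h1 : D.φ (aU + (x / √n) • L.u n) = φ₀ := by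
      rcases mul_eq_zero.1 hx0 with h | h
      · exact absurd h hs.ne'
      · rcases div_eq_zero_iff.1 h with h | h
        · linarith
        · exact absurd h hsd.ne'
    have h2 := hmin zs b _ aR haR hR aU hU _ (hT x hx) ⟨hpert aU hU _ (hT x hx), h1⟩
    rw [incr]
    linarith
  · intro x hx
    have h2 := hmin zs b _ aU haU hU aR hR _ (hT x hx) (hpert aR hR _ (hT x hx))
    rw [incr]
    linarith
  · calc _ ≤ (K ^ 2 + 6 * K + 2) * (ε / (K ^ 2 + 6 * K + 2)) := by
          gcongr
          exact min_le_right _ _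
      _ = ε := by field_simp

/-- This first-order condition cancels the original score `Z_n` from the bootstrap slope. -/
theorem littleOP_slope_αhat (hD : D.Basic) (hL : L.Regular) (hQ : L.LQA)
    (hT : ∀ K, ∀ᶠ n : ℕ in atTop, ∀ x, |x| ≤ K → x / √n ∈ L.T n)
    (hN : Wpa1 D.P fun n z => D.αhat n (obs n z) ∈ L.Nosn n) :
    LittleOP D.P fun n z => slope L n (obs n z) (fun _ => 1) (D.αhat n (obs n z)) := by
  rw [littleOP_iff]
  intro ε hε
  refine Wpa1.of_tight hQ.B_bdd.tight fun β hβ => ?_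
  obtain ⟨e, he, hslope⟩ := eventually_abs_slope_le hD hL hQ hT hβ.le hε
  refine ((hN.and (wpa1_expands hQ he)).and hD.est).mono ?_
  filter_upwards [hslope] with n hn z ⟨⟨h1, h2⟩, h3⟩ hB
  exact hn _ _ _ _ hB h2 h1 h3

theorem bigOP_score (hQ : L.LQA) : BigOP D.P fun n z => √n * L.Z n (obs n z) fun _ => 1 := by
  intro ε hε
  obtain ⟨K, hK, hK0⟩ := ((tendsto_absNormalCDF.eventually
    (lt_mem_nhds (show 1 - ε / 2 < 1 by linarith))).and (eventually_gt_atTop 0)).exists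
  refine ⟨K, hK0, ?_⟩
  filter_upwards [eventually_abs_measureReal_sub_absNormalCDF_le hQ.normal
    (show 0 < ε / 6 by positivity)] with n hn
  have h1 := (abs_le.1 (hn K)).1
  have hm : NullMeasurableSet {z | |√n * L.Z n (obs n z) fun _ => 1| ≤ K} D.P := by
    have h2 : MeasurableSet {x : ℝ | |x| ≤ K} := measurableSet_le measurable_id.abs measurable_const
    exact (hQ.normal.forall_aemeasurable n).nullMeasurableSet_preimage h2
  have h3 : {z | K < |√n * L.Z n (obs n z) fun _ => 1|}
      = {z | |√n * L.Z n (obs n z) fun _ => 1| ≤ K}ᶜ := by ext; simp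
  have h4 : D.P.real {z | K < |√n * L.Z n (obs n z) fun _ => 1|} ≤ ε := by
    rw [h3, measureReal_compl₀ hm, probReal_univ]
    linarith
  exact (ENNReal.le_ofReal_iff_toReal_le (by finiteness) hε.le).2 h4

/-- Quadratic representation of the statistic based on the original sample. -/
theorem littleOP_SQLR_sub (hD : D.Basic) (hL : L.Regular) (hQ : L.LQA)
    (hT : ∀ K, ∀ᶠ n : ℕ in atTop, ∀ x, |x| ≤ K → x / √n ∈ L.T n)
    (hN : Wpa1 D.P fun n z => D.αhat n (obs n z) ∈ L.Nosn n)
    {αR : (n : ℕ) → (Fin n → 𝒳 × 𝒴) → Par dθ H} {T : (n : ℕ) → (Fin n → 𝒳 × 𝒴) → ℝ}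
    (hR : D.IsRestrictedEst (D.φ D.α₀) αR) (hRN : Wpa1 D.P fun n z => αR n (obs n z) ∈ L.Nosn n)
    (hB : LittleOP D.P fun n z => L.B n (obs n z) - L.wnorm (L.u n) ^ 2) (hS : D.IsSQLR αR T) :
    LittleOP D.P fun n z => T n (obs n z)
      - (√n * L.Z n (obs n z) fun _ => 1) ^ 2 / L.wnorm (L.u n) ^ 2 := by
  rw [littleOP_iff]
  intro ε hε
  refine Wpa1.of_tight (bigOP_score hQ).tight fun Y hY => ?_
  obtain ⟨e, he, hcrit⟩ := eventually_abs_crit_sub_le hD hL hQ hT hY.le (half_pos hε)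
  refine ((((((littleOP_iff.1 hB e he).and (wpa1_expands hQ he)).and hN).and hRN).and
    hD.est).and (hR.and (littleOP_iff.1 hS _ (half_pos hε)))).mono ?_
  filter_upwards [hcrit] with n hn z ⟨⟨⟨⟨⟨h1, h2⟩, h3⟩, h4⟩, h5⟩, h6, h7⟩ hy
  have h8 := hn (obs n z) (fun _ => 1) _ _ _ _ 0 (by rwa [add_zero]) h1 h2 h3 h4 h5 h6
    (by simp [he.le])
  rw [add_zero] at h8
  have h9 : |T n (obs n z) - n * (D.crit n (obs n z) (fun _ => 1) (αR n (obs n z))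
    - D.crit n (obs n z) (fun _ => 1) (D.αhat n (obs n z)))| ≤ ε / 2 := h7
  rw [abs_le] at h8 h9 ⊢
  constructor <;> linarith

theorem Z_sub (n : ℕ) (zs : Fin n → 𝒳 × 𝒴) (b : Fin n → ℝ) :
    L.Z n zs b = L.Z n zs (fun i => b i - 1) + L.Z n zs fun _ => 1 := by
  simp only [Loc.Z, ← mul_add, ← Finset.sum_add_distrib]
  congr 1
  exact Finset.sum_congr rfl fun i _ => by ring

theorem measurable_bootScore (hD : D.Basic) (n : ℕ) (z : ℕ → 𝒳 × 𝒴) :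
    Measurable (L.bootScore n z) := by
  unfold Loc.bootScore Loc.Z
  refine ((Finset.measurable_fun_sum _ fun i _ => ?_).const_mul _).const_mul _
  exact ((hD.meas_ω n i).sub_const 1).mul_const _

/-- Conditionally on the data, the distribution function of the absolute bootstrap score converges
uniformly. -/
theorem wpa1_bootScore (hD : D.Basic) (hB : L.LQAB) {ε : ℝ} (hε0 : 0 < ε) (hε1 : ε ≤ 1) :
    Wpa1 D.P fun n z => ∀ y,
      |D.R.real {w | |L.bootScore n z w / D.σ| ≤ y} - absNormalCDF y| ≤ 3 * ε := by
  have h : Wpa1 D.P fun n z => ¬ ∃ f : ℝ → ℝ, (∀ x, |f x| ≤ 1) ∧ LipschitzWith 1 f ∧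
      ε ^ 2 < |∫ w, f (L.bootScore n z w / D.σ) ∂D.R - ∫ x, f x ∂(gaussianReal 0 1)| := by
    have := hB.normal (ε ^ 2) (by positivity)
    simpa only [Wpa1, not_not] using this
  refine h.mono (Eventually.of_forall fun n z hz y => ?_)
  refine abs_measureReal_sub_absNormalCDF_le ((measurable_bootScore hD n z).div_const _) hε0 hε1
    (fun f hf hfL => ?_) y
  by_contra! hcon
  exact hz ⟨f, hf, hfL, hcon⟩

theorem condBigOP_bootScore (hD : D.Basic) (hB : L.LQAB) :
    CondBigOP D.P D.R fun n z w => L.bootScore n z w / D.σ := by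
  intro ε hε
  obtain ⟨K, hK, hK0⟩ := ((tendsto_absNormalCDF.eventually
    (lt_mem_nhds (show 1 - ε / 2 < 1 by linarith))).and (eventually_gt_atTop 0)).exists
  refine ⟨K, hK0, ?_⟩
  suffices Wpa1 D.P fun n z => D.R {w | K < |L.bootScore n z w / D.σ|} ≤ ENNReal.ofReal ε by
    simpa only [Wpa1, not_le] using this
  refine (wpa1_bootScore hD hB (ε := min 1 (ε / 6)) (lt_min one_pos (by positivity))
    (min_le_left _ _)).mono (Eventually.of_forall fun n z hz => ?_)
  have h1 := (abs_le.1 (hz K)).1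
  have h2 : min 1 (ε / 6) ≤ ε / 6 := min_le_right _ _
  have hm : MeasurableSet {w | |L.bootScore n z w / D.σ| ≤ K} :=
    measurableSet_le ((measurable_bootScore hD n z).div_const _).abs measurable_const
  have h3 : {w | K < |L.bootScore n z w / D.σ|} = {w | |L.bootScore n z w / D.σ| ≤ K}ᶜ := by
    ext; simp
  have h4 : D.R.real {w | K < |L.bootScore n z w / D.σ|} ≤ ε := by
    rw [h3, measureReal_compl hm, probReal_univ]
    linarith
  exact (ENNReal.le_ofReal_iff_toReal_le (by finiteness) hε.le).2 h4

/-- Quadratic representation of the bootstrap statistic. -/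
theorem condLittleOP_bootSQLR_sub (hD : D.Basic) (hL : L.Regular) (hQ : L.LQA) (hB : L.LQAB)
    (hT : ∀ K, ∀ᶠ n : ℕ in atTop, ∀ x, |x| ≤ K → x / √n ∈ L.T n)
    (hN : Wpa1 D.P fun n z => D.αhat n (obs n z) ∈ L.Nosn n)
    (hNB : CondWpa1 D.P D.R fun n z w => D.αhatB n (obs n z) (D.wts n w) ∈ L.Nosn n)
    (hNRB : CondWpa1 D.P D.R fun n z w => D.αhatRB n (obs n z) (D.wts n w) ∈ L.Nosn n)
    (hBω : CondLittleOP D.P D.R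
      fun n z w => L.Bω n (obs n z) (D.wts n w) - L.wnorm (L.u n) ^ 2)
    {TB : (n : ℕ) → (Fin n → 𝒳 × 𝒴) → (Fin n → ℝ) → ℝ} (hTB : D.IsBootSQLR TB) :
    CondLittleOP D.P D.R fun n z w => TB n (obs n z) (D.wts n w)
      - L.bootScore n z w ^ 2 / L.wnorm (L.u n) ^ 2 := by
  obtain ⟨c, hc, C, hC, hu⟩ := exists_wnorm_u_bounds hD hL
  have hσ := hD.σ_pos
  rw [condLittleOP_iff]
  intro ε hε
  refine CondWpa1.of_tight (condBigOP_bootScore hD hB).tight fun Y hY => ?_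
  obtain ⟨e, he, hcrit⟩ := eventually_abs_crit_sub_le hD hL hQ hT
    (show 0 ≤ Y * D.σ + 1 by positivity) (show 0 < ε / 3 by positivity)
  set e' := min 1 (c * (ε / 3) / (2 * (Y * D.σ) + 1)) with he'
  have he'0 : 0 < e' := lt_min one_pos (by positivity)
  have hslope := (littleOP_iff.1 (littleOP_slope_αhat hD hL hQ hT hN) e' he'0).cond (R := D.R)
  refine (((((((condLittleOP_iff.1 hBω e he).and (condWpa1_expands hB he)).and hNB).and hNRB).and
    hD.estB).and (hD.estRB.and (condLittleOP_iff.1 hTB _ (show 0 < ε / 3 by positivity)))).and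
    (hN.cond.and hslope)).mono ?_
  filter_upwards [hcrit, eventually_φ_linear hD hL hQ he, eventually_sd_pos hQ]
    with n hn hφ hsd z w ⟨⟨⟨⟨⟨⟨h1, h2⟩, h3⟩, h4⟩, h5⟩, h6, h7⟩, h8, h9⟩ hy
  obtain ⟨hcs, -, -, -⟩ := hu n hsd
  set a := D.αhat n (obs n z) with ha
  set ζ := L.bootScore n z w with hζ
  set y := √n * (L.Z n (obs n z) (D.wts n w) + L.winner (L.u n) (a - D.α₀)) with hydef
  -- The score is linear in the weights, so the bootstrap slope at `αhat` is the centred bootstrap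
  -- score plus the original slope at `αhat`.
  have hyζ : y - ζ = slope L n (obs n z) (fun _ => 1) a := by
    rw [hydef, hζ, Loc.bootScore, Z_sub, slope]
    ring
  have hζY : |ζ| ≤ Y * D.σ := by
    rwa [abs_div, abs_of_pos hσ, div_le_iff₀ hσ] at hy
  have hye : |y - ζ| ≤ e' := by rwa [hyζ]
  have he'1 : e' ≤ 1 := min_le_left _ _
  have hyY : |y| ≤ Y * D.σ + 1 := by
    rw [abs_le] at hye hζY ⊢
    constructor <;> linarith
  have h10 := hφ a h8 0 (zero_mem_T hL n)
  rw [zero_smul, add_zero, zero_mul, add_zero] at h10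
  have h11 := hn (obs n z) (D.wts n w) _ _ _ _ (L.winner (L.u n) (a - D.α₀)) hyY h1 h2 h3 h4 h5 h6 h10
  have h12 : |y ^ 2 / L.wnorm (L.u n) ^ 2 - ζ ^ 2 / L.wnorm (L.u n) ^ 2| ≤ ε / 3 := by
    have hspos : 0 < L.wnorm (L.u n) ^ 2 := hc.trans_le hcs
    have h13 : y ^ 2 - ζ ^ 2 = (y - ζ) * (y + ζ) := by ring
    rw [← sub_div, abs_div, abs_of_pos hspos, div_le_iff₀ hspos, h13, abs_mul]
    have h14 : |y + ζ| ≤ 2 * (Y * D.σ) + 1 := (abs_add_le _ _).trans (by linarith)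
    calc |y - ζ| * |y + ζ| ≤ (c * (ε / 3) / (2 * (Y * D.σ) + 1)) * (2 * (Y * D.σ) + 1) :=
          mul_le_mul (hye.trans (min_le_right _ _)) h14 (abs_nonneg _) (by positivity)
      _ = ε / 3 * c := by field_simp
      _ ≤ ε / 3 * L.wnorm (L.u n) ^ 2 := by gcongr
  have h15 : |TB n (obs n z) (D.wts n w)
      - n * (D.crit n (obs n z) (D.wts n w) (D.αhatRB n (obs n z) (D.wts n w))
        - D.crit n (obs n z) (D.wts n w) (D.αhatB n (obs n z) (D.wts n w)))| ≤ ε / 3 := h7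
  rw [abs_le] at h11 h12 h15 ⊢
  constructor <;> linarith

end Model


namespace Model

variable {dθ dρ : ℕ} {H 𝒳 𝒴 W : Type*} [NormedAddCommGroup H] [NormedSpace ℝ H]
  [MeasurableSpace 𝒳] [MeasurableSpace 𝒴] [MeasurableSpace W]
  {D : Model dθ dρ H 𝒳 𝒴 W} {L : Loc D}

/-! ### Distribution of the statistics -/

/-- After multiplication by `s = ‖u‖²` the statistic is close to the squared score; the upper bound
on `s` keeps the error small. The approximating law depends on n through `s`. -/
theorem eventually_SQLR_cdf (hD : D.Basic) (hL : L.Regular) (hQ : L.LQA)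
    {T : (n : ℕ) → (Fin n → 𝒳 × 𝒴) → ℝ}
    (hT : LittleOP D.P fun n z => T n (obs n z)
      - (√n * L.Z n (obs n z) fun _ => 1) ^ 2 / L.wnorm (L.u n) ^ 2) {ε : ℝ} (hε : 0 < ε) :
    ∀ᶠ n in atTop, ∀ v,
      |D.P.real {z | T n (obs n z) ≤ v} - absNormalCDF √(L.wnorm (L.u n) ^ 2 * v)| ≤ ε ∧
      |D.P.real {z | v ≤ T n (obs n z)} - (1 - absNormalCDF √(L.wnorm (L.u n) ^ 2 * v))| ≤ ε := by
  obtain ⟨c, hc, C, hC, hu⟩ := exists_wnorm_u_bounds hD hL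
  filter_upwards [eventually_abs_measureReal_sub_absNormalCDF_le hQ.normal
    (show 0 < ε / 18 by positivity), eventually_sd_pos hQ,
    wpa1_iff.1 (littleOP_iff.1 hT ((ε / 6) ^ 2 / C) (by positivity)) (ε / 6) (by positivity)]
    with n h1 hsd h2 v
  obtain ⟨hcs, hsC, -, -⟩ := hu n hsd
  set s := L.wnorm (L.u n) ^ 2
  have hs : 0 < s := hc.trans_le hcs
  have h3 := abs_measureReal_sub_absNormalCDF_sqrt_le (U := fun z => s * T n (obs n z))
    (hQ.normal.forall_aemeasurable n) (show 0 < ε / 6 by positivity)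
    (fun y => (h1 y).trans (by linarith)) ?_ (s * v)
  · simp only [mul_le_mul_iff_right₀ hs] at h3
    exact ⟨h3.1.trans (by linarith), h3.2.trans (by linarith)⟩
  · refine ENNReal.toReal_le_of_le_ofReal (by positivity) (le_trans (measure_mono ?_) h2)
    intro z hz hz'
    refine hz ?_
    have h4 : s * T n (obs n z) - (√n * L.Z n (obs n z) fun _ => 1) ^ 2
        = s * (T n (obs n z) - (√n * L.Z n (obs n z) fun _ => 1) ^ 2 / s) := by
      field_simp
    rw [h4, abs_mul, abs_of_pos hs]
    calc _ ≤ C * ((ε / 6) ^ 2 / C) := mul_le_mul hsC hz' (abs_nonneg _) hC.le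
      _ = (ε / 6) ^ 2 := by field_simp

theorem wpa1_bootCDF (hD : D.Basic) (hL : L.Regular) (hQ : L.LQA) (hB : L.LQAB)
    {TB : (n : ℕ) → (Fin n → 𝒳 × 𝒴) → (Fin n → ℝ) → ℝ}
    (hTB : CondLittleOP D.P D.R fun n z w => TB n (obs n z) (D.wts n w)
      - L.bootScore n z w ^ 2 / L.wnorm (L.u n) ^ 2) {ε : ℝ} (hε0 : 0 < ε) (hε1 : ε ≤ 1) :
    Wpa1 D.P fun n z => ∀ v,
      |D.bootCDF TB n z v - absNormalCDF √(L.wnorm (L.u n) ^ 2 * v)| ≤ ε := by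
  obtain ⟨c, hc, C, hC, hu⟩ := exists_wnorm_u_bounds hD hL
  have hσ := hD.σ_pos
  refine ((wpa1_bootScore hD hB (ε := ε / 18) (by positivity) (by linarith)).and
    (condWpa1_iff.1 (condLittleOP_iff.1 hTB ((ε / 6) ^ 2 * D.σ ^ 2 / C) (by positivity))
      (ε / 6) (by positivity))).mono ?_
  filter_upwards [eventually_sd_pos hQ] with n hsd z ⟨h1, h2⟩ v
  obtain ⟨hcs, hsC, -, -⟩ := hu n hsd
  set s := L.wnorm (L.u n) ^ 2
  have hs : 0 < s := hc.trans_le hcs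
  have h3 := abs_measureReal_sub_absNormalCDF_sqrt_le
    (U := fun w => s * (TB n (obs n z) (D.wts n w) / D.σ ^ 2))
    ((measurable_bootScore hD n z).div_const D.σ).aemeasurable (show 0 < ε / 6 by positivity)
    (fun y => (h1 y).trans (by linarith)) ?_ (s * v)
  · simp only [mul_le_mul_iff_right₀ hs] at h3
    exact h3.1.trans (by linarith)
  · refine ENNReal.toReal_le_of_le_ofReal (by positivity) (le_trans (measure_mono ?_) h2)
    intro w hw hw'
    refine hw ?_
    have h4 : s * (TB n (obs n z) (D.wts n w) / D.σ ^ 2) - (L.bootScore n z w / D.σ) ^ 2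
        = s * (TB n (obs n z) (D.wts n w) - L.bootScore n z w ^ 2 / s) / D.σ ^ 2 := by
      field_simp
    rw [h4, abs_div, abs_mul, abs_of_pos hs, abs_of_pos (by positivity : 0 < D.σ ^ 2),
      div_le_iff₀ (by positivity)]
    calc _ ≤ C * ((ε / 6) ^ 2 * D.σ ^ 2 / C) := mul_le_mul hsC hw' (abs_nonneg _) hC.le
      _ = (ε / 6) ^ 2 * D.σ ^ 2 := by field_simp

theorem condLittleOP_bootSQLR_div (hD : D.Basic)
    {TB : (n : ℕ) → (Fin n → 𝒳 × 𝒴) → (Fin n → ℝ) → ℝ}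
    (hTB : CondLittleOP D.P D.R fun n z w => TB n (obs n z) (D.wts n w)
      - L.bootScore n z w ^ 2 / L.wnorm (L.u n) ^ 2) :
    CondLittleOP D.P D.R fun n z w => TB n (obs n z) (D.wts n w) / D.σ ^ 2
      - (L.bootScore n z w / (D.σ * L.wnorm (L.u n))) ^ 2 := by
  have hσ : 0 < D.σ ^ 2 := pow_pos hD.σ_pos 2
  rw [condLittleOP_iff] at hTB ⊢
  intro ε hε
  refine (hTB (ε * D.σ ^ 2) (by positivity)).mono (Eventually.of_forall fun n z w h => ?_)
  have h1 : (L.bootScore n z w / (D.σ * L.wnorm (L.u n))) ^ 2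
      = L.bootScore n z w ^ 2 / L.wnorm (L.u n) ^ 2 / D.σ ^ 2 := by
    rw [div_pow, mul_pow, div_div, mul_comm (D.σ ^ 2)]
  rwa [h1, ← sub_div, abs_div, abs_of_pos hσ, div_le_iff₀ hσ]

theorem condBigOP_bootSQLR_div (hD : D.Basic) (hL : L.Regular) (hQ : L.LQA) (hB : L.LQAB)
    {TB : (n : ℕ) → (Fin n → 𝒳 × 𝒴) → (Fin n → ℝ) → ℝ}
    (hTB : CondLittleOP D.P D.R fun n z w => TB n (obs n z) (D.wts n w) / D.σ ^ 2
      - (L.bootScore n z w / (D.σ * L.wnorm (L.u n))) ^ 2) :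
    CondBigOP D.P D.R fun n z w => TB n (obs n z) (D.wts n w) / D.σ ^ 2 := by
  obtain ⟨c, hc, C, hC, hu⟩ := exists_wnorm_u_bounds hD hL
  refine (condBigOP_bootScore hD hB).of_condWpa1 (f := fun K => 1 + K ^ 2 / c) fun K hK => ?_
  refine (condLittleOP_iff.1 hTB 1 one_pos).mono ?_
  filter_upwards [eventually_sd_pos hQ] with n hsd z w h hX
  have hcs := (hu n hsd).1
  have h1 : (L.bootScore n z w / (D.σ * L.wnorm (L.u n))) ^ 2 ≤ K ^ 2 / c := by
    rw [← div_div, div_pow]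
    refine div_le_div₀ (sq_nonneg K) ?_ hc hcs
    rw [← sq_abs]
    exact pow_le_pow_left₀ (abs_nonneg _) hX 2
  have h2 := sq_nonneg (L.bootScore n z w / (D.σ * L.wnorm (L.u n)))
  rw [abs_le] at h ⊢
  constructor <;> linarith

/-- Both distribution functions are uniformly close to the same function of `t`, so no limit law is
needed. -/
theorem littleOP_iSup_cdf_sub (hD : D.Basic) (hL : L.Regular) (hQ : L.LQA) (hB : L.LQAB)
    {TB : (n : ℕ) → (Fin n → 𝒳 × 𝒴) → (Fin n → ℝ) → ℝ}
    (hTB : CondLittleOP D.P D.R fun n z w => TB n (obs n z) (D.wts n w)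
      - L.bootScore n z w ^ 2 / L.wnorm (L.u n) ^ 2) {T : (n : ℕ) → (Fin n → 𝒳 × 𝒴) → ℝ}
    (hT : LittleOP D.P fun n z => T n (obs n z)
      - (√n * L.Z n (obs n z) fun _ => 1) ^ 2 / L.wnorm (L.u n) ^ 2) :
    LittleOP D.P fun n z =>
      ⨆ t : ℝ, |D.bootCDF TB n z t - D.P.real {z' | T n (obs n z') ≤ t}| := by
  rw [littleOP_iff]
  intro ε hε
  refine (wpa1_bootCDF hD hL hQ hB hTB (ε := min 1 (ε / 2)) (lt_min one_pos (by positivity))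
    (min_le_left _ _)).mono ?_
  filter_upwards [eventually_SQLR_cdf hD hL hQ hT (half_pos hε)] with n h1 z h2
  rw [abs_of_nonneg (Real.iSup_nonneg fun _ => abs_nonneg _)]
  refine ciSup_le fun t => ?_
  have h3 := (h1 t).1
  have h4 := (h2 t).trans (min_le_right _ _)
  rw [abs_le] at h3 h4 ⊢
  constructor <;> linarith

/-- Off an event of small probability the random quantile lies between two deterministic points, so
the rejection probability is sandwiched between survival probabilities at fixed thresholds; no joint
law of statistic and quantile is required. -/
theorem tendsto_bootQuantile (hD : D.Basic) (hL : L.Regular) (hQ : L.LQA) (hB : L.LQAB)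
    {TB : (n : ℕ) → (Fin n → 𝒳 × 𝒴) → (Fin n → ℝ) → ℝ}
    (hTB : CondLittleOP D.P D.R fun n z w => TB n (obs n z) (D.wts n w)
      - L.bootScore n z w ^ 2 / L.wnorm (L.u n) ^ 2) {T : (n : ℕ) → (Fin n → 𝒳 × 𝒴) → ℝ}
    (hT : LittleOP D.P fun n z => T n (obs n z)
      - (√n * L.Z n (obs n z) fun _ => 1) ^ 2 / L.wnorm (L.u n) ^ 2) {a : ℝ}
    (ha : a ∈ Ioo (0 : ℝ) 1) :
    Tendsto (fun n => D.P.real {z | D.bootQuantile TB n z (1 - a) ≤ T n (obs n z)}) atTop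
      (𝓝 a) := by
  rw [Metric.tendsto_nhds]
  intro ε hε
  obtain ⟨c, hc, C, hC, hu⟩ := exists_wnorm_u_bounds hD hL
  -- The sandwich loses `2 e` for the level of the thresholds, `e` for the survival function and `e`
  -- for the exceptional event; a fifth `e` makes the inequality strict. The other minima keep the
  -- levels of `y₁` and `y₂` in `(0, 1)`.
  set e := min ε (min a (1 - a)) / 5 with he
  have ha0 := ha.1
  have ha1 : 0 < 1 - a := sub_pos.2 ha.2
  have he0 : 0 < e := div_pos (lt_min hε (lt_min ha0 ha1)) (by norm_num)
  have h5e : 5 * e = min ε (min a (1 - a)) := by rw [he]; ring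
  have heε : 5 * e ≤ ε := h5e.trans_le (min_le_left _ _)
  have hea : 5 * e ≤ a := h5e.trans_le ((min_le_right _ _).trans (min_le_left _ _))
  have hea' : 5 * e ≤ 1 - a := h5e.trans_le ((min_le_right _ _).trans (min_le_right _ _))
  obtain ⟨y₁, hy₁, h₁⟩ := exists_absNormalCDF_eq (p := 1 - a - 2 * e) ⟨by linarith, by linarith⟩
  obtain ⟨y₂, hy₂, h₂⟩ := exists_absNormalCDF_eq (p := 1 - a + 2 * e) ⟨by linarith, by linarith⟩
  filter_upwards [eventually_SQLR_cdf hD hL hQ hT he0, eventually_sd_pos hQ,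
    wpa1_iff.1 (wpa1_bootCDF hD hL hQ hB hTB he0 (by linarith)) e he0] with n h3 hsd h4
  set s := L.wnorm (L.u n) ^ 2
  have hs : 0 < s := hc.trans_le (hu n hsd).1
  set E := {z | ¬ ∀ v, |D.bootCDF TB n z v - absNormalCDF √(s * v)| ≤ e} with hE
  have hPE : D.P.real E ≤ e := ENNReal.toReal_le_of_le_ofReal he0.le h4
  have hq : ∀ z ∉ E, D.bootQuantile TB n z (1 - a) ∈ Icc (y₁ ^ 2 / s) (y₂ ^ 2 / s) := fun z hz =>
    sInf_mem_Icc_of_approx hs (not_not.1 hz) hy₁.le hy₂.le (by linarith) (by linarith)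
  have hv : ∀ y, 0 < y → absNormalCDF √(s * (y ^ 2 / s)) = absNormalCDF y := fun y hy => by
    rw [mul_div_cancel₀ _ hs.ne', Real.sqrt_sq hy.le]
  have h5 := (abs_le.1 (h3 (y₁ ^ 2 / s)).2).2
  have h6 := (abs_le.1 (h3 (y₂ ^ 2 / s)).2).1
  rw [hv _ hy₁, h₁] at h5
  rw [hv _ hy₂, h₂] at h6
  have h7 : D.P.real {z | D.bootQuantile TB n z (1 - a) ≤ T n (obs n z)}
      ≤ D.P.real {z | y₁ ^ 2 / s ≤ T n (obs n z)} + D.P.real E := by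
    refine (measureReal_mono ?_).trans (measureReal_union_le _ _)
    intro z hz
    by_cases hzE : z ∈ E
    · exact Or.inr hzE
    · exact Or.inl ((hq z hzE).1.trans hz)
  have h8 : D.P.real {z | y₂ ^ 2 / s ≤ T n (obs n z)}
      ≤ D.P.real {z | D.bootQuantile TB n z (1 - a) ≤ T n (obs n z)} + D.P.real E := by
    refine (measureReal_mono ?_).trans (measureReal_union_le _ _)
    intro z hz
    by_cases hzE : z ∈ E
    · exact Or.inr hzE
    · exact Or.inl ((hq z hzE).2.trans hz)
  rw [Real.dist_eq, abs_lt]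
  constructor <;> linarith

end Model

end PSMD

/-! ### The theorem -/

theorem mainTheorem5 {dθ dρ : ℕ} {H 𝒳 𝒴 W : Type*} [NormedAddCommGroup H] [NormedSpace ℝ H]
    [MeasurableSpace 𝒳] [MeasurableSpace 𝒴] [MeasurableSpace W]
    (D : PSMD.Model dθ dρ H 𝒳 𝒴 W) (hD : D.Basic) :
    -- the bound `M₀` in the definition of the neighbourhoods has to be large enough
    ∃ Mlow : ℝ, ∀ L : PSMD.Model.Loc D, Mlow ≤ L.M₀ → L.Regular → L.LQA → L.LQAB →
      PSMD.CondLittleOP D.P D.R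
        (fun n z w => L.Bω n (PSMD.Model.obs n z) (D.wts n w) - L.wnorm (L.u n) ^ 2) →
      ∀ TB : (n : ℕ) → (Fin n → 𝒳 × 𝒴) → (Fin n → ℝ) → ℝ, D.IsBootSQLR TB →
        -- (1) quadratic representation and stochastic boundedness
        (PSMD.CondLittleOP D.P D.R (fun n z w =>
            TB n (PSMD.Model.obs n z) (D.wts n w) / D.σ ^ 2
              - (L.bootScore n z w / (D.σ * L.wnorm (L.u n))) ^ 2) ∧
          PSMD.CondBigOP D.P D.R (fun n z w =>
            TB n (PSMD.Model.obs n z) (D.wts n w) / D.σ ^ 2)) ∧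
        -- under the null hypothesis and the conditions for the null limit of the SQLR
        (∀ (φ₀ : ℝ) (αR : (n : ℕ) → (Fin n → 𝒳 × 𝒴) → PSMD.Par dθ H)
            (T : (n : ℕ) → (Fin n → 𝒳 × 𝒴) → ℝ),
          D.φ D.α₀ = φ₀ → D.IsRestrictedEst φ₀ αR →
          PSMD.Wpa1 D.P (fun n z => αR n (PSMD.Model.obs n z) ∈ L.Nosn n) →
          PSMD.LittleOP D.P
            (fun n z => L.B n (PSMD.Model.obs n z) - L.wnorm (L.u n) ^ 2) →
          D.IsSQLR αR T →
          -- (2) uniform consistency of the conditional distribution function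
          PSMD.CondLittleOP D.P D.R (fun n z _ =>
            ⨆ t : ℝ, |D.bootCDF TB n z t - D.P.real {z' | T n (PSMD.Model.obs n z') ≤ t}|) ∧
          -- (3) asymptotic validity of the bootstrap critical values
          (∀ a ∈ Set.Ioo (0 : ℝ) 1, Filter.Tendsto
            (fun n => D.P.real {z | D.bootQuantile TB n z (1 - a) ≤ T n (PSMD.Model.obs n z)})
            Filter.atTop (nhds a))) := by
  obtain ⟨K, hP, hest, hestB, hestRB⟩ := PSMD.Model.exists_admissible hD
  refine ⟨K, fun L hK hL hQ hB hBω TB hTB => ?_⟩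
  have hN := PSMD.Model.wpa1_αhat_mem_Nosn hD hL hK hP hest
  have hNB := PSMD.Model.condWpa1_mem_Nosn hD hL hK hP hestB
  have hNRB := PSMD.Model.condWpa1_mem_Nosn hD hL hK hP hestRB
  have hT := PSMD.Model.eventually_div_sqrt_mem_T hD hL hQ hest hN
  have hquad := PSMD.Model.condLittleOP_bootSQLR_sub hD hL hQ hB hT hN hNB hNRB hBω hTB
  have hdiv := PSMD.Model.condLittleOP_bootSQLR_div hD hquad
  refine ⟨⟨hdiv, PSMD.Model.condBigOP_bootSQLR_div hD hL hQ hB hdiv⟩, ?_⟩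
  rintro φ₀ αR T rfl hR hRN hBn hS
  have hS' := PSMD.Model.littleOP_SQLR_sub hD hL hQ hT hN hR hRN hBn hS
  exact ⟨PSMD.condLittleOP_of_littleOP
    (PSMD.Model.littleOP_iSup_cdf_sub hD hL hQ hB hquad hS'),
    fun a ha => PSMD.Model.tendsto_bootQuantile hD hL hQ hB hquad hS' ha⟩
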